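/- **Setup.** A graph $G$ is a finite set $V(G)$ of vertices and a finite set $H(G)$ of half-edges with a root map $r:H(G)\to V(G)$ and a fixed-point-free involution $\iota$ on $H(G)$; its edges are the $\iota$-orbits (loops and multiple edges are allowed), and its genus is $g(G)=|E(G)|-|V(G)|+1$. A double cover $p:\widetilde G\to G$ is a harmonic morphism of global degree two: maps on vertices and half-edges commuting with $r$ and $\iota$, and local degrees $d_p\in\mathbb Z_{>0}$ on the vertices and half-edges of $\widetilde G$ that agree on the two halves of each edge and satisfy $d_p(\widetilde v)=\sum_{\widetilde h\in r^{-1}(\widetilde v)\cap p^{-1}(h)}d_p(\widetilde h)$ for every vertex $\widetilde v$ and every half-edge $h$ rooted at $p(\widetilde v)$, such that the local degrees over each vertex and over each half-edge of $G$ sum to $2$. A vertex or half-edge of $G$ is dilated if it has a unique preimage, an edge is dilated if its half-edges are; $G_{\mathrm{dil}}$ is the subgraph of dilated vertices and edges, and $E_{\mathrm{ud}}(G)$ is the set of undilated edges. The cover is free if $G_{\mathrm{dil}}=\emptyset$ and dilated otherwise; it is the trivial free double cover if it is isomorphic over $G$ to $G\sqcup G\to G$. It is an elementary double cover if $G$ is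 connected and either (1) $p$ is dilated, $G_{\mathrm{dil}}$ is connected and $g(G_{\mathrm{dil}})=g(G)$; or (2) $p$ is free and not the trivial free double cover, and $g(G)=1$. It is relatively connected if the preimage of every connected component of $G$ is connected. All these notions are also applied to restrictions $p^{-1}(S)\to S$ to subgraphs $S\subset G$. For a set $F$ of edges, $G\setminus F$ is obtained by removing the edges in $F$ (keeping all vertices), and $G[F]$ is the minimal subgraph containing all edges in $F$. If $G$ is connected and $p$ is not the trivial free double cover, the signed cographic matroid $M^*(\widetilde G/G)$ has ground set $E_{\mathrm{ud}}(G)$, and $F\subset E_{\mathrm{ud}}(G)$ is independent if $\widetilde G\setminus p^{-1}(F)\to G\setminus F$ is relatively connected. The signed graphic matroid $M(\widetilde G/G)$ is its dual. **Proposition.** Let $p:\widetilde G\to G$ be a double cover of a connected graph $G$ that is not the trivial free double cover, and let $F\subset E_{\mathrm{ud}}(G)$. Let $G[F]=G_1\cup\dots\cup G_k$ be the decomposition into connected components, and let $p[F]:p^{-1}(G[F])\to G[F]$ and $p_i:p^{-1}(G_i)\to G_i$ be the restrictions of $p$. 1. $F$ is a basis of $M(\widetilde G/G)$ if and only if $G[F]$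 contains all undilated vertices of $G$ and each $p_i$ is an elementary double cover. 2. $F$ is independent in $M(\widetilde G/G)$ if and only if the map $p[F]_*:H_1(p^{-1}(G[F]),\mathbb Z)\to H_1(G[F],\mathbb Z)$ on simplicial homology is injective. 3. $F$ is a circuit of $M(\widetilde G/G)$ if and only if $G[F]$ is connected, has no undilated vertices of valency one, and either $g(G[F])=1$ and $p[F]$ is the trivial free double cover (type I), or $p[F]$ has one of the following types II–VI. Here each edge or loop of the description may be replaced by a chain of edges whose interior vertices are undilated and of valency two, and all vertices that are not said to be dilated are undilated: - II: two loops with connected preimage, at distinct vertices that are joined by an edge; - III: two loops with connected preimage at the same vertex; - IV: an edge joining a dilated vertex to a vertex that supports a loop with connected preimage; - V: a loop at a dilated vertex; - VI: an edge joining two distinct dilated vertices. -/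

import Mathlib

/-- A graph with vertex set `V` and half-edge set `H`: a root map and a fixed-point-free involution
on the half-edges. Loops and multiple edges are allowed. -/
structure HalfEdgeGraph (V H : Type*) where
  root : H → V
  inv : H → H
  inv_inv : ∀ h, inv (inv h) = h
  inv_ne : ∀ h, inv h ≠ h

namespace HalfEdgeGraph

/-- Two half-edges are equivalent if they lie in the same orbit of the involution. -/
def edgeSetoid {V H : Type*} (G : HalfEdgeGraph V H) : Setoid H where
  r h k := k = h ∨ k = G.inv h
  iseqv :=
    { refl := fun _ => Or.inl rfl
      symm := by
        rintro h k (rfl | rfl)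
        · exact Or.inl rfl
        · exact Or.inr (G.inv_inv h).symm
      trans := by
        rintro h k l (rfl | rfl) (rfl | rfl)
        · exact Or.inl rfl
        · exact Or.inr rfl
        · exact Or.inr rfl
        · exact Or.inl (G.inv_inv h) }

/-- The set `E(G)` of edges: the orbits of the involution on the half-edges. -/
def Edge {V H : Type*} (G : HalfEdgeGraph V H) : Type _ := Quotient G.edgeSetoid

/-- The edge containing a half-edge. -/
def edge {V H : Type*} (G : HalfEdgeGraph V H) (h : H) : G.Edge := Quotient.mk G.edgeSetoid h

/-- A subgraph of `G`: a set of vertices and a set of half-edges, closed under the root map and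
under the involution. -/
structure Subgraph {V H : Type*} (G : HalfEdgeGraph V H) where
  verts : Set V
  halves : Set H
  root_mem : ∀ h ∈ halves, G.root h ∈ verts
  inv_mem : ∀ h ∈ halves, G.inv h ∈ halves

theorem edge_inv {V H : Type*} (G : HalfEdgeGraph V H) (h : H) : G.edge (G.inv h) = G.edge h :=
  Quotient.sound (s := G.edgeSetoid) (Or.inr (G.inv_inv h).symm)

theorem edge_eq_iff {V H : Type*} (G : HalfEdgeGraph V H) (h k : H) :
    G.edge h = G.edge k ↔ k = h ∨ k = G.inv h :=
  ⟨fun e => Quotient.exact (s := G.edgeSetoid) e,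
    fun e => Quotient.sound (s := G.edgeSetoid) e⟩

/-- The whole graph as a subgraph of itself. -/
def whole {V H : Type*} (G : HalfEdgeGraph V H) : G.Subgraph where
  verts := Set.univ
  halves := Set.univ
  root_mem _ _ := Set.mem_univ _
  inv_mem _ _ := Set.mem_univ _

/-- `G \ F`: the edges in `F` are removed and all vertices are retained, even isolated ones. -/
def deleteEdges {V H : Type*} (G : HalfEdgeGraph V H) (F : Set G.Edge) : G.Subgraph where
  verts := Set.univ
  halves := {h | G.edge h ∉ F}
  root_mem _ _ := Set.mem_univ _
  inv_mem h hh := by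
    have hh' : G.edge h ∉ F := hh
    simpa [edge_inv] using hh'

/-- `G[F]`: the minimal subgraph of `G` containing all edges in `F`. -/
def generatedBy {V H : Type*} (G : HalfEdgeGraph V H) (F : Set G.Edge) : G.Subgraph where
  verts := {v | ∃ h, G.edge h ∈ F ∧ G.root h = v}
  halves := {h | G.edge h ∈ F}
  root_mem h hh := ⟨h, hh, rfl⟩
  inv_mem h hh := by
    have hh' : G.edge h ∈ F := hh
    simpa [edge_inv] using hh'

namespace Subgraph

/-- The edges of a subgraph. -/
def edges {V H : Type*} {G : HalfEdgeGraph V H} (S : G.Subgraph) : Set G.Edge :=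
  G.edge '' S.halves

/-- Adjacency of vertices along an edge of the subgraph. -/
def Adj {V H : Type*} {G : HalfEdgeGraph V H} (S : G.Subgraph) (u v : V) : Prop :=
  ∃ h ∈ S.halves, G.root h = u ∧ G.root (G.inv h) = v

/-- `v` can be reached from `u` by an edge path in the subgraph. -/
def Reach {V H : Type*} {G : HalfEdgeGraph V H} (S : G.Subgraph) : V → V → Prop :=
  Relation.ReflTransGen S.Adj

/-- A subgraph is connected if it is non-empty and any two of its vertices are joined by an edge
path in it. -/
def Connected {V H : Type*} {G : HalfEdgeGraph V H} (S : G.Subgraph) : Prop :=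
  S.verts.Nonempty ∧ ∀ u ∈ S.verts, ∀ v ∈ S.verts, S.Reach u v

/-- The connected component of the vertex `v` of a subgraph. -/
def component {V H : Type*} {G : HalfEdgeGraph V H} (S : G.Subgraph) (v : V) : G.Subgraph where
  verts := {w | S.Reach v w}
  halves := {h | h ∈ S.halves ∧ S.Reach v (G.root h)}
  root_mem _ hh := hh.2
  inv_mem h hh := ⟨S.inv_mem h hh.1, hh.2.tail ⟨h, hh.1, rfl, rfl⟩⟩

/-- `C` is a connected component of the subgraph `S`. -/
def IsComponent {V H : Type*} {G : HalfEdgeGraph V H} (S C : G.Subgraph) : Prop :=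
  ∃ v ∈ S.verts, C = S.component v

/-- The genus `|E| - |V| + 1`. -/
noncomputable def genus {V H : Type*} {G : HalfEdgeGraph V H} (S : G.Subgraph) : ℤ :=
  (S.edges.ncard : ℤ) - (S.verts.ncard : ℤ) + 1

/-- The valency of a vertex in a subgraph: the number of half-edges rooted at it, so that a loop
counts twice. -/
noncomputable def valency {V H : Type*} {G : HalfEdgeGraph V H} (S : G.Subgraph) (v : V) : ℕ :=
  {h | h ∈ S.halves ∧ G.root h = v}.ncard

open Classical in
/-- The simplicial homology group `H₁(S, ℤ)`. A simplicial `1`-chain is written without the choice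
of an orientation, as an integer function on the half-edges that changes sign under the involution;
the homology group consists of the `1`-chains on `S` with zero boundary. -/
def homology {V H : Type*} [Fintype H] {G : HalfEdgeGraph V H} (S : G.Subgraph) :
    AddSubgroup (H → ℤ) where
  carrier := {c | (∀ h, c (G.inv h) = -c h) ∧ (∀ h, h ∉ S.halves → c h = 0) ∧
    ∀ v, ∑ h with G.root h = v, c h = 0}
  zero_mem' := by simp
  add_mem' := by
    rintro c d ⟨c1, c2, c3⟩ ⟨d1, d2, d3⟩
    refine ⟨fun h => ?_, fun h hh => ?_, fun v => ?_⟩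
    · simp only [Pi.add_apply, c1, d1]; ring
    · simp [c2 h hh, d2 h hh]
    · simp only [Pi.add_apply, Finset.sum_add_distrib, c3, d3, add_zero]
  neg_mem' := by
    rintro c ⟨c1, c2, c3⟩
    refine ⟨fun h => ?_, fun h hh => ?_, fun v => ?_⟩
    · simp only [Pi.neg_apply, c1]
    · simp [c2 h hh]
    · simp only [Pi.neg_apply, Finset.sum_neg_distrib, c3, neg_zero]

theorem adj_symm {V H : Type*} {G : HalfEdgeGraph V H} (S : G.Subgraph) {u v : V}
    (h : S.Adj u v) : S.Adj v u := by
  obtain ⟨k, hk, h1, h2⟩ := h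
  exact ⟨G.inv k, S.inv_mem k hk, h2, by rw [G.inv_inv]; exact h1⟩

theorem reach_symm {V H : Type*} {G : HalfEdgeGraph V H} (S : G.Subgraph) {u v : V}
    (h : S.Reach u v) : S.Reach v u := by
  induction h with
  | refl => exact Relation.ReflTransGen.refl
  | tail _ h2 ih => exact Relation.ReflTransGen.head (S.adj_symm h2) ih

theorem component_reach {V H : Type*} {G : HalfEdgeGraph V H} (S : G.Subgraph) {u v : V}
    (h : S.Reach u v) : (S.component u).Reach u v := by
  induction h with
  | refl => exact Relation.ReflTransGen.refl
  | tail h1 h2 ih =>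
    obtain ⟨k, hk, rfl, rfl⟩ := h2
    exact ih.tail ⟨k, ⟨hk, h1⟩, rfl, rfl⟩

end Subgraph

/-- The edge path that traverses the list of half-edges `l` (each one together with its partner)
leads from `u` to `w`. -/
def IsChain {V H : Type*} (G : HalfEdgeGraph V H) : V → List H → V → Prop
  | u, [], w => u = w
  | u, h :: l, w => G.root h = u ∧ G.IsChain (G.root (G.inv h)) l w

/-- The vertices that an edge path passes strictly between its two ends. -/
def chainInterior {V H : Type*} (G : HalfEdgeGraph V H) (l : List H) : List V :=
  l.tail.map G.root

/-- The edges of an edge path. -/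
def chainEdges {V H : Type*} (G : HalfEdgeGraph V H) (l : List H) : List G.Edge :=
  l.map G.edge

end HalfEdgeGraph

open Classical in
/-- A harmonic morphism of graphs: vertex and half-edge maps that commute with the root maps and the
involutions, with positive local degrees that satisfy the local balancing condition. -/
structure HarmonicMorphism {V' H' V H : Type*} [Fintype V'] [Fintype H']
    (G' : HalfEdgeGraph V' H') (G : HalfEdgeGraph V H) where
  onV : V' → V
  onH : H' → H
  root_comm : ∀ h, onV (G'.root h) = G.root (onH h)
  inv_comm : ∀ h, onH (G'.inv h) = G.inv (onH h)
  degV : V' → ℕ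
  degH : H' → ℕ
  degV_pos : ∀ v, 0 < degV v
  degH_pos : ∀ h, 0 < degH h
  degH_inv : ∀ h, degH (G'.inv h) = degH h
  balanced : ∀ (v : V') (h : H), G.root h = onV v →
    degV v = ∑ k with G'.root k = v ∧ onH k = h, degH k

open Classical in
/-- A double cover: a harmonic morphism of global degree two. -/
structure DoubleCover {V' H' V H : Type*} [Fintype V'] [Fintype H']
    (G' : HalfEdgeGraph V' H') (G : HalfEdgeGraph V H) extends HarmonicMorphism G' G where
  degree_vert : ∀ v : V, ∑ w with onV w = v, degV w = 2
  degree_half : ∀ h : H, ∑ k with onH k = h, degH k = 2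

namespace DoubleCover

open HalfEdgeGraph

/-- A vertex is dilated if it has a unique preimage (the local degree there is then two). -/
def DilatedVert {V' H' V H : Type*} [Fintype V'] [Fintype H'] {G' : HalfEdgeGraph V' H'}
    {G : HalfEdgeGraph V H} (p : DoubleCover G' G) (v : V) : Prop :=
  ∃! w, p.onV w = v

/-- A half-edge is dilated if it has a unique preimage (the local degree there is then two). -/
def DilatedHalf {V' H' V H : Type*} [Fintype V'] [Fintype H'] {G' : HalfEdgeGraph V' H'}
    {G : HalfEdgeGraph V H} (p : DoubleCover G' G) (h : H) : Prop :=
  ∃! k, p.onH k = h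

/-- The set `E_ud(G)` of undilated edges. -/
def undilatedEdges {V' H' V H : Type*} [Fintype V'] [Fintype H'] {G' : HalfEdgeGraph V' H'}
    {G : HalfEdgeGraph V H} (p : DoubleCover G' G) : Set G.Edge :=
  {e | ∃ h, G.edge h = e ∧ ¬ p.DilatedHalf h}

theorem fibre_vert {V' H' V H : Type*} [Fintype V'] [Fintype H'] {G' : HalfEdgeGraph V' H'}
    {G : HalfEdgeGraph V H} (p : DoubleCover G' G) {a b : V'} (hab : a ≠ b)
    (h : p.onV a = p.onV b) :
    p.degV a = 1 ∧ p.degV b = 1 ∧ ∀ x, p.onV x = p.onV b → x = a ∨ x = b := by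
  classical
  have key : ∀ s : Finset V', (∀ x ∈ s, p.onV x = p.onV b) → ∑ w ∈ s, p.degV w ≤ 2 := by
    intro s hs
    have h2 := p.degree_vert (p.onV b)
    rw [← h2]
    convert Finset.sum_le_sum_of_subset (f := p.degV)
      (show s ⊆ Finset.univ.filter (fun w => p.onV w = p.onV b) from fun x hx => by
        simpa using hs x hx)
  have ha := p.degV_pos a
  have hb := p.degV_pos b
  have h1 := key {a, b} (by simp [h])
  rw [Finset.sum_pair hab] at h1
  refine ⟨by omega, by omega, fun x hx => ?_⟩
  by_contra hne
  push Not at hne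
  have h3 := key {x, a, b} (by simp [h, hx])
  rw [Finset.sum_insert (by simp [hne.1, hne.2]), Finset.sum_pair hab] at h3
  have := p.degV_pos x
  omega

theorem fibre_half {V' H' V H : Type*} [Fintype V'] [Fintype H'] {G' : HalfEdgeGraph V' H'}
    {G : HalfEdgeGraph V H} (p : DoubleCover G' G) {a b : H'} (hab : a ≠ b)
    (h : p.onH a = p.onH b) (x : H') (hx : p.onH x = p.onH b) : x = a ∨ x = b := by
  classical
  by_contra hne
  push Not at hne
  have h2 := p.degree_half (p.onH b)
  have h3 : ∑ k ∈ ({x, a, b} : Finset H'), p.degH k ≤ 2 := by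
    rw [← h2]
    convert Finset.sum_le_sum_of_subset (f := p.degH)
      (show ({x, a, b} : Finset H') ⊆ Finset.univ.filter (fun w => p.onH w = p.onH b) from
        fun y hy => by
          simp only [Finset.mem_insert, Finset.mem_singleton] at hy
          rcases hy with rfl | rfl | rfl <;> simp [*])
  rw [Finset.sum_insert (by simp [hne.1, hne.2]), Finset.sum_pair hab] at h3
  have := p.degH_pos x
  have := p.degH_pos a
  have := p.degH_pos b
  omega

theorem onV_surj {V' H' V H : Type*} [Fintype V'] [Fintype H'] {G' : HalfEdgeGraph V' H'}
    {G : HalfEdgeGraph V H} (p : DoubleCover G' G) (v : V) : ∃ w, p.onV w = v := by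
  classical
  by_contra hne
  push Not at hne
  have h2 := p.degree_vert v
  rw [Finset.sum_eq_zero] at h2
  · omega
  · intro x hx
    exact absurd (by simpa using hx) (hne x)

theorem onH_surj {V' H' V H : Type*} [Fintype V'] [Fintype H'] {G' : HalfEdgeGraph V' H'}
    {G : HalfEdgeGraph V H} (p : DoubleCover G' G) (h : H) : ∃ k, p.onH k = h := by
  classical
  by_contra hne
  push Not at hne
  have h2 := p.degree_half h
  rw [Finset.sum_eq_zero] at h2
  · omega
  · intro x hx
    exact absurd (by simpa using hx) (hne x)

theorem lift_half {V' H' V H : Type*} [Fintype V'] [Fintype H'] {G' : HalfEdgeGraph V' H'}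
    {G : HalfEdgeGraph V H} (p : DoubleCover G' G) (v : V') (h : H) (hv : G.root h = p.onV v) :
    ∃ k, G'.root k = v ∧ p.onH k = h := by
  classical
  by_contra hne
  push Not at hne
  have h2 := p.balanced v h hv
  rw [Finset.sum_eq_zero] at h2
  · have := p.degV_pos v
    omega
  · intro x hx
    simp only [Finset.mem_filter, Finset.mem_univ, true_and] at hx
    exact absurd hx.2 (hne x hx.1)

/-- The root of a dilated half-edge is dilated. -/
theorem dilated_root {V' H' V H : Type*} [Fintype V'] [Fintype H'] {G' : HalfEdgeGraph V' H'}
    {G : HalfEdgeGraph V H} (p : DoubleCover G' G) (h : H) (hh : p.DilatedHalf h) :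
    p.DilatedVert (G.root h) := by
  obtain ⟨k, hk, hu⟩ := hh
  refine ⟨G'.root k, by change p.onV _ = _; rw [p.root_comm, hk], fun w hw => ?_⟩
  obtain ⟨l, hl, hl'⟩ := p.lift_half w h hw.symm
  rw [← hl, hu l hl']

theorem dilated_inv {V' H' V H : Type*} [Fintype V'] [Fintype H'] {G' : HalfEdgeGraph V' H'}
    {G : HalfEdgeGraph V H} (p : DoubleCover G' G) (h : H) (hh : p.DilatedHalf h) :
    p.DilatedHalf (G.inv h) := by
  obtain ⟨k, hk, hu⟩ := hh
  refine ⟨G'.inv k, by change p.onH _ = _; rw [p.inv_comm, hk], fun l hl => ?_⟩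
  have := hu (G'.inv l) (by change p.onH _ = _; rw [p.inv_comm, hl, G.inv_inv])
  rw [← this, G'.inv_inv]

/-- The dilated part of a subgraph `S`, that is `S ∩ G_dil`, the dilation subgraph of the
restriction of `p` to `S`. -/
def dilatedPart {V' H' V H : Type*} [Fintype V'] [Fintype H'] {G' : HalfEdgeGraph V' H'}
    {G : HalfEdgeGraph V H} (p : DoubleCover G' G) (S : G.Subgraph) : G.Subgraph where
  verts := {v | v ∈ S.verts ∧ p.DilatedVert v}
  halves := {h | h ∈ S.halves ∧ p.DilatedHalf h}
  root_mem h hh := ⟨S.root_mem h hh.1, p.dilated_root h hh.2⟩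
  inv_mem h hh := ⟨S.inv_mem h hh.1, p.dilated_inv h hh.2⟩

/-- The preimage `p⁻¹(S)` of a subgraph of the target. -/
def preimage {V' H' V H : Type*} [Fintype V'] [Fintype H'] {G' : HalfEdgeGraph V' H'}
    {G : HalfEdgeGraph V H} (p : DoubleCover G' G) (S : G.Subgraph) : G'.Subgraph where
  verts := {w | p.onV w ∈ S.verts}
  halves := {k | p.onH k ∈ S.halves}
  root_mem k hk := by
    change p.onV (G'.root k) ∈ S.verts
    rw [p.root_comm]
    exact S.root_mem _ hk
  inv_mem k hk := by
    change p.onH (G'.inv k) ∈ S.halves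
    rw [p.inv_comm]
    exact S.inv_mem _ hk

/-- The restriction `p⁻¹(S) → S` is free: `S` has no dilated vertices (hence no dilated edges). -/
def FreeOver {V' H' V H : Type*} [Fintype V'] [Fintype H'] {G' : HalfEdgeGraph V' H'}
    {G : HalfEdgeGraph V H} (p : DoubleCover G' G) (S : G.Subgraph) : Prop :=
  ∀ v ∈ S.verts, ¬ p.DilatedVert v

/-- The restriction `p⁻¹(S) → S` is the trivial free double cover: it is isomorphic over `S` to the
disjoint union `S × {true, false}` of two copies of `S`. The isomorphism maps `x` to the pair of
`p x` and the sheet of `x`. -/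
def TrivialFreeOver {V' H' V H : Type*} [Fintype V'] [Fintype H'] {G' : HalfEdgeGraph V' H'}
    {G : HalfEdgeGraph V H} (p : DoubleCover G' G) (S : G.Subgraph) : Prop :=
  ∃ (sheetV : V' → Bool) (sheetH : H' → Bool),
    (∀ k ∈ (p.preimage S).halves,
      sheetV (G'.root k) = sheetH k ∧ sheetH (G'.inv k) = sheetH k) ∧
    (∀ v ∈ S.verts, ∀ b, ∃! w, p.onV w = v ∧ sheetV w = b) ∧
    (∀ h ∈ S.halves, ∀ b, ∃! k, p.onH k = h ∧ sheetH k = b)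

/-- The double cover is not the trivial free double cover. -/
def Nontrivial {V' H' V H : Type*} [Fintype V'] [Fintype H'] {G' : HalfEdgeGraph V' H'}
    {G : HalfEdgeGraph V H} (p : DoubleCover G' G) : Prop :=
  ¬ p.TrivialFreeOver G.whole

/-- The restriction `p⁻¹(S) → S` is relatively connected: the preimage of each connected component
of `S` is connected. -/
def RelConnectedOver {V' H' V H : Type*} [Fintype V'] [Fintype H'] {G' : HalfEdgeGraph V' H'}
    {G : HalfEdgeGraph V H} (p : DoubleCover G' G) (S : G.Subgraph) : Prop :=
  ∀ C, S.IsComponent C → (p.preimage C).Connected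

/-- The restriction `p⁻¹(S) → S` is an elementary double cover, of the first type (dilated) or of
the second type (free). -/
def ElementaryOver {V' H' V H : Type*} [Fintype V'] [Fintype H'] {G' : HalfEdgeGraph V' H'}
    {G : HalfEdgeGraph V H} (p : DoubleCover G' G) (S : G.Subgraph) : Prop :=
  (¬ p.FreeOver S ∧ S.Connected ∧ (p.dilatedPart S).Connected ∧
      (p.dilatedPart S).genus = S.genus) ∨
    (p.FreeOver S ∧ S.Connected ∧ S.genus = 1 ∧ ¬ p.TrivialFreeOver S)

open Classical in
/-- The map `H₁(p⁻¹(S), ℤ) → H₁(S, ℤ)` induced by the restriction of `p`. -/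
noncomputable def homologyMap {V' H' V H : Type*} [Fintype V'] [Fintype H'] [Fintype H]
    {G' : HalfEdgeGraph V' H'} {G : HalfEdgeGraph V H} (p : DoubleCover G' G) (S : G.Subgraph) :
    (p.preimage S).homology →+ S.homology where
  toFun c := ⟨fun h => ∑ k with p.onH k = h, c.1 k, by
    obtain ⟨c, c1, c2, c3⟩ := c
    refine ⟨fun h => ?_, fun h hh => ?_, fun v => ?_⟩
    · change ∑ k with p.onH k = G.inv h, c k = -∑ k with p.onH k = h, c k
      rw [← Finset.sum_neg_distrib]
      refine Finset.sum_nbij' G'.inv G'.inv ?_ ?_ ?_ ?_ ?_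
      · intro k hk
        simp only [Finset.mem_filter, Finset.mem_univ, true_and] at hk ⊢
        rw [p.inv_comm, hk, G.inv_inv]
      · intro k hk
        simp only [Finset.mem_filter, Finset.mem_univ, true_and] at hk ⊢
        rw [p.inv_comm, hk]
      · intro k _
        exact G'.inv_inv k
      · intro k _
        exact G'.inv_inv k
      · intro k _
        rw [c1, neg_neg]
    · refine Finset.sum_eq_zero fun k hk => c2 k ?_
      simp only [Finset.mem_filter, Finset.mem_univ, true_and] at hk
      change p.onH k ∉ S.halves
      rwa [hk]
    · change ∑ h with G.root h = v, ∑ k with p.onH k = h, c k = 0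
      have h1 : ∑ h with G.root h = v, ∑ k with p.onH k = h, c k =
          ∑ k with G.root (p.onH k) = v, c k := by
        rw [← Finset.sum_fiberwise_of_maps_to
          (s := Finset.univ.filter fun k => G.root (p.onH k) = v)
          (t := Finset.univ.filter fun h => G.root h = v) (g := p.onH) (by simp)]
        refine Finset.sum_congr rfl fun h hh => Finset.sum_congr ?_ fun _ _ => rfl
        ext k
        simp only [Finset.mem_filter, Finset.mem_univ, true_and] at hh ⊢
        exact ⟨fun e => ⟨by rw [e]; exact hh, e⟩, fun e => e.2⟩
      have h2 : ∑ k with G.root (p.onH k) = v, c k =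
          ∑ w with p.onV w = v, ∑ k with G'.root k = w, c k := by
        rw [← Finset.sum_fiberwise_of_maps_to
          (s := Finset.univ.filter fun k => G.root (p.onH k) = v)
          (t := Finset.univ.filter fun w => p.onV w = v) (g := G'.root)
          (by simp [p.root_comm])]
        refine Finset.sum_congr rfl fun w hw => Finset.sum_congr ?_ fun _ _ => rfl
        ext k
        simp only [Finset.mem_filter, Finset.mem_univ, true_and] at hw ⊢
        exact ⟨fun e => e.2, fun e => ⟨by rw [← p.root_comm, e]; exact hw, e⟩⟩
      rw [h1, h2]
      exact Finset.sum_eq_zero fun w _ => c3 w⟩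
  map_zero' := by
    ext h
    simp
  map_add' c d := by
    ext h
    simp [Finset.sum_add_distrib]

end DoubleCover

namespace DoubleCover

open HalfEdgeGraph

theorem sheets_of_not_connected {V' H' V H : Type*} [Fintype V'] [Fintype H']
    {G' : HalfEdgeGraph V' H'} {G : HalfEdgeGraph V H} (p : DoubleCover G' G) {S C : G.Subgraph}
    (hC : S.IsComponent C) (hn : ¬ (p.preimage C).Connected) :
    ∃ A : Set V', (∀ v ∈ C.verts, ∃ a ∈ A, ∃ b, b ∉ A ∧ p.onV a = v ∧ p.onV b = v) ∧
      ∀ k, p.onH k ∈ C.halves → (G'.root k ∈ A ↔ G'.root (G'.inv k) ∈ A) := by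
  obtain ⟨v₀, hv₀, rfl⟩ := hC
  set C := S.component v₀ with hC
  have hne : (p.preimage C).verts.Nonempty := by
    obtain ⟨w, hw⟩ := p.onV_surj v₀
    refine ⟨w, ?_⟩
    change p.onV w ∈ C.verts
    rw [hw]
    exact Relation.ReflTransGen.refl
  have hconn : ∀ u ∈ C.verts, ∀ v ∈ C.verts, C.Reach u v := fun u hu v hv =>
    (C.reach_symm (S.component_reach hu)).trans (S.component_reach hv)
  have hlift : ∀ a, p.onV a ∈ C.verts → ∀ v, C.Reach (p.onV a) v →
      ∃ b, (p.preimage C).Reach a b ∧ p.onV b = v := by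
    intro a ha v hv
    induction hv with
    | refl => exact ⟨a, Relation.ReflTransGen.refl, rfl⟩
    | tail _ h2 ih =>
      obtain ⟨b, hb, hb'⟩ := ih
      obtain ⟨h, hh, hr, hr'⟩ := h2
      obtain ⟨k, hk, hk'⟩ := p.lift_half b h (hr.trans hb'.symm)
      refine ⟨G'.root (G'.inv k), hb.tail ⟨k, ?_, hk, rfl⟩, ?_⟩
      · change p.onH k ∈ C.halves
        rwa [hk']
      · rw [p.root_comm, p.inv_comm, hk', hr']
  have hn' : ∃ a, p.onV a ∈ C.verts ∧ ∃ b, p.onV b ∈ C.verts ∧ ¬ (p.preimage C).Reach a b := by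
    by_contra hcon
    push Not at hcon
    exact hn ⟨hne, fun a ha b hb => hcon a ha b hb⟩
  obtain ⟨a, ha, b, hb, hab⟩ := hn'
  refine ⟨{x | (p.preimage C).Reach a x}, fun v hv => ?_, fun k hk => ⟨fun h => ?_, fun h => ?_⟩⟩
  · obtain ⟨x, hx, hx'⟩ := hlift a ha v (hconn _ ha _ hv)
    obtain ⟨y, hy, hy'⟩ := hlift b hb v (hconn _ hb _ hv)
    exact ⟨x, hx, y, fun h => hab (h.trans ((p.preimage C).reach_symm hy)), hx', hy'⟩
  · exact Relation.ReflTransGen.tail h ⟨k, hk, rfl, rfl⟩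
  · exact Relation.ReflTransGen.tail h ((p.preimage C).adj_symm ⟨k, hk, rfl, rfl⟩)

theorem relConnectedOver_whole {V' H' V H : Type*} [Fintype V'] [Fintype H']
    {G' : HalfEdgeGraph V' H'} {G : HalfEdgeGraph V H} (p : DoubleCover G' G)
    (hG : G.whole.Connected) (hp : p.Nontrivial) : p.RelConnectedOver (G.deleteEdges ∅) := by
  classical
  intro C hC
  by_contra hn
  obtain ⟨A, hA, hA'⟩ := p.sheets_of_not_connected hC hn
  obtain ⟨v₀, -, rfl⟩ := hC
  have hreach : ∀ v, (G.deleteEdges ∅).Reach v₀ v := by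
    intro v
    refine Relation.ReflTransGen.mono (r := G.whole.Adj) ?_ _ _ (hG.2 v₀ trivial v trivial)
    rintro x y ⟨h, -, h1, h2⟩
    exact ⟨h, by simp [deleteEdges], h1, h2⟩
  have hall : ∀ k, G'.root k ∈ A ↔ G'.root (G'.inv k) ∈ A := fun k =>
    hA' k ⟨by simp [deleteEdges], hreach _⟩
  have hsep : ∀ x y, p.onV x = p.onV y → (x ∈ A ↔ y ∈ A) → x = y := by
    intro x y hxy hiff
    by_contra hne
    obtain ⟨a, ha, b, hb, hav, hbv⟩ := hA (p.onV y) (hreach _)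
    obtain ⟨-, -, h3⟩ := p.fibre_vert hne hxy
    rcases h3 a hav with rfl | rfl <;> rcases h3 b hbv with rfl | rfl <;> tauto
  refine hp ⟨fun w => decide (w ∈ A), fun k => decide (G'.root k ∈ A), fun k _ => ⟨rfl, ?_⟩,
    fun v _ c => ?_, fun h _ c => ?_⟩
  · simp only [hall k]
  · obtain ⟨a, ha, b, hb, hav, hbv⟩ := hA v (hreach _)
    have hc : ∃ w, p.onV w = v ∧ decide (w ∈ A) = c := by
      cases c
      · exact ⟨b, hbv, by simpa using hb⟩
      · exact ⟨a, hav, by simpa using ha⟩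
    obtain ⟨w, hw, hwc⟩ := hc
    refine ⟨w, ⟨hw, hwc⟩, fun y hy => hsep y w (hy.1.trans hw.symm) ?_⟩
    have := hy.2.trans hwc.symm
    simpa using this
  · obtain ⟨a, ha, b, hb, hav, hbv⟩ := hA (G.root h) (hreach _)
    have hc : ∃ w, p.onV w = G.root h ∧ decide (w ∈ A) = c := by
      cases c
      · exact ⟨b, hbv, by simpa using hb⟩
      · exact ⟨a, hav, by simpa using ha⟩
    obtain ⟨w, hw, hwc⟩ := hc
    obtain ⟨k, hk, hkh⟩ := p.lift_half w h hw.symm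
    refine ⟨k, ⟨hkh, by change decide (G'.root k ∈ A) = c; rw [hk]; exact hwc⟩, fun l hl => ?_⟩
    have hlw : G'.root l = w := by
      refine hsep _ _ ?_ ?_
      · rw [p.root_comm, hl.1, hw]
      · have := hl.2.trans hwc.symm
        simpa using this
    by_contra hne
    have hab : a ≠ b := fun e => hb (e ▸ ha)
    obtain ⟨h1, h2, h3⟩ := p.fibre_vert hab (hav.trans hbv.symm)
    have hw1 : p.degV w = 1 := by
      rcases h3 w (hw.trans hbv.symm) with rfl | rfl
      · exact h1
      · exact h2
    have hbal := p.balanced w h hw.symm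
    have hle : ∑ m ∈ ({l, k} : Finset H'), p.degH m ≤
        ∑ m with G'.root m = w ∧ p.onH m = h, p.degH m := by
      refine Finset.sum_le_sum_of_subset fun m hm => ?_
      simp only [Finset.mem_insert, Finset.mem_singleton] at hm
      rcases hm with rfl | rfl
      · simp [hlw, hl.1]
      · simp [hk, hkh]
    rw [Finset.sum_pair hne] at hle
    have e1 := p.degH_pos l
    have e2 := p.degH_pos k
    have e3 : p.degV w = ∑ m with G'.root m = w ∧ p.onH m = h, p.degH m := by convert hbal
    omega

open Classical in
/-- The functions on the vertices of the cover that push forward to zero and are constant along the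
edges that do not lie over `F`. -/
def constantOff {V' H' V H : Type*} [Fintype V'] [Fintype H'] {G' : HalfEdgeGraph V' H'}
    {G : HalfEdgeGraph V H} (p : DoubleCover G' G) (F : Set G.Edge) : Submodule ℚ (V' → ℚ) where
  carrier := {f | (∀ v, ∑ w with p.onV w = v, (p.degV w : ℚ) * f w = 0) ∧
    ∀ k, G.edge (p.onH k) ∉ F → f (G'.root k) = f (G'.root (G'.inv k))}
  zero_mem' := by simp
  add_mem' := by
    rintro f g ⟨f1, f2⟩ ⟨g1, g2⟩
    refine ⟨fun v => ?_, fun k hk => ?_⟩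
    · simp only [Pi.add_apply, mul_add, Finset.sum_add_distrib, f1, g1, add_zero]
    · simp only [Pi.add_apply, f2 k hk, g2 k hk]
  smul_mem' := by
    rintro c f ⟨f1, f2⟩
    refine ⟨fun v => ?_, fun k hk => ?_⟩
    · simp only [Pi.smul_apply, smul_eq_mul, mul_left_comm _ c, ← Finset.mul_sum, f1, mul_zero]
    · simp only [Pi.smul_apply, f2 k hk]

theorem relConnectedOver_iff {V' H' V H : Type*} [Fintype V'] [Fintype H']
    {G' : HalfEdgeGraph V' H'} {G : HalfEdgeGraph V H} (p : DoubleCover G' G) (F : Set G.Edge) :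
    p.RelConnectedOver (G.deleteEdges F) ↔ p.constantOff F = ⊥ := by
  classical
  constructor
  · intro hp
    rw [eq_bot_iff]
    rintro f ⟨f1, f2⟩
    rw [Submodule.mem_bot]
    funext w
    have hconn := hp _ ⟨p.onV w, trivial, rfl⟩
    have hreach : ∀ x, (p.preimage ((G.deleteEdges F).component (p.onV w))).Reach w x →
        f x = f w := by
      intro x hx
      induction hx with
      | refl => rfl
      | tail _ h2 ih =>
        obtain ⟨k, hk, rfl, rfl⟩ := h2
        rw [← ih]
        exact (f2 k hk.1).symm
    have hfib : ∀ x, p.onV x = p.onV w → f x = f w := by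
      intro x hx
      refine hreach x (hconn.2 w ?_ x ?_)
      · exact Relation.ReflTransGen.refl
      · change (G.deleteEdges F).Reach (p.onV w) (p.onV x)
        rw [hx]
        exact Relation.ReflTransGen.refl
    have h0 := f1 (p.onV w)
    rw [Finset.sum_congr rfl (g := fun x => (p.degV x : ℚ) * f w)
      (fun x hx => by rw [hfib x (by simpa using hx)]), ← Finset.sum_mul, ← Nat.cast_sum] at h0
    have h2 : ∑ x with p.onV x = p.onV w, p.degV x = 2 := by
      convert p.degree_vert (p.onV w)
    rw [h2] at h0
    simpa using h0
  · intro hbot C hC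
    by_contra hn
    obtain ⟨A, hA, hA'⟩ := p.sheets_of_not_connected hC hn
    obtain ⟨v₀, -, rfl⟩ := hC
    set C := (G.deleteEdges F).component v₀ with hC
    let f : V' → ℚ := fun x => if p.onV x ∈ C.verts then (if x ∈ A then 1 else -1) else 0
    have hf : f ∈ p.constantOff F := by
      refine ⟨fun v => ?_, fun k hk => ?_⟩
      · by_cases hv : v ∈ C.verts
        · obtain ⟨a, ha, b, hb, hav, hbv⟩ := hA v hv
          have hab : a ≠ b := fun e => hb (e ▸ ha)
          obtain ⟨h1, h2, h3⟩ := p.fibre_vert hab (hav.trans hbv.symm)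
          have hs : (Finset.univ.filter fun w => p.onV w = v) = {a, b} := by
            ext x
            simp only [Finset.mem_filter, Finset.mem_univ, true_and, Finset.mem_insert,
              Finset.mem_singleton]
            constructor
            · intro hx
              exact h3 x (hx.trans hbv.symm)
            · rintro (rfl | rfl)
              · exact hav
              · exact hbv
          rw [hs, Finset.sum_pair hab, h1, h2]
          simp [f, hav, hbv, hv, ha, hb]
        · refine Finset.sum_eq_zero fun x hx => ?_
          simp only [Finset.mem_filter, Finset.mem_univ, true_and] at hx
          simp [f, hx, hv]
      · by_cases hc : p.onH k ∈ C.halves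
        · have h1 : p.onV (G'.root k) ∈ C.verts := by
            rw [p.root_comm]
            exact C.root_mem _ hc
          have h2 : p.onV (G'.root (G'.inv k)) ∈ C.verts := by
            rw [p.root_comm, p.inv_comm]
            exact C.root_mem _ (C.inv_mem _ hc)
          simp only [f, h1, h2, if_true, hA' k hc]
        · have h1 : p.onV (G'.root k) ∉ C.verts := by
            rw [p.root_comm]
            exact fun h => hc ⟨hk, h⟩
          have h2 : p.onV (G'.root (G'.inv k)) ∉ C.verts := by
            rw [p.root_comm, p.inv_comm]
            intro h
            refine hc ?_
            rw [← G.inv_inv (p.onH k)]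
            exact C.inv_mem _ ⟨by change G.edge _ ∉ F; rw [edge_inv]; exact hk, h⟩
          simp [f, h1, h2]
    rw [hbot, Submodule.mem_bot] at hf
    obtain ⟨a, ha, -, -, hav, -⟩ := hA v₀ Relation.ReflTransGen.refl
    have h0 := congrFun hf a
    have : p.onV a ∈ C.verts := by rw [hav]; exact Relation.ReflTransGen.refl
    simp [f, this, ha] at h0

theorem constantOff_mono {V' H' V H : Type*} [Fintype V'] [Fintype H']
    {G' : HalfEdgeGraph V' H'} {G : HalfEdgeGraph V H} (p : DoubleCover G' G) {I J : Set G.Edge}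
    (h : I ⊆ J) : p.constantOff I ≤ p.constantOff J :=
  fun _ hf => ⟨hf.1, fun k hk => hf.2 k fun hI => hk (h hI)⟩

/-- If a function that pushes forward to zero is constant along one lift of an edge, then it is
constant along all of them. -/
theorem const_of_const_lift {V' H' V H : Type*} [Fintype V'] [Fintype H']
    {G' : HalfEdgeGraph V' H'} {G : HalfEdgeGraph V H} (p : DoubleCover G' G) {F : Set G.Edge}
    {f : V' → ℚ} (hf : f ∈ p.constantOff F) (k : H')
    (hk : f (G'.root k) = f (G'.root (G'.inv k))) (l : H')
    (hl : G.edge (p.onH l) = G.edge (p.onH k)) :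
    f (G'.root l) = f (G'.root (G'.inv l)) := by
  classical
  have hsum : ∀ h, ∑ m with p.onH m = h, (p.degH m : ℚ) * f (G'.root m) = 0 := by
    intro h
    have hf1 : ∑ w with p.onV w = G.root h, (p.degV w : ℚ) * f w = 0 := by
      convert hf.1 (G.root h)
    rw [← hf1, ← Finset.sum_fiberwise_of_maps_to
      (t := Finset.univ.filter fun w => p.onV w = G.root h) (g := G'.root)
      (by intro m hm; simp only [Finset.mem_filter, Finset.mem_univ, true_and] at hm ⊢
          rw [p.root_comm, hm])]
    refine Finset.sum_congr rfl fun w hw => ?_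
    simp only [Finset.mem_filter, Finset.mem_univ, true_and] at hw
    have hb : p.degV w = ∑ m with G'.root m = w ∧ p.onH m = h, p.degH m := by
      convert p.balanced w h hw.symm
    rw [hb, Nat.cast_sum, Finset.sum_mul]
    rw [Finset.filter_filter]
    refine Finset.sum_congr ?_ fun m hm => ?_
    · ext m
      simp [and_comm]
    · simp only [Finset.mem_filter, Finset.mem_univ, true_and] at hm
      rw [hm.1]
  have hsum' : ∀ h, ∑ m with p.onH m = h, (p.degH m : ℚ) * f (G'.root (G'.inv m)) = 0 := by
    intro h
    rw [← hsum (G.inv h)]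
    refine Finset.sum_nbij' G'.inv G'.inv ?_ ?_ ?_ ?_ ?_
    · intro m hm
      simp only [Finset.mem_filter, Finset.mem_univ, true_and] at hm ⊢
      rw [p.inv_comm, hm]
    · intro m hm
      simp only [Finset.mem_filter, Finset.mem_univ, true_and] at hm ⊢
      rw [p.inv_comm, hm, G.inv_inv]
    · intro m _
      exact G'.inv_inv m
    · intro m _
      exact G'.inv_inv m
    · intro m _
      rw [p.degH_inv]
  have main : ∀ l, p.onH l = p.onH k → f (G'.root l) = f (G'.root (G'.inv l)) := by
    intro l hl
    by_cases hlk : l = k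
    · rw [hlk]; exact hk
    have hs : (Finset.univ.filter fun m => p.onH m = p.onH k) = {l, k} := by
      ext x
      simp only [Finset.mem_filter, Finset.mem_univ, true_and, Finset.mem_insert,
        Finset.mem_singleton]
      constructor
      · exact p.fibre_half hlk hl x
      · rintro (rfl | rfl)
        · exact hl
        · rfl
    have h1 := hsum (p.onH k)
    have h2 := hsum' (p.onH k)
    rw [hs, Finset.sum_pair hlk] at h1 h2
    have h3 : (p.degH l : ℚ) * (f (G'.root l) - f (G'.root (G'.inv l))) = 0 := by
      rw [← hk] at h2
      linear_combination h1 - h2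
    have h4 : (p.degH l : ℚ) ≠ 0 := by exact_mod_cast (p.degH_pos l).ne'
    have := (mul_eq_zero.mp h3).resolve_left h4
    linarith
  rw [edge_eq_iff] at hl
  rcases hl with hl | hl
  · exact main l hl.symm
  · have := main (G'.inv l) (by rw [p.inv_comm, ← hl])
    rw [G'.inv_inv] at this
    exact this.symm

theorem augment {V' H' V H : Type*} [Fintype V'] [Fintype H'] [Finite H]
    {G' : HalfEdgeGraph V' H'} {G : HalfEdgeGraph V H} (p : DoubleCover G' G) {I J : Set G.Edge}
    (hI : p.constantOff I = ⊥) (hJ : p.constantOff J = ⊥) (hlt : I.ncard < J.ncard) :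
    ∃ e ∈ J, e ∉ I ∧ p.constantOff (insert e I) = ⊥ := by
  classical
  have : Finite G.Edge := Quotient.finite _
  by_contra hcon
  push Not at hcon
  have hlift : ∀ e : G.Edge, ∃ k, G.edge (p.onH k) = e := by
    intro e
    obtain ⟨h, rfl⟩ := Quotient.exists_rep e
    obtain ⟨k, rfl⟩ := p.onH_surj h
    exact ⟨k, rfl⟩
  choose lft hlft using hlift
  let φ : G.Edge → (V' → ℚ) →ₗ[ℚ] ℚ := fun e =>
    LinearMap.proj (R := ℚ) (φ := fun _ : V' => ℚ) (G'.root (lft e)) -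
      LinearMap.proj (R := ℚ) (φ := fun _ : V' => ℚ) (G'.root (G'.inv (lft e)))
  have hφ : ∀ e f, φ e f = f (G'.root (lft e)) - f (G'.root (G'.inv (lft e))) := fun _ _ => rfl
  have hdrop : ∀ (e : G.Edge) (F : Set G.Edge) (f : V' → ℚ), f ∈ p.constantOff F → φ e f = 0 →
      f ∈ p.constantOff (F \ {e}) := by
    intro e F f hf h0
    refine ⟨hf.1, fun k hk => ?_⟩
    by_cases hke : G.edge (p.onH k) = e
    · refine p.const_of_const_lift hf (lft e) ?_ k (by rw [hlft, hke])
      rw [hφ] at h0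
      linarith
    · exact hf.2 k fun h => hk ⟨h, hke⟩
  have hvan : ∀ (e : G.Edge) (F : Set G.Edge) (f : V' → ℚ), f ∈ p.constantOff F → e ∉ F →
      φ e f = 0 := by
    intro e F f hf he
    rw [hφ, hf.2 (lft e) (by rwa [hlft]), sub_self]
  have hex : ∀ e : ↥(J \ I), ∃ f ∈ p.constantOff (insert e.1 I), f ≠ 0 := fun e =>
    (Submodule.ne_bot_iff _).mp (hcon e.1 e.2.1 e.2.2)
  choose f hf hf0 using hex
  have hne : ∀ e, φ e.1 (f e) ≠ 0 := by
    intro e h0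
    have h1 := hdrop e.1 _ _ (hf e) h0
    have h2 := p.constantOff_mono (J := I) (by
      rintro x ⟨hx | hx, hx'⟩
      · exact absurd hx hx'
      · exact hx) h1
    rw [hI, Submodule.mem_bot] at h2
    exact hf0 e h2
  have hoff : ∀ e e', e ≠ e' → φ e.1 (f e') = 0 := by
    intro e e' hee
    refine hvan _ _ _ (hf e') ?_
    rintro (h | h)
    · exact hee (Subtype.ext h)
    · exact e.2.2 h
  let Φ : (V' → ℚ) →ₗ[ℚ] (↥(I \ J) → ℚ) := LinearMap.pi fun e => φ e.1
  have hli : LinearIndependent ℚ fun e => Φ (f e) := by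
    have : Fintype ↥(J \ I) := Fintype.ofFinite _
    have : Fintype ↥(I \ J) := Fintype.ofFinite _
    rw [Fintype.linearIndependent_iff]
    intro g hg e
    have hz : ∑ e, g e • f e ∈ p.constantOff (I ∪ J) :=
      Submodule.sum_mem _ fun e _ => Submodule.smul_mem _ _
        (p.constantOff_mono (by
          rintro x (rfl | hx)
          · exact Or.inr e.2.1
          · exact Or.inl hx) (hf e))
    have hΦ : Φ (∑ e, g e • f e) = 0 := by
      rw [map_sum, ← hg]
      exact Finset.sum_congr rfl fun e _ => map_smul _ _ _
    have hz' : ∑ e, g e • f e ∈ p.constantOff J := by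
      refine ⟨hz.1, fun k hk => ?_⟩
      by_cases hkI : G.edge (p.onH k) ∈ I
      · have h0 : φ (G.edge (p.onH k)) (∑ e, g e • f e) = 0 := congrFun hΦ ⟨_, hkI, hk⟩
        exact (hdrop _ _ _ hz h0).2 k fun h => h.2 rfl
      · exact hz.2 k fun h => h.elim hkI hk
    rw [hJ, Submodule.mem_bot] at hz'
    have h1 : φ e.1 (∑ e, g e • f e) = 0 := by rw [hz', map_zero]
    rw [map_sum, Finset.sum_eq_single e] at h1
    · rw [map_smul, smul_eq_mul] at h1
      exact (mul_eq_zero.mp h1).resolve_right (hne e)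
    · intro e' _ hee
      rw [map_smul, hoff e e' hee.symm, smul_zero]
    · simp
  have : Fintype ↥(J \ I) := Fintype.ofFinite _
  have : Fintype ↥(I \ J) := Fintype.ofFinite _
  have hcard := hli.fintype_card_le_finrank
  rw [Module.finrank_fintype_fun_eq_card, ← Nat.card_eq_fintype_card, ← Nat.card_eq_fintype_card,
    Nat.card_coe_set_eq, Nat.card_coe_set_eq] at hcard
  have e1 := Set.ncard_sdiff_add_ncard I J
  have e2 := Set.ncard_sdiff_add_ncard J I
  rw [Set.union_comm] at e2
  omega

/-- The signed cographic matroid `M*(G'/G)` of a nontrivial double cover of a connected graph: its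
ground set is the set of undilated edges, and a set `F` of undilated edges is independent if the
double cover obtained by removing the edges in `F` and their preimages is relatively connected. -/
def signedCographicMatroid {V' H' V H : Type*} [Fintype V'] [Fintype H'] [Finite H]
    {G' : HalfEdgeGraph V' H'} {G : HalfEdgeGraph V H} (p : DoubleCover G' G)
    (hG : G.whole.Connected) (hp : p.Nontrivial) : Matroid G.Edge :=
  haveI : Finite G.Edge := Quotient.finite _
  (IndepMatroid.ofFinite (E := p.undilatedEdges) (Set.toFinite _)
    (fun F => F ⊆ p.undilatedEdges ∧ p.RelConnectedOver (G.deleteEdges F))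
    ⟨Set.empty_subset _, p.relConnectedOver_whole hG hp⟩
    (fun I J hJ hIJ => ⟨hIJ.trans hJ.1, by
      have h := hJ.2
      rw [p.relConnectedOver_iff] at h ⊢
      exact eq_bot_iff.mpr (h ▸ p.constantOff_mono hIJ)⟩)
    (fun I J hI hJ hlt => by
      obtain ⟨e, he, heI, h⟩ := p.augment ((p.relConnectedOver_iff I).mp hI.2)
        ((p.relConnectedOver_iff J).mp hJ.2) hlt
      exact ⟨e, he, heI, Set.insert_subset (hJ.1 he) hI.1, (p.relConnectedOver_iff _).mpr h⟩)
    (fun _ hI => hI.1)).matroid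

/-- The signed graphic matroid `M(G'/G)`, the dual of the signed cographic matroid. -/
def signedGraphicMatroid {V' H' V H : Type*} [Fintype V'] [Fintype H'] [Finite H]
    {G' : HalfEdgeGraph V' H'} {G : HalfEdgeGraph V H} (p : DoubleCover G' G)
    (hG : G.whole.Connected) (hp : p.Nontrivial) : Matroid G.Edge :=
  (p.signedCographicMatroid hG hp)✶

end DoubleCover

/-- A topological type of double covers, drawn as a finite diagram: the edges of the target graph
have the ends `src` and `tgt`, the vertices in `dilated` are the dilated ones (bold dots in the
cover), and the edges in `odd` are loops with connected preimage (spirals in the cover). An edge of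
the diagram may stand for a chain of edges whose interior vertices are undilated of valency two. -/
structure CoverDiagram where
  numVerts : ℕ
  numEdges : ℕ
  src : Fin numEdges → Fin numVerts
  tgt : Fin numEdges → Fin numVerts
  dilated : Set (Fin numVerts)
  odd : Set (Fin numEdges)

namespace CoverDiagram

/-- Two undilated loops with connected preimage, at distinct undilated vertices joined by an
edge. -/
def typeII : CoverDiagram := ⟨2, 3, ![0, 0, 1], ![0, 1, 1], ∅, {0, 2}⟩

/-- Two undilated loops with connected preimage, at the same undilated vertex. -/
def typeIII : CoverDiagram := ⟨1, 2, ![0, 0], ![0, 0], ∅, {0, 1}⟩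

/-- An edge from a dilated vertex to an undilated vertex, which supports a loop with connected
preimage. -/
def typeIV : CoverDiagram := ⟨2, 2, ![0, 1], ![1, 1], {0}, {1}⟩

/-- An undilated loop at a dilated vertex. -/
def typeV : CoverDiagram := ⟨1, 1, ![0], ![0], {0}, ∅⟩

/-- An undilated edge between two distinct dilated vertices. -/
def typeVI : CoverDiagram := ⟨2, 1, ![0], ![1], {0, 1}, ∅⟩

end CoverDiagram

namespace DoubleCover

open HalfEdgeGraph

/-- The restriction `p[F] : p⁻¹(G[F]) → G[F]` has the topological type of the diagram `D`: the
vertices of `D` are realized by distinct vertices of `G`, dilated exactly as prescribed by `D`; the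
edges of `D` are realized by chains of edges of `G`, which are disjoint apart from their ends and
have distinct edges and distinct undilated interior vertices; the chains use exactly the edges in
`F`; and the cover restricted to a chain that realizes an odd loop of `D` is not trivial. -/
def HasType {V' H' V H : Type*} [Fintype V'] [Fintype H'] {G' : HalfEdgeGraph V' H'}
    {G : HalfEdgeGraph V H} (p : DoubleCover G' G) (F : Set G.Edge) (D : CoverDiagram) : Prop :=
  ∃ (φ : Fin D.numVerts → V) (c : Fin D.numEdges → List H),
    Function.Injective φ ∧
    (∀ x, p.DilatedVert (φ x) ↔ x ∈ D.dilated) ∧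
    (∀ i, c i ≠ [] ∧ G.IsChain (φ (D.src i)) (c i) (φ (D.tgt i))) ∧
    (∀ i, (G.chainEdges (c i)).Nodup ∧ (G.chainInterior (c i)).Nodup) ∧
    (∀ i, ∀ v ∈ G.chainInterior (c i), ¬ p.DilatedVert v ∧ v ∉ Set.range φ) ∧
    (∀ i j, i ≠ j → List.Disjoint (G.chainEdges (c i)) (G.chainEdges (c j)) ∧
      List.Disjoint (G.chainInterior (c i)) (G.chainInterior (c j))) ∧
    F = {e | ∃ i, e ∈ G.chainEdges (c i)} ∧
    ∀ i ∈ D.odd, ¬ p.TrivialFreeOver (G.generatedBy {e | e ∈ G.chainEdges (c i)})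

end DoubleCover

/-! Choosing one preimage of every vertex encodes the cover by signs ±1 on the edges of G, with the
dilated vertices grounded. A function on the cover that pushes forward to zero becomes a function f
on V(G) that vanishes at the grounded vertices, and constancy along the lifts of an edge uv becomes
f(u) = ±f(v). So G \ I is relatively connected over exactly when the undilated edges outside I carry
no nonzero such potential (`relConnectedOver_iff_rigid`). Dually, a cycle of the cover killed by the
pushforward is a signed flow on G, conserved at undilated vertices only. Both notions are read off
the coboundary ℚ^U → ℚ^F, for U a set of undilated vertices: potentials form its kernel, and flows
are dual to its cokernel (`coboundary_injective_iff`, `coboundary_surjective_iff`).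

Consequently F is a basis when it carries neither a potential nor a flow (`isBase_iff`), and
independent when it carries no flow (`indep_iff`), which up to clearing denominators is injectivity
on homology (`homologyMap_injective_iff`). For bases, the coboundary splits over the components of
G[F]. On a component, absence of potentials means that the cover is not the trivial one, and the
coboundary is then bijective when edges and undilated vertices are equal in number; for a connected
graph this is the genus condition (`elementaryOver_iff`).

Circuits are the minimal sets that carry a nonzero flow. If the cover is trivial over G[F], counting
dimensions forces genus one; conversely, a connected graph of genus one without leaves is a cycle.
If it is not trivial, F has one edge more than there are undilated vertices in G[F]. Undilated
vertices have degree at least two, so by the handshake lemma the degrees exceed the values 2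
(undilated) and 0 (dilated) by 2 in total. Following arcs between the vertices with positive excess
gives the types II–VI or a theta graph. A theta graph is impossible: two of its three chains have
the same sign product, and their union already carries a flow. Conversely, each diagram has too many
edges to be independent, and the vanishing of a flow on one of its edges propagates to all the
others (`Realizes.isCircuit`). -/

set_option linter.unusedSectionVars false
open scoped Classical

/-! ### Signed graphs: potentials, flows and the coboundary operator -/

namespace HalfEdgeGraph

section Basic

variable {V H : Type*} (G : HalfEdgeGraph V H)

/-- A representative half-edge of an edge. -/
noncomputable def rep (e : G.Edge) : H := Quotient.out (s := G.edgeSetoid) e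

theorem edge_rep (e : G.Edge) : G.edge (G.rep e) = e := Quotient.out_eq (s := G.edgeSetoid) e

theorem edge_eq_iff' (h k : H) : G.edge h = G.edge k ↔ h = k ∨ h = G.inv k := by
  rw [eq_comm, G.edge_eq_iff]

theorem eq_rep_or (h : H) : h = G.rep (G.edge h) ∨ h = G.inv (G.rep (G.edge h)) := by
  rw [← edge_eq_iff', edge_rep]

instance [Finite H] : Finite G.Edge := Quotient.finite _

end Basic

/-- A signing of a graph: a sign on every edge and a set of grounded vertices. -/
structure Signing {V H : Type*} (G : HalfEdgeGraph V H) where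
  ground : Set V
  sign : H → ℚ
  sign_mul_self : ∀ h, sign h * sign h = 1
  sign_inv : ∀ h, sign (G.inv h) = sign h

namespace Signing

variable {V H : Type*} {G : HalfEdgeGraph V H} (s : G.Signing)

/-- The failure of a vertex function to be compatible with the sign of an edge. -/
def defect (f : V → ℚ) (h : H) : ℚ := f (G.root h) - s.sign h * f (G.root (G.inv h))

/-- A function that vanishes at the grounded vertices and is compatible with the signs of the edges
in `F`. -/
def IsPotential (F : Set G.Edge) (f : V → ℚ) : Prop :=
  (∀ v ∈ s.ground, f v = 0) ∧ ∀ h, G.edge h ∈ F → s.defect f h = 0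

variable {s}

theorem sign_ne_zero (h : H) : s.sign h ≠ 0 := fun h0 => by
  have := s.sign_mul_self h
  simp [h0] at this

theorem sign_eq (h : H) : s.sign h = 1 ∨ s.sign h = -1 :=
  mul_self_eq_one_iff.mp (s.sign_mul_self h)

/-- Defects and flows have the same symmetry under `inv`, so their product takes equal values on the
two halves of an edge. -/
theorem defect_inv (f : V → ℚ) (h : H) : s.defect f (G.inv h) = -(s.sign h * s.defect f h) := by
  simp only [defect, s.sign_inv, G.inv_inv]
  linear_combination -f (G.root (G.inv h)) * s.sign_mul_self h

theorem defect_eq_zero_of_edge_eq {f : V → ℚ} {h k : H} (e : G.edge h = G.edge k)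
    (h0 : s.defect f h = 0) : s.defect f k = 0 := by
  rcases (G.edge_eq_iff h k).mp e with rfl | rfl
  · exact h0
  · rw [defect_inv, h0, mul_zero, neg_zero]

variable (s)

/-- The coboundary operator from functions on `U` to functions on `F`. -/
noncomputable def coboundary (U : Set V) (F : Set G.Edge) : (U → ℚ) →ₗ[ℚ] (F → ℚ) where
  -- Functions on U are extended by zero, and the defect of an edge is measured on its
  -- representative half-edge.
  toFun f e := s.defect (fun v => if hv : v ∈ U then f ⟨v, hv⟩ else 0) (G.rep e.1)
  map_add' f g := by
    funext e
    simp only [defect, Pi.add_apply]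
    split_ifs <;> ring
  map_smul' a f := by
    funext e
    simp only [defect, Pi.smul_apply, smul_eq_mul, RingHom.id_apply]
    split_ifs <;> ring

/-- The kernel consists of the potentials supported on U: since U avoids the grounded vertices,
extension by zero vanishes there, and a defect that is zero on one half of an edge is zero on the
other. -/
theorem coboundary_injective_iff {U : Set V} {F : Set G.Edge} (hU : Disjoint U s.ground) :
    Function.Injective (s.coboundary U F) ↔
      ∀ f, s.IsPotential F f → (∀ v, v ∉ U → f v = 0) → f = 0 := by
  rw [← LinearMap.ker_eq_bot, LinearMap.ker_eq_bot']
  constructor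
  · intro h f hf h0
    have hext : (fun v => if hv : v ∈ U then (fun x : U => f x) ⟨v, hv⟩ else 0) = f := by
      funext v
      split_ifs with hv
      · rfl
      · exact (h0 v hv).symm
    have := h (fun x => f x) (by
      funext e
      change s.defect (fun v => if hv : v ∈ U then (fun x : U => f x) ⟨v, hv⟩ else 0) _ = 0
      rw [hext]
      exact hf.2 _ (by rw [edge_rep]; exact e.2))
    funext v
    by_cases hv : v ∈ U
    · exact congrFun this ⟨v, hv⟩
    · exact h0 v hv
  · intro h f hf
    have := h (fun v => if hv : v ∈ U then f ⟨v, hv⟩ else 0) ⟨fun v hv => ?_, fun k hk => ?_⟩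
      fun v hv => by simp [hv]
    · funext x
      have hx := congrFun this x.1
      simpa using hx
    · have : v ∉ U := fun hvU => hU.le_bot ⟨hvU, hv⟩
      simp [this]
    · exact defect_eq_zero_of_edge_eq (G.edge_rep _) (congrFun hf ⟨G.edge k, hk⟩)

variable [Fintype H]

/-- A signed flow supported on `F`, conserved at the vertices that are not grounded. -/
def IsFlow (F : Set G.Edge) (c : H → ℚ) : Prop :=
  (∀ h, c (G.inv h) = -(s.sign h * c h)) ∧ (∀ h, G.edge h ∉ F → c h = 0) ∧
    ∀ v, v ∉ s.ground → ∑ h with G.root h = v, c h = 0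

/-- A set of edges that supports no nonzero signed flow. -/
def FlowFree (F : Set G.Edge) : Prop := ∀ c, s.IsFlow F c → c = 0

variable {s}

theorem IsFlow.mono {F F' : Set G.Edge} {c : H → ℚ} (hc : s.IsFlow F c) (h : F ⊆ F') :
    s.IsFlow F' c :=
  ⟨hc.1, fun k hk => hc.2.1 k fun hF => hk (h hF), hc.2.2⟩

theorem FlowFree.mono {F F' : Set G.Edge} (hF : s.FlowFree F') (h : F ⊆ F') : s.FlowFree F :=
  fun c hc => hF c (hc.mono h)

theorem IsFlow.restrict {F F' : Set G.Edge} {c : H → ℚ} (hc : s.IsFlow F c)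
    (h : ∀ k, c k ≠ 0 → G.edge k ∈ F') : s.IsFlow F' c :=
  ⟨hc.1, fun k hk => by_contra fun h0 => hk (h k h0), hc.2.2⟩

theorem IsFlow.eq_zero_of_edge_eq {F : Set G.Edge} {c : H → ℚ} (hc : s.IsFlow F c) {h k : H}
    (e : G.edge h = G.edge k) (h0 : c h = 0) : c k = 0 := by
  rcases (G.edge_eq_iff h k).mp e with rfl | rfl
  · exact h0
  · rw [hc.1, h0, mul_zero, neg_zero]

/-- Summation by parts: at every vertex either f vanishes or c is conserved, so the sum of c(h)
f(root h) is zero. The second term of the defect gives the same sum after reindexing by `inv`. -/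
theorem IsFlow.sum_mul_defect [Fintype V] {F : Set G.Edge} {c : H → ℚ} (hc : s.IsFlow F c)
    {f : V → ℚ} (hf : ∀ v ∈ s.ground, f v = 0) : ∑ h, c h * s.defect f h = 0 := by
  have h1 : ∑ h, c h * f (G.root h) = 0 := by
    rw [← Finset.sum_fiberwise (s := Finset.univ) (g := G.root)]
    refine Finset.sum_eq_zero fun v _ => ?_
    rw [Finset.sum_congr rfl (g := fun h => c h * f v)
      (fun h hh => by rw [(Finset.mem_filter.mp hh).2]), ← Finset.sum_mul]
    by_cases hv : v ∈ s.ground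
    · rw [hf v hv, mul_zero]
    · rw [hc.2.2 v hv, zero_mul]
  have h2 : ∑ h, c (G.inv h) * f (G.root (G.inv h)) = 0 := by
    rw [← h1]
    exact Finset.sum_nbij' G.inv G.inv (by simp) (by simp) (by simp [G.inv_inv])
      (by simp [G.inv_inv]) (by simp)
  rw [← add_zero (0 : ℚ)]
  nth_rewrite 1 [← h1]
  rw [← h2, ← Finset.sum_add_distrib]
  refine Finset.sum_congr rfl fun h _ => ?_
  rw [hc.1, defect]
  ring

/-- In the pairing of c with the defects only the two halves of one edge survive, and they
contribute equally. This orthogonality is used in both directions: a nonzero flow value forces the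
defect to vanish, and a nonzero defect forces the flow to vanish. -/
theorem IsFlow.mul_defect_eq_zero [Fintype V] {F : Set G.Edge} {c : H → ℚ} (hc : s.IsFlow F c)
    {f : V → ℚ} (hf : ∀ v ∈ s.ground, f v = 0) (h₀ : H)
    (hd : ∀ h, G.edge h ∈ F → G.edge h ≠ G.edge h₀ → s.defect f h = 0) :
    c h₀ * s.defect f h₀ = 0 := by
  have h := hc.sum_mul_defect hf
  rw [← Finset.sum_subset (Finset.subset_univ {h₀, G.inv h₀}),
    Finset.sum_pair (G.inv_ne h₀).symm, hc.1, defect_inv] at h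
  · linear_combination h / 2 - c h₀ * s.defect f h₀ / 2 * s.sign_mul_self h₀
  · intro k _ hk
    simp only [Finset.mem_insert, Finset.mem_singleton, ← G.edge_eq_iff'] at hk
    by_cases hkF : G.edge k ∈ F
    · rw [hd k hkF hk, mul_zero]
    · rw [hc.2.1 k hkF, zero_mul]

variable (s)

/-- A linear functional that kills the image of the coboundary is a flow: its value on the
coboundary of the indicator of v is the boundary at v. The condition on U ensures that edges of F
have no ungrounded ends outside U. -/
theorem coboundary_surjective_iff [Fintype V] {U : Set V} {F : Set G.Edge}
    (hU : Disjoint U s.ground)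
    (hUF : ∀ h, G.edge h ∈ F → G.root h ∉ s.ground → G.root h ∈ U) :
    Function.Surjective (s.coboundary U F) ↔ s.FlowFree F := by
  constructor
  · intro hsurj c hc
    funext h
    by_cases hh : G.edge h ∈ F
    swap
    · exact hc.2.1 h hh
    refine hc.eq_zero_of_edge_eq (G.edge_rep _) ?_
    -- A function whose coboundary is the indicator of one edge pairs with the flow to the value of
    -- the flow there.
    obtain ⟨f, hf⟩ := hsurj (Pi.single ⟨G.edge h, hh⟩ 1)
    have h1 := hc.mul_defect_eq_zero (f := fun v => if hv : v ∈ U then f ⟨v, hv⟩ else 0)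
      (fun v hv => dif_neg fun hvU => hU.le_bot ⟨hvU, hv⟩) (G.rep (G.edge h)) (by
        intro k hk hne
        rw [edge_rep] at hne
        refine defect_eq_zero_of_edge_eq (G.edge_rep _) ((congrFun hf ⟨G.edge k, hk⟩).trans ?_)
        exact Pi.single_eq_of_ne (by simpa using hne) _)
    have h2 : s.defect (fun v => if hv : v ∈ U then f ⟨v, hv⟩ else 0) (G.rep (G.edge h)) = 1 :=
      (congrFun hf ⟨G.edge h, hh⟩).trans (Pi.single_eq_same _ _)
    rwa [h2, mul_one] at h1
  · intro hF
    by_contra hns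
    rw [← LinearMap.range_eq_top] at hns
    obtain ⟨l, hl, hle⟩ := Submodule.exists_le_ker_of_lt_top _ (lt_top_iff_ne_top.mpr hns)
    -- `m` spreads a function on edges over the half-edges with the symmetry of a flow: 1 on the
    -- representative, minus the sign on the other half.
    let m : H → ℚ := fun h => if h = G.rep (G.edge h) then 1 else -s.sign h
    let c : H → ℚ := fun h =>
      if he : G.edge h ∈ F then l (Pi.single ⟨G.edge h, he⟩ (m h)) else 0
    have hm : ∀ h, m (G.inv h) = -(s.sign h * m h) := by
      intro h
      simp only [m, G.edge_inv, s.sign_inv]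
      rcases G.eq_rep_or h with h1 | h1
      · have h2 : G.inv h ≠ G.rep (G.edge h) := by rw [← h1]; exact G.inv_ne h
        rw [if_pos h1, if_neg h2, mul_one]
      · have h2 : G.inv h = G.rep (G.edge h) := by
          conv_lhs => rw [h1]
          rw [G.inv_inv]
        have h3 : h ≠ G.rep (G.edge h) := by
          rw [← h2]; exact (G.inv_ne h).symm
        rw [if_pos h2, if_neg h3]
        linear_combination -s.sign_mul_self h
    have hc : s.IsFlow F c := by
      refine ⟨fun h => ?_, fun h hh => dif_neg hh, fun v hv => ?_⟩
      · simp only [c, G.edge_inv]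
        split_ifs with he
        · rw [hm, ← mul_neg, ← smul_eq_mul, Pi.single_smul, map_smul, Pi.single_neg, map_neg,
            smul_neg, smul_eq_mul]
        · simp
      · by_cases hvU : v ∈ U
        -- The conservation law at a vertex of U says that the functional kills the coboundary of
        -- the indicator of this vertex.
        · have h0 : l (s.coboundary U F (Pi.single ⟨v, hvU⟩ 1)) = 0 := hle ⟨_, rfl⟩
          rw [← h0]
          have hs : s.coboundary U F (Pi.single ⟨v, hvU⟩ 1) =
              ∑ h with G.root h = v,
                if he : G.edge h ∈ F then Pi.single (⟨G.edge h, he⟩ : F) (m h) else 0 := by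
            funext e
            have hext : (fun w => if hw : w ∈ U then
                (Pi.single (⟨v, hvU⟩ : U) (1 : ℚ) : U → ℚ) ⟨w, hw⟩ else 0) =
                fun w => if w = v then 1 else 0 := by
              funext w
              by_cases hwv : w = v
              · subst hwv
                simp [hvU]
              · simp [hwv]
            change s.defect (fun w => if hw : w ∈ U then
                (Pi.single (⟨v, hvU⟩ : U) (1 : ℚ) : U → ℚ) ⟨w, hw⟩ else 0) (G.rep e.1) = _
            rw [hext, Finset.sum_apply, Finset.sum_filter]
            have hterm : ∀ h, (if G.root h = v then
                (if he : G.edge h ∈ F then Pi.single (⟨G.edge h, he⟩ : F) (m h) else 0 : F → ℚ) e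
                else 0) = if G.edge h = e.1 then (if G.root h = v then m h else 0) else 0 := by
              intro h
              by_cases h1 : G.root h = v
              · by_cases h2 : G.edge h = e.1
                · have h3 : G.edge h ∈ F := h2 ▸ e.2
                  have h4 : e = ⟨G.edge h, h3⟩ := Subtype.ext h2.symm
                  subst h4
                  simp [h1, h3]
                · rw [if_pos h1, if_neg h2]
                  split_ifs with h3
                  · exact Pi.single_eq_of_ne (fun h4 => h2 (congrArg Subtype.val h4).symm) _
                  · rfl
              · simp [h1]
            rw [Finset.sum_congr rfl fun h _ => hterm h,
              ← Finset.sum_subset (Finset.subset_univ {G.rep e.1, G.inv (G.rep e.1)}),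
              Finset.sum_pair (G.inv_ne _).symm, hm, G.edge_inv, G.edge_rep]
            · have h5 : m (G.rep e.1) = 1 := if_pos (by rw [G.edge_rep])
              simp only [if_true, h5, defect]
              split_ifs <;> ring
            · intro k _ hk
              simp only [Finset.mem_insert, Finset.mem_singleton, ← G.edge_eq_iff',
                G.edge_rep] at hk
              exact if_neg hk
          rw [hs, map_sum]
          refine Finset.sum_congr rfl fun h _ => ?_
          simp only [c]
          split_ifs
          · rfl
          · rw [map_zero]
        -- No edge of F meets an ungrounded vertex outside U, so the sum there is empty.
        · refine Finset.sum_eq_zero fun h hh => dif_neg fun he => hvU ?_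
          rw [Finset.mem_filter] at hh
          rw [← hh.2]
          exact hUF h he (by rw [hh.2]; exact hv)
    have hc0 := hF c hc
    refine hl (LinearMap.pi_ext' fun e => LinearMap.ext_ring ?_)
    have h1 := congrFun hc0 (G.rep e.1)
    have h5 : m (G.rep e.1) = 1 := if_pos (by rw [G.edge_rep])
    have h6 : (⟨G.edge (G.rep e.1), by rw [G.edge_rep]; exact e.2⟩ : F) = e :=
      Subtype.ext (G.edge_rep _)
    have h7 : c (G.rep e.1) = l (Pi.single e 1) := by
      rw [← h5]
      simp only [c]
      rw [dif_pos (by rw [G.edge_rep]; exact e.2), h6]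
    rw [h7] at h1
    exact h1

variable {s}

theorem FlowFree.ncard_le [Fintype V] {U : Set V} {F : Set G.Edge} (hF : s.FlowFree F)
    (hU : Disjoint U s.ground)
    (hUF : ∀ h, G.edge h ∈ F → G.root h ∉ s.ground → G.root h ∈ U) : F.ncard ≤ U.ncard := by
  have : Fintype F := Fintype.ofFinite _
  have h := LinearMap.finrank_le_finrank_of_surjective
    ((s.coboundary_surjective_iff hU hUF).mpr hF)
  rwa [Module.finrank_fintype_fun_eq_card, Module.finrank_fintype_fun_eq_card,
    ← Nat.card_eq_fintype_card, ← Nat.card_eq_fintype_card, Nat.card_coe_set_eq,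
    Nat.card_coe_set_eq] at h

theorem ncard_le_of_potential_eq_zero [Fintype V] {U : Set V} {F : Set G.Edge}
    (hU : Disjoint U s.ground)
    (hF : ∀ f, s.IsPotential F f → (∀ v, v ∉ U → f v = 0) → f = 0) : U.ncard ≤ F.ncard := by
  have : Fintype F := Fintype.ofFinite _
  have h := LinearMap.finrank_le_finrank_of_injective
    ((s.coboundary_injective_iff hU).mpr hF)
  rwa [Module.finrank_fintype_fun_eq_card, Module.finrank_fintype_fun_eq_card,
    ← Nat.card_eq_fintype_card, ← Nat.card_eq_fintype_card, Nat.card_coe_set_eq,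
    Nat.card_coe_set_eq] at h

/-- The coboundary is now a square matrix, so that injectivity and surjectivity agree. -/
theorem flowFree_iff_of_ncard_eq [Fintype V] {U : Set V} {F : Set G.Edge}
    (hU : Disjoint U s.ground)
    (hUF : ∀ h, G.edge h ∈ F → G.root h ∉ s.ground → G.root h ∈ U) (hcard : F.ncard = U.ncard) :
    s.FlowFree F ↔ ∀ f, s.IsPotential F f → (∀ v, v ∉ U → f v = 0) → f = 0 := by
  have : Fintype F := Fintype.ofFinite _
  rw [← s.coboundary_surjective_iff hU hUF, ← s.coboundary_injective_iff hU]
  refine (LinearMap.injective_iff_surjective_of_finrank_eq_finrank ?_).symm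
  rw [Module.finrank_fintype_fun_eq_card, Module.finrank_fintype_fun_eq_card,
    ← Nat.card_eq_fintype_card, ← Nat.card_eq_fintype_card, Nat.card_coe_set_eq,
    Nat.card_coe_set_eq, hcard]

end Signing

end HalfEdgeGraph

/-! ### The signing attached to a double cover -/

namespace DoubleCover

open HalfEdgeGraph

variable {V' H' V H : Type*} [Fintype V'] [Fintype H'] {G' : HalfEdgeGraph V' H'}
  {G : HalfEdgeGraph V H} (p : DoubleCover G' G)

theorem onV_root_inv (k : H') : p.onV (G'.root (G'.inv k)) = G.root (G.inv (p.onH k)) := by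
  rw [p.root_comm, p.inv_comm]

/-- A chosen preimage of a vertex. -/
noncomputable def sheet (v : V) : V' := (p.onV_surj v).choose

theorem onV_sheet (v : V) : p.onV (p.sheet v) = v := (p.onV_surj v).choose_spec

theorem exists_lift_sheet (h : H) : ∃ k, G'.root k = p.sheet (G.root h) ∧ p.onH k = h :=
  p.lift_half _ h (p.onV_sheet _).symm

/-- A chosen preimage of a half-edge, rooted at the chosen preimage of its root. -/
noncomputable def lift (h : H) : H' := (p.exists_lift_sheet h).choose

theorem root_lift (h : H) : G'.root (p.lift h) = p.sheet (G.root h) :=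
  (p.exists_lift_sheet h).choose_spec.1

theorem onH_lift (h : H) : p.onH (p.lift h) = h := (p.exists_lift_sheet h).choose_spec.2

theorem exists_ne_sheet {v : V} (hv : ¬ p.DilatedVert v) : ∃ w, w ≠ p.sheet v ∧ p.onV w = v := by
  by_contra hcon
  push Not at hcon
  exact hv ⟨p.sheet v, p.onV_sheet v, fun w hw => by_contra fun h => hcon w h hw⟩

theorem eq_of_ne_sheet {a b : V'} (h : p.onV a = p.onV b) (ha : a ≠ p.sheet (p.onV b))
    (hb : b ≠ p.sheet (p.onV b)) : a = b :=
  ((p.fibre_vert hb.symm (p.onV_sheet _)).2.2 a h).resolve_left ha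

/-- Over an undilated vertex the local degree is one. By balancing it is the sum of the positive
degrees of the lifts of a half-edge rooted at this point, so there is only one such lift. -/
theorem eq_of_root_eq {k l : H'} (hv : ¬ p.DilatedVert (p.onV (G'.root k)))
    (hr : G'.root k = G'.root l) (hh : p.onH k = p.onH l) : k = l := by
  by_contra hne
  have hw : p.degV (G'.root k) = 1 := by
    by_cases h : G'.root k = p.sheet (p.onV (G'.root k))
    · obtain ⟨w, hw, hw'⟩ := p.exists_ne_sheet hv
      rw [← h] at hw
      exact (p.fibre_vert hw hw').2.1
    · exact (p.fibre_vert h (p.onV_sheet _).symm).1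
  have hbal := p.balanced (G'.root k) (p.onH k) (p.root_comm k).symm
  have hle : ∑ m ∈ ({k, l} : Finset H'), p.degH m ≤
      ∑ m with G'.root m = G'.root k ∧ p.onH m = p.onH k, p.degH m := by
    refine Finset.sum_le_sum_of_subset fun m hm => ?_
    simp only [Finset.mem_insert, Finset.mem_singleton] at hm
    rcases hm with rfl | rfl
    · simp
    · simp [hr, hh]
  rw [Finset.sum_pair hne, ← hbal, hw] at hle
  have e1 := p.degH_pos l
  have e2 := p.degH_pos k
  omega

/-- The signing of the target graph that describes a double cover. -/
noncomputable def signing : G.Signing where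
  ground := {v | p.DilatedVert v}
  -- The sign is positive when the chosen lifts of the two halves form one edge of the cover.
  sign h := if G'.inv (p.lift h) = p.lift (G.inv h) then 1 else -1
  sign_mul_self h := by split_ifs <;> norm_num
  sign_inv h := by
    rw [G.inv_inv]
    refine if_congr ⟨fun e => ?_, fun e => ?_⟩ rfl rfl
    · rw [← e, G'.inv_inv]
    · rw [← e, G'.inv_inv]

theorem sign_eq_ite (h : H) :
    p.signing.sign h = if G'.inv (p.lift h) = p.lift (G.inv h) then 1 else -1 := rfl

/-- The sign of a vertex of the cover: `1` for the chosen preimage of an undilated vertex, `-1` for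
the other one, and `0` over dilated vertices. -/
noncomputable def vertSign (w : V') : ℚ :=
  if p.DilatedVert (p.onV w) then 0 else if w = p.sheet (p.onV w) then 1 else -1

theorem vertSign_sheet {v : V} (hv : ¬ p.DilatedVert v) : p.vertSign (p.sheet v) = 1 := by
  rw [vertSign, p.onV_sheet, if_neg hv, if_pos rfl]

theorem vertSign_of_ne {w : V'} (hv : ¬ p.DilatedVert (p.onV w)) (hw : w ≠ p.sheet (p.onV w)) :
    p.vertSign w = -1 := by
  rw [vertSign, if_neg hv, if_neg hw]

theorem vertSign_mul_self {w : V'} (hv : ¬ p.DilatedVert (p.onV w)) :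
    p.vertSign w * p.vertSign w = 1 := by
  rw [vertSign, if_neg hv]
  split_ifs <;> norm_num

theorem vertSign_eq_iff {a b : V'} (hv : ¬ p.DilatedVert (p.onV b)) (h : p.onV a = p.onV b) :
    p.vertSign a = p.vertSign b ↔ a = b := by
  refine ⟨fun e => ?_, fun e => by rw [e]⟩
  rw [vertSign, vertSign, h, if_neg hv, if_neg hv] at e
  split_ifs at e with h1 h2 h2
  · exact h1.trans h2.symm
  · norm_num at e
  · norm_num at e
  · exact p.eq_of_ne_sheet h h1 h2

theorem inv_lift_eq_iff {h : H} (hv : ¬ p.DilatedVert (G.root (G.inv h))) :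
    G'.inv (p.lift h) = p.lift (G.inv h) ↔
      G'.root (G'.inv (p.lift h)) = p.sheet (G.root (G.inv h)) := by
  constructor
  · intro e
    rw [e, p.root_lift]
  · intro e
    refine p.eq_of_root_eq ?_ (by rw [e, p.root_lift]) (by rw [p.inv_comm, p.onH_lift, p.onH_lift])
    rwa [p.onV_root_inv, p.onH_lift]

theorem vertSign_inv_lift {h : H} (hv : ¬ p.DilatedVert (G.root (G.inv h))) :
    p.vertSign (G'.root (G'.inv (p.lift h))) = p.signing.sign h := by
  rw [sign_eq_ite, vertSign, p.onV_root_inv, p.onH_lift, if_neg hv]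
  exact if_congr (p.inv_lift_eq_iff hv).symm rfl rfl

theorem filter_onV {v : V} (hv : ¬ p.DilatedVert v) : ∃ w, w ≠ p.sheet v ∧ p.onV w = v ∧
    (Finset.univ.filter fun x => p.onV x = v) = {p.sheet v, w} ∧ p.degV (p.sheet v) = 1 ∧
    p.degV w = 1 := by
  obtain ⟨w, hw, rfl⟩ := p.exists_ne_sheet hv
  obtain ⟨h1, h2, h3⟩ := p.fibre_vert hw.symm (p.onV_sheet _)
  refine ⟨w, hw, rfl, ?_, h1, h2⟩
  ext x
  simp only [Finset.mem_filter, Finset.mem_univ, true_and, Finset.mem_insert,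
    Finset.mem_singleton]
  refine ⟨h3 x, ?_⟩
  rintro (rfl | rfl)
  · exact p.onV_sheet _
  · rfl

/-- Pushing forward to zero is antisymmetry under the exchange of sheets: over an undilated vertex
both local degrees are one and the two values are opposite; over a dilated vertex the only value is
zero. -/
theorem eq_vertSign_mul {F : Set G.Edge} {f : V' → ℚ} (hf : f ∈ p.constantOff F) (w : V') :
    f w = p.vertSign w * f (p.sheet (p.onV w)) := by
  have h0 := hf.1 (p.onV w)
  by_cases hv : p.DilatedVert (p.onV w)
  · rw [vertSign, if_pos hv, zero_mul]
    obtain ⟨x, hx, hu⟩ := hv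
    have hs : (Finset.univ.filter fun x => p.onV x = p.onV w) = {w} := by
      ext y
      simp only [Finset.mem_filter, Finset.mem_univ, true_and, Finset.mem_singleton]
      exact ⟨fun hy => (hu y hy).trans (hu w rfl).symm, fun hy => by rw [hy]⟩
    rw [hs, Finset.sum_singleton] at h0
    exact (mul_eq_zero.mp h0).resolve_left (by exact_mod_cast (p.degV_pos w).ne')
  · obtain ⟨x, hx, hxv, hs, d1, d2⟩ := p.filter_onV hv
    rw [hs, Finset.sum_pair hx.symm, d1, d2] at h0
    by_cases hw : w = p.sheet (p.onV w)
    · rw [← hw]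
      nth_rewrite 2 [hw]
      rw [p.vertSign_sheet hv, one_mul]
    · rw [p.vertSign_of_ne hv hw, p.eq_of_ne_sheet (b := x) hxv.symm (by rwa [hxv]) (by rwa [hxv]), hxv]
      push_cast at h0
      linarith

/-- Restriction to the chosen preimages turns functions constant off I into potentials for the
complement of I. By antisymmetry nothing is lost, and `mem_constantOff_of_isPotential` is the
converse extension. -/
theorem isPotential_of_mem_constantOff {I : Set G.Edge} {f : V' → ℚ} (hf : f ∈ p.constantOff I) :
    p.signing.IsPotential Iᶜ fun v => f (p.sheet v) := by
  have h0 : ∀ w, p.DilatedVert (p.onV w) → f w = 0 := fun w hw => by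
    rw [p.eq_vertSign_mul hf, vertSign, if_pos hw, zero_mul]
  refine ⟨fun v hv => h0 _ (by rwa [p.onV_sheet]), fun h hh => ?_⟩
  have h1 := hf.2 (p.lift h) (by rwa [p.onH_lift])
  rw [p.root_lift, p.eq_vertSign_mul hf (G'.root (G'.inv (p.lift h))), p.onV_root_inv,
    p.onH_lift] at h1
  rw [Signing.defect, h1, sub_eq_zero]
  by_cases hv : p.DilatedVert (G.root (G.inv h))
  · rw [h0 (p.sheet _) (by rwa [p.onV_sheet]), mul_zero, mul_zero]
  · rw [p.vertSign_inv_lift hv]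

theorem mem_constantOff_of_isPotential {I : Set G.Edge} {f : V → ℚ}
    (hf : p.signing.IsPotential Iᶜ f) :
    (fun w => p.vertSign w * f (p.onV w)) ∈ p.constantOff I := by
  have h0 : ∀ v, ∑ w with p.onV w = v, (p.degV w : ℚ) * (p.vertSign w * f (p.onV w)) = 0 := by
    intro v
    by_cases hv : p.DilatedVert v
    · refine Finset.sum_eq_zero fun w hw => ?_
      rw [(Finset.mem_filter.mp hw).2, hf.1 v hv, mul_zero, mul_zero]
    · obtain ⟨x, hx, hxv, hs, d1, d2⟩ := p.filter_onV hv
      rw [hs, Finset.sum_pair hx.symm, d1, d2, hxv, p.onV_sheet, p.vertSign_sheet hv,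
        p.vertSign_of_ne (by rwa [hxv]) (by rwa [hxv])]
      push_cast
      ring
  refine ⟨h0, fun k hk => ?_⟩
  -- It suffices to compare the ends of the chosen lift. For `F := Set.univ` the edge condition in
  -- `constantOff` is void, so only the pushforward condition is needed.
  refine p.const_of_const_lift (F := Set.univ) ⟨h0, fun k hk => (hk trivial).elim⟩
    (p.lift (p.onH k)) ?_ k (by rw [p.onH_lift])
  have h1 := hf.2 (p.onH k) hk
  rw [Signing.defect, sub_eq_zero] at h1
  simp only [p.root_lift, p.onV_sheet, p.onV_root_inv, p.onH_lift]
  by_cases hv : p.DilatedVert (G.root (p.onH k))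
  · rw [hf.1 _ hv] at h1 ⊢
    have := (mul_eq_zero.mp h1.symm).resolve_left (Signing.sign_ne_zero _)
    rw [this, mul_zero, mul_zero]
  · rw [p.vertSign_sheet hv, one_mul, h1]
    by_cases hv' : p.DilatedVert (G.root (G.inv (p.onH k)))
    · rw [hf.1 _ hv', mul_zero, mul_zero]
    · rw [p.vertSign_inv_lift hv']

theorem constantOff_eq_bot_iff (I : Set G.Edge) :
    p.constantOff I = ⊥ ↔ ∀ f, p.signing.IsPotential Iᶜ f → f = 0 := by
  rw [eq_bot_iff]
  constructor
  · intro h f hf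
    funext v
    by_cases hv : p.DilatedVert v
    · exact hf.1 v hv
    · have := congrFun ((Submodule.mem_bot ℚ).mp (h (p.mem_constantOff_of_isPotential hf)))
        (p.sheet v)
      simpa [p.vertSign_sheet hv, p.onV_sheet] using this
  · intro h f hf
    rw [Submodule.mem_bot]
    funext w
    rw [p.eq_vertSign_mul hf, congrFun (h _ (p.isPotential_of_mem_constantOff hf)) (p.onV w)]
    simp

/-- The square of a potential is constant on a connected subgraph. -/
theorem potential_sq_eq {s : G.Signing} {S : G.Subgraph} (hS : S.Connected) {f : V → ℚ}
    (hf : ∀ h ∈ S.halves, s.defect f h = 0) {u v : V} (hu : u ∈ S.verts) (hv : v ∈ S.verts) :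
    f u * f u = f v * f v := by
  induction hS.2 u hu v hv with
  | refl => rfl
  | tail h1 h2 ih =>
    obtain ⟨h, hh, rfl, rfl⟩ := h2
    rw [ih (S.root_mem _ hh)]
    have := sub_eq_zero.mp (hf h hh)
    rw [this]
    linear_combination (f (G.root (G.inv h)) * f (G.root (G.inv h))) * s.sign_mul_self h

/-- The potential is ±1 according to the sheet that contains the chosen preimage. An edge has
negative sign exactly when the chosen preimages of its ends lie in different sheets. -/
theorem exists_potential_of_trivialFreeOver {S : G.Subgraph} (hS : p.TrivialFreeOver S) :
    ∃ f, (∀ v ∈ p.signing.ground, f v = 0) ∧ (∀ h ∈ S.halves, p.signing.defect f h = 0) ∧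
      ∀ v ∈ S.verts, f v ≠ 0 := by
  obtain ⟨sV, sH, h1, h2, h3⟩ := hS
  -- A dilated vertex has one preimage, which cannot lie in both sheets.
  have hun : ∀ v ∈ S.verts, ¬ p.DilatedVert v := by
    rintro v hv ⟨w, -, hu⟩
    obtain ⟨a, ha, -⟩ := h2 v hv true
    obtain ⟨b, hb, -⟩ := h2 v hv false
    have := (hu a ha.1).trans (hu b hb.1).symm
    rw [this] at ha
    exact absurd (ha.2.symm.trans hb.2) (by simp)
  refine ⟨fun v => if p.DilatedVert v then 0 else if sV (p.sheet v) = true then 1 else -1,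
    fun v hv => if_pos hv, fun h hh => ?_, fun v hv => ?_⟩
  · have hk : ∀ k, p.onH k = h → sV (G'.root k) = sV (G'.root (G'.inv k)) := by
      intro k hk
      have a1 := h1 k (by change p.onH k ∈ S.halves; rwa [hk])
      have a2 := h1 (G'.inv k)
        (by change p.onH (G'.inv k) ∈ S.halves; rw [p.inv_comm, hk]; exact S.inv_mem _ hh)
      rw [a1.1, a2.1, a1.2]
    have a := hk _ (p.onH_lift h)
    rw [p.root_lift] at a
    have hu1 := hun _ (S.root_mem _ hh)
    have hu2 := hun _ (S.root_mem _ (S.inv_mem _ hh))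
    rw [Signing.defect, if_neg hu1, if_neg hu2, a, sign_eq_ite]
    by_cases hi : G'.inv (p.lift h) = p.lift (G.inv h)
    · rw [if_pos hi, hi, p.root_lift]
      simp
    · have hne : sV (G'.root (G'.inv (p.lift h))) ≠ sV (p.sheet (G.root (G.inv h))) := by
        intro e
        refine hi ((p.inv_lift_eq_iff hu2).mpr ?_)
        obtain ⟨w, -, hw⟩ := h2 _ (S.root_mem _ (S.inv_mem _ hh)) (sV (p.sheet (G.root (G.inv h))))
        exact (hw _ ⟨by rw [p.onV_root_inv, p.onH_lift], e⟩).trans (hw _ ⟨p.onV_sheet _, rfl⟩).symm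
      rw [if_neg hi]
      revert hne
      cases sV (G'.root (G'.inv (p.lift h))) <;> cases sV (p.sheet (G.root (G.inv h))) <;> simp
  · simp only [if_neg (hun v hv)]
    split_ifs <;> norm_num

/-- Lifted antisymmetrically to the cover, the potential takes only the values ±f(v₀) over S, both
of them in every fibre, and is constant along edges. Its level sets are the two sheets. -/
theorem trivialFreeOver_of_potential {S : G.Subgraph} (hS : S.Connected) {f : V → ℚ}
    (hf0 : ∀ v ∈ p.signing.ground, f v = 0) (hf : ∀ h ∈ S.halves, p.signing.defect f h = 0)
    {v₀ : V} (hv₀ : v₀ ∈ S.verts) (hne : f v₀ ≠ 0) : p.TrivialFreeOver S := by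
  have hsq : ∀ v ∈ S.verts, f v = f v₀ ∨ f v = -f v₀ := fun v hv =>
    mul_self_eq_mul_self_iff.mp (potential_sq_eq hS hf hv hv₀)
  have hne' : ∀ v ∈ S.verts, f v ≠ 0 := fun v hv h0 => by
    rcases hsq v hv with h | h
    · exact hne (h.symm.trans h0)
    · exact hne (neg_eq_zero.mp (h.symm.trans h0))
  have hun : ∀ v ∈ S.verts, ¬ p.DilatedVert v := fun v hv hd => hne' v hv (hf0 v hd)
  let g : V' → ℚ := fun w => p.vertSign w * f (p.onV w)
  have hg : ∀ w, p.onV w ∈ S.verts → g w = f v₀ ∨ g w = -f v₀ := by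
    intro w hw
    have h1 : p.vertSign w = 1 ∨ p.vertSign w = -1 :=
      mul_self_eq_one_iff.mp (p.vertSign_mul_self (hun _ hw))
    simp only [g]
    rcases h1 with h1 | h1 <;> rcases hsq _ hw with h2 | h2 <;> rw [h1, h2] <;> simp
  have hedge : ∀ k, p.onH k ∈ S.halves → g (G'.root k) = g (G'.root (G'.inv k)) := by
    -- Here I consists of the edges outside S, so that only the edges of S impose a condition.
    have := p.mem_constantOff_of_isPotential (I := {e | ∀ h ∈ S.halves, G.edge h ≠ e}) (f := f)
      ⟨hf0, fun h hh => by
        have : ∃ k ∈ S.halves, G.edge k = G.edge h := by simpa using hh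
        obtain ⟨k, hk, he⟩ := this
        exact Signing.defect_eq_zero_of_edge_eq he (hf k hk)⟩
    exact fun k hk => this.2 k fun h => h _ hk rfl
  have hinj : ∀ a b, p.onV a ∈ S.verts → p.onV a = p.onV b → (g a = f v₀ ↔ g b = f v₀) →
      a = b := by
    intro a b ha hab hiff
    have hb : p.onV b ∈ S.verts := hab ▸ ha
    have : g a = g b := by
      rcases hg a ha with h1 | h1 <;> rcases hg b hb with h2 | h2
      · rw [h1, h2]
      · exact (hiff.mp h1).symm ▸ h1
      · exact (hiff.mpr h2).symm ▸ h2.symm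
      · rw [h1, h2]
    simp only [g, hab] at this
    exact (p.vertSign_eq_iff (hun _ hb) hab).mp (mul_right_cancel₀ (hne' _ hb) this)
  have hex : ∀ v ∈ S.verts, ∀ c : Bool, ∃ w, p.onV w = v ∧ decide (g w = f v₀) = c := by
    intro v hv c
    obtain ⟨x, hx, hxv⟩ := p.exists_ne_sheet (hun v hv)
    have hx' : g x = -g (p.sheet v) := by
      simp only [g, hxv, p.onV_sheet]
      rw [p.vertSign_sheet (hun v hv), p.vertSign_of_ne (by rw [hxv]; exact hun v hv)
        (by rwa [hxv])]
      ring
    have hnn : -f v₀ ≠ f v₀ := fun h => hne (by linarith)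
    have hs := hg (p.sheet v) (by rwa [p.onV_sheet])
    cases c
    · rcases hs with h | h
      · exact ⟨x, hxv, by rw [hx', h]; simpa using hnn⟩
      · exact ⟨p.sheet v, p.onV_sheet v, by rw [h]; simpa using hnn⟩
    · rcases hs with h | h
      · exact ⟨p.sheet v, p.onV_sheet v, by rw [h]; simp⟩
      · exact ⟨x, hxv, by rw [hx', h]; simp⟩
  refine ⟨fun w => decide (g w = f v₀), fun k => decide (g (G'.root k) = f v₀), fun k hk => ⟨rfl, ?_⟩,
    fun v hv c => ?_, fun h hh c => ?_⟩
  · simp only [hedge k hk]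
  · obtain ⟨w, hw, hwc⟩ := hex v hv c
    refine ⟨w, ⟨hw, hwc⟩, fun y hy => hinj y w (by rwa [hy.1]) (hy.1.trans hw.symm) ?_⟩
    have := hy.2.trans hwc.symm
    simpa using this
  · obtain ⟨w, hw, hwc⟩ := hex _ (S.root_mem _ hh) c
    obtain ⟨k, hk, hkh⟩ := p.lift_half w h hw.symm
    refine ⟨k, ⟨hkh, by simp only [hk]; exact hwc⟩, fun l hl => ?_⟩
    have hlv : p.onV (G'.root l) = G.root h := by rw [p.root_comm, hl.1]
    refine p.eq_of_root_eq (by rw [hlv]; exact hun _ (S.root_mem _ hh)) ?_ (hl.1.trans hkh.symm)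
    rw [hk]
    refine hinj _ _ (by rw [hlv]; exact S.root_mem _ hh) (hlv.trans hw.symm) ?_
    have := hl.2.trans hwc.symm
    simpa using this

/-! ### The induced map on homology -/

/-- At a point over an undilated vertex the cover is a local isomorphism: each half-edge below has
exactly one lift rooted there. -/
theorem sum_onH_of_root {A : Type*} [AddCommMonoid A] {w : V'} [Fintype H]
    (hw : ¬ p.DilatedVert (p.onV w)) (g : H → A) :
    ∑ k with G'.root k = w, g (p.onH k) = ∑ h with G.root h = p.onV w, g h := by
  refine Finset.sum_nbij p.onH ?_ ?_ ?_ fun _ _ => rfl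
  · intro k hk
    simp only [Finset.mem_filter, Finset.mem_univ, true_and] at hk ⊢
    rw [← p.root_comm, hk]
  · intro k hk l hl e
    simp only [Finset.coe_filter, Finset.mem_univ, true_and, Set.mem_ofPred_eq] at hk hl
    exact p.eq_of_root_eq (by rwa [hk]) (hk.trans hl.symm) e
  · intro h hh
    simp only [Finset.coe_filter, Finset.mem_univ, true_and, Set.mem_ofPred_eq] at hh
    obtain ⟨k, hk, hk'⟩ := p.lift_half w h hh
    exact ⟨k, by simpa using hk, hk'⟩

theorem sum_fibre_half {A : Type*} [AddCommMonoid A] {k l : H'} (hkl : k ≠ l)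
    (h : p.onH k = p.onH l) (g : H' → A) : ∑ x with p.onH x = p.onH l, g x = g k + g l := by
  rw [← Finset.sum_pair hkl]
  refine Finset.sum_congr ?_ fun _ _ => rfl
  ext x
  simp only [Finset.mem_filter, Finset.mem_univ, true_and, Finset.mem_insert,
    Finset.mem_singleton]
  refine ⟨p.fibre_half hkl h x, ?_⟩
  rintro (rfl | rfl)
  · exact h
  · rfl

theorem not_dilatedHalf {F : Set G.Edge} (hF : F ⊆ p.undilatedEdges) {h : H}
    (hh : G.edge h ∈ F) : ¬ p.DilatedHalf h := by
  obtain ⟨k, hk, hd⟩ := hF hh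
  intro hd'
  rcases (G.edge_eq_iff' k h).mp hk with rfl | rfl
  · exact hd hd'
  · exact hd (p.dilated_inv h hd')

theorem exists_ne_lift {h : H} (hd : ¬ p.DilatedHalf h) : ∃ k, k ≠ p.lift h ∧ p.onH k = h := by
  by_contra hcon
  push Not at hcon
  exact hd ⟨p.lift h, p.onH_lift h, fun w hw => by_contra fun h => hcon w h hw⟩

/-- Clearing denominators makes a rational flow integral, as needed for homology over ℤ. -/
theorem exists_int_multiple {ι : Type*} [Finite ι] (c : ι → ℚ) :
    ∃ (N : ℤ) (z : ι → ℤ), N ≠ 0 ∧ ∀ i, (z i : ℚ) = N * c i := by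
  have := Fintype.ofFinite ι
  refine ⟨∏ i, ((c i).den : ℤ), fun i => (c i).num * ∏ j ∈ Finset.univ.erase i, ((c j).den : ℤ),
    Finset.prod_ne_zero_iff.mpr fun i _ => by exact_mod_cast (c i).den_nz, fun i => ?_⟩
  rw [← Finset.mul_prod_erase Finset.univ _ (Finset.mem_univ i)]
  push_cast
  have := Rat.mul_den_eq_num (c i)
  rw [← this]
  ring

theorem homologyMap_apply [Fintype H] (S : G.Subgraph) (c : (p.preimage S).homology) (h : H) :
    (p.homologyMap S c).1 h = ∑ k with p.onH k = h, c.1 k := rfl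

/-- A sign for every half-edge of the cover. -/
noncomputable def halfSign (k : H') : ℤ := if k = p.lift (p.onH k) then 1 else -1

/-- The involution of the cover exchanges the fibres over the two halves of an edge, and it matches
the chosen lifts with each other exactly when the sign is positive. -/
theorem halfSign_inv (k : H') :
    (p.halfSign (G'.inv k) : ℚ) = p.signing.sign (p.onH k) * p.halfSign k := by
  rw [sign_eq_ite, halfSign, halfSign, p.inv_comm]
  by_cases hk : k = p.lift (p.onH k)
  · rw [← hk, if_pos rfl]
    split_ifs <;> simp
  · have hfib : ∀ l, p.onH l = G.inv (p.onH k) → l = G'.inv k ∨ l = G'.inv (p.lift (p.onH k)) := by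
      intro l hl
      have := p.fibre_half (a := G'.inv k) (b := G'.inv (p.lift (p.onH k)))
        (fun e => hk (by rw [← G'.inv_inv (p.lift _), ← e, G'.inv_inv])) (by simp only [p.inv_comm, p.onH_lift])
        l (by rw [hl, p.inv_comm, p.onH_lift])
      exact this
    rw [if_neg hk]
    rcases hfib _ (p.onH_lift (G.inv (p.onH k))) with h | h
    · rw [h, if_pos rfl, if_neg]
      · simp
      · exact fun e => hk (by rw [← G'.inv_inv (p.lift _), e, G'.inv_inv])
    · rw [h, if_pos rfl, if_neg]
      · simp
      · exact fun e => hk (by rw [← G'.inv_inv (p.lift _), ← e, G'.inv_inv])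

theorem halfSign_eq_vertSign {k : H'} (hv : ¬ p.DilatedVert (p.onV (G'.root k))) :
    (p.halfSign k : ℚ) = p.vertSign (G'.root k) := by
  rw [halfSign, vertSign, if_neg hv]
  push_cast
  refine if_congr ⟨fun e => ?_, fun e => ?_⟩ rfl rfl
  · rw [p.root_comm, ← p.root_lift, ← e]
  · exact p.eq_of_root_eq hv (by rw [p.root_lift, ← p.root_comm, ← e]) (p.onH_lift _).symm

/-- A cycle in the kernel takes opposite values on the two lifts of an undilated half-edge, hence is
determined by its values on the chosen lifts. Its boundary over an undilated vertex is that of a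
signed flow; over a dilated vertex the two lifts of each half-edge meet and cancel, so no condition
remains there. -/
theorem homologyMap_injective_iff [Fintype H] {F : Set G.Edge} (hF : F ⊆ p.undilatedEdges) :
    Function.Injective (p.homologyMap (G.generatedBy F)) ↔ p.signing.FlowFree F := by
  rw [injective_iff_map_eq_zero]
  constructor
  · intro hinj c hc
    obtain ⟨N, z, hN, hz⟩ := exists_int_multiple c
    have hz0 : ∀ h, G.edge h ∉ F → z h = 0 := fun h hh => by
      have := hz h
      rw [hc.2.1 h hh, mul_zero] at this
      exact_mod_cast this
    -- The two lifts of an undilated half-edge carry opposite values, so the antisymmetric lift of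
    -- the flow lies in the kernel.
    have hpush : ∀ h, ∑ k with p.onH k = h, p.halfSign k * z (p.onH k) = 0 := by
      intro h
      by_cases hh : G.edge h ∈ F
      · obtain ⟨l, hl, hlh⟩ := p.exists_ne_lift (p.not_dilatedHalf hF hh)
        have := p.sum_fibre_half hl (hlh.trans (p.onH_lift h).symm)
          fun k => p.halfSign k * z (p.onH k)
        rw [p.onH_lift] at this
        rw [this, halfSign, halfSign, hlh, p.onH_lift, if_neg hl, if_pos rfl]
        ring
      · refine Finset.sum_eq_zero fun k hk => ?_
        rw [(Finset.mem_filter.mp hk).2, hz0 h hh, mul_zero]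
    let d : (p.preimage (G.generatedBy F)).homology :=
      ⟨fun k => p.halfSign k * z (p.onH k), fun k => ?_, fun k hk => ?_, fun w => ?_⟩
    · have hd := hinj d (Subtype.ext (funext fun h => (p.homologyMap_apply _ _ _).trans (hpush h)))
      funext h
      have h1 : p.halfSign (p.lift h) * z (p.onH (p.lift h)) = 0 :=
        congrFun (congrArg Subtype.val hd) (p.lift h)
      rw [halfSign, p.onH_lift, if_pos rfl, one_mul] at h1
      have h2 := hz h
      rw [h1, Int.cast_zero] at h2
      exact (mul_eq_zero.mp h2.symm).resolve_left (by exact_mod_cast hN)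
    · by_cases hh : G.edge (p.onH k) ∈ F
      · have h1 := p.halfSign_inv k
        have h2 : (z (G.inv (p.onH k)) : ℚ) = -(p.signing.sign (p.onH k) * z (p.onH k)) := by
          rw [hz, hz, hc.1]
          ring
        have : ((p.halfSign (G'.inv k) * z (G.inv (p.onH k)) : ℤ) : ℚ) =
            ((-(p.halfSign k * z (p.onH k)) : ℤ) : ℚ) := by
          push_cast
          rw [h1, h2]
          linear_combination (-(p.halfSign k : ℚ) * z (p.onH k)) *
            p.signing.sign_mul_self (p.onH k)
        change p.halfSign (G'.inv k) * z (p.onH (G'.inv k)) = -(p.halfSign k * z (p.onH k))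
        rw [p.inv_comm]
        exact_mod_cast this
      · change p.halfSign (G'.inv k) * z (p.onH (G'.inv k)) = -(p.halfSign k * z (p.onH k))
        rw [p.inv_comm, hz0 _ hh, hz0 _ (by rwa [G.edge_inv])]
        simp
    · change p.halfSign k * z (p.onH k) = 0
      rw [hz0 _ hk, mul_zero]
    -- Over a dilated vertex all lifts of a half-edge are rooted at w and cancel by `hpush`;
    -- otherwise the half-edges at w correspond to those below and the conservation law applies.
    · by_cases hw : p.DilatedVert (p.onV w)
      · rw [← Finset.sum_fiberwise_of_maps_to (s := Finset.univ.filter fun k => G'.root k = w)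
          (t := Finset.univ.filter fun h => G.root h = p.onV w) (g := p.onH) (by
            intro k hk
            simp only [Finset.mem_filter, Finset.mem_univ, true_and] at hk ⊢
            rw [← p.root_comm, hk])]
        refine Finset.sum_eq_zero fun h hh => ?_
        rw [← hpush h]
        refine Finset.sum_congr ?_ fun _ _ => rfl
        ext k
        simp only [Finset.mem_filter, Finset.mem_univ, true_and] at hh ⊢
        refine ⟨fun e => e.2, fun e => ⟨?_, e⟩⟩
        obtain ⟨x, hx, hu⟩ := hw
        exact (hu _ (by change p.onV _ = _; rw [p.root_comm, e, hh])).trans (hu w rfl).symm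
      · have h1 : ∑ k with G'.root k = w, (p.vertSign w * z (p.onH k) : ℚ) = 0 := by
          rw [p.sum_onH_of_root hw fun h => (p.vertSign w * z h : ℚ), ← Finset.mul_sum]
          simp only [hz]
          rw [← Finset.mul_sum, hc.2.2 _ hw, mul_zero, mul_zero]
        have h2 : ((∑ k with G'.root k = w, p.halfSign k * z (p.onH k) : ℤ) : ℚ) = 0 := by
          rw [← h1]
          push_cast
          refine Finset.sum_congr rfl fun k hk => ?_
          have hk' := (Finset.mem_filter.mp hk).2
          rw [p.halfSign_eq_vertSign (by rwa [hk']), hk']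
        exact_mod_cast h2
  · intro hfree d hd
    obtain ⟨c, c1, c2, c3⟩ := d
    have hpair : ∀ k l, k ≠ l → p.onH k = p.onH l → c k = -c l := by
      intro k l hkl h
      have h1 := congrFun (congrArg Subtype.val hd) (p.onH l)
      have h2 : ∑ x with p.onH x = p.onH l, c x = 0 := h1
      rw [p.sum_fibre_half hkl h] at h2
      omega
    have hflow : p.signing.IsFlow F fun h => (c (p.lift h) : ℚ) := by
      refine ⟨fun h => ?_, fun h hh => ?_, fun v hv => ?_⟩
      · change (c (p.lift (G.inv h)) : ℚ) = -(p.signing.sign h * c (p.lift h))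
        rw [sign_eq_ite]
        split_ifs with hi
        · rw [← hi, c1]
          push_cast
          ring
        · rw [hpair _ _ (Ne.symm hi) (by rw [p.onH_lift, p.inv_comm, p.onH_lift]), c1]
          push_cast
          ring
      · have : c (p.lift h) = 0 := c2 _ (by
          change p.onH (p.lift h) ∉ (G.generatedBy F).halves
          rwa [p.onH_lift])
        simp [this]
      · have h1 := p.sum_onH_of_root (w := p.sheet v) (by rwa [p.onV_sheet])
          fun h => (c (p.lift h) : ℚ)
        rw [p.onV_sheet] at h1
        rw [← h1]
        have h2 := c3 (p.sheet v)
        rw [← Int.cast_zero, ← h2]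
        push_cast
        refine Finset.sum_congr rfl fun k hk => ?_
        have hk' := (Finset.mem_filter.mp hk).2
        have hkv : G.root (p.onH k) = v := by rw [← p.root_comm, hk', p.onV_sheet]
        rw [← p.eq_of_root_eq (k := k) (l := p.lift (p.onH k)) (by rw [hk', p.onV_sheet]; exact hv)
          (by rw [p.root_lift, hkv, hk']) (p.onH_lift _).symm]
    have h0 := hfree _ hflow
    have h0' : ∀ h, c (p.lift h) = 0 := fun h => Int.cast_eq_zero.mp (congrFun h0 h)
    ext k
    change c k = 0
    by_cases hk : k = p.lift (p.onH k)
    · rw [hk, h0']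
    · rw [hpair _ _ hk (p.onH_lift _).symm, h0', neg_zero]

end DoubleCover

/-! ### Connected components, rigid sets and flow-free sets -/

namespace HalfEdgeGraph

namespace Subgraph

variable {V H : Type*} {G : HalfEdgeGraph V H}

theorem edge_mem_edges_iff {S : G.Subgraph} {h : H} : G.edge h ∈ S.edges ↔ h ∈ S.halves := by
  refine ⟨?_, fun hh => ⟨h, hh, rfl⟩⟩
  rintro ⟨k, hk, e⟩
  rcases (G.edge_eq_iff k h).mp e with rfl | rfl
  · exact hk
  · exact S.inv_mem _ hk

theorem component_connected (S : G.Subgraph) (v : V) : (S.component v).Connected :=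
  ⟨⟨v, Relation.ReflTransGen.refl⟩, fun _ hu _ hw =>
    ((S.component v).reach_symm (S.component_reach hu)).trans (S.component_reach hw)⟩

theorem mem_halves_component {S : G.Subgraph} {v : V} {h : H} (hh : h ∈ S.halves)
    (hv : G.root h ∈ (S.component v).verts) : h ∈ (S.component v).halves := ⟨hh, hv⟩

theorem root_inv_mem_component_iff {S : G.Subgraph} {v : V} {h : H} (hh : h ∈ S.halves) :
    G.root (G.inv h) ∈ (S.component v).verts ↔ G.root h ∈ (S.component v).verts := by
  refine ⟨fun hv => ?_, fun hv => ?_⟩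
  · have := (S.component v).root_mem _ ((S.component v).inv_mem _
      (mem_halves_component (S.inv_mem _ hh) hv))
    rwa [G.inv_inv] at this
  · exact (S.component v).root_mem _ ((S.component v).inv_mem _ (mem_halves_component hh hv))

/-- With all signs positive and a single vertex grounded, potentials on a connected subgraph vanish.
The coboundary from the remaining vertices is therefore injective. -/
theorem Connected.ncard_verts_le [Fintype V] [Fintype H] {S : G.Subgraph} (hS : S.Connected) :
    S.verts.ncard ≤ S.edges.ncard + 1 := by
  obtain ⟨v₀, hv₀⟩ := hS.1
  let s : G.Signing := ⟨{v₀}, fun _ => 1, fun _ => by norm_num, fun _ => rfl⟩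
  have h := Signing.ncard_le_of_potential_eq_zero (s := s) (U := S.verts \ {v₀}) (F := S.edges)
    disjoint_sdiff_self_left fun f hf h0 => by
      funext v
      by_cases hv : v ∈ S.verts
      · have := DoubleCover.potential_sq_eq hS (fun h hh => hf.2 h ⟨h, hh, rfl⟩) hv hv₀
        rw [hf.1 v₀ rfl, mul_zero] at this
        exact mul_self_eq_zero.mp this
      · exact h0 v fun h => hv h.1
  have := Set.ncard_sdiff_singleton_add_one hv₀
  omega

end Subgraph

namespace Signing

variable {V H : Type*} [Fintype V] [Fintype H] {G : HalfEdgeGraph V H} (s : G.Signing)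

/-- A set of edges on which there is no nonzero potential. -/
def Rigid (F : Set G.Edge) : Prop := ∀ f, s.IsPotential F f → f = 0

variable {s}

theorem Rigid.mono {F F' : Set G.Edge} (hF : s.Rigid F) (h : F ⊆ F') : s.Rigid F' :=
  fun f hf => hF f ⟨hf.1, fun k hk => hf.2 k (h hk)⟩

theorem rigid_iff {F : Set G.Edge} : s.Rigid F ↔
    ∀ f, s.IsPotential F f → (∀ v, v ∉ s.groundᶜ → f v = 0) → f = 0 :=
  ⟨fun h f hf _ => h f hf, fun h f hf => h f hf fun v hv => hf.1 v (not_not.mp hv)⟩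

theorem Rigid.ncard_eq {F : Set G.Edge} (hr : s.Rigid F) (hf : s.FlowFree F) :
    F.ncard = s.groundᶜ.ncard :=
  le_antisymm (hf.ncard_le disjoint_compl_left fun _ _ h => h)
    (ncard_le_of_potential_eq_zero disjoint_compl_left (rigid_iff.mp hr))

/-- An edge with a nonzero flow value can be removed from a rigid set: by orthogonality a potential
on the other edges has no defect on it. Conversely, rigid flow-free sets all have as many edges as
there are ungrounded vertices, so none contains another properly. -/
theorem minimal_rigid_iff {B : Set G.Edge} :
    (s.Rigid B ∧ ∀ B' ⊆ B, s.Rigid B' → B' = B) ↔ s.Rigid B ∧ s.FlowFree B := by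
  refine and_congr_right fun hr => ⟨fun hmin c hc => ?_, fun hf B' hB hr' => ?_⟩
  · by_contra hne
    obtain ⟨h₀, hh₀⟩ := Function.ne_iff.mp hne
    have he : G.edge h₀ ∈ B := by_contra fun h => hh₀ (hc.2.1 h₀ h)
    have hr' : s.Rigid (B \ {G.edge h₀}) := by
      intro f hf
      refine hr f ⟨hf.1, fun h hh => ?_⟩
      by_cases heq : G.edge h = G.edge h₀
      · have := hc.mul_defect_eq_zero hf.1 h₀ fun k hk hne => hf.2 k ⟨hk, hne⟩
        exact defect_eq_zero_of_edge_eq heq.symm ((mul_eq_zero.mp this).resolve_left hh₀)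
      · exact hf.2 h ⟨hh, heq⟩
    have := hmin _ Set.sdiff_subset hr'
    rw [← this] at he
    exact he.2 rfl
  · refine Set.eq_of_subset_of_ncard_le hB ?_
    rw [hr.ncard_eq hf, hr'.ncard_eq (hf.mono hB)]

/-- A maximal flow-free set is rigid: if a potential on it had a nonzero defect on a further edge,
then by orthogonality every flow would vanish on this edge, and the edge could be added. -/
theorem FlowFree.exists_rigid {F E : Set G.Edge} (hF : s.FlowFree F) (hFE : F ⊆ E)
    (hE : s.Rigid E) : ∃ B, F ⊆ B ∧ B ⊆ E ∧ s.Rigid B ∧ s.FlowFree B := by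
  obtain ⟨B, hFB, hB⟩ := Set.Finite.exists_le_maximal (s := {B | B ⊆ E ∧ s.FlowFree B})
    (Set.toFinite _) (a := F) ⟨hFE, hF⟩
  refine ⟨B, hFB, hB.prop.1, fun f hf => hE f ⟨hf.1, fun h hh => ?_⟩, hB.prop.2⟩
  by_contra hd
  have hins : s.FlowFree (insert (G.edge h) B) := by
    intro c hc
    have h0 : c h = 0 := (mul_eq_zero.mp (hc.mul_defect_eq_zero hf.1 h fun k hk hne =>
      hf.2 k (hk.resolve_left hne))).resolve_right hd
    refine hB.prop.2 c (hc.restrict fun k hk => ?_)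
    by_contra hkB
    by_cases hkh : G.edge h = G.edge k
    · exact hk (hc.eq_zero_of_edge_eq hkh h0)
    · exact hk (hc.2.1 k fun h' => h'.elim (fun e => hkh e.symm) hkB)
  have := hB.le_of_ge (y := insert (G.edge h) B) ⟨Set.insert_subset hh hB.prop.1, hins⟩
    (Set.subset_insert _ _)
  exact hd (hf.2 h (this (Set.mem_insert _ _)))

end Signing

end HalfEdgeGraph

/-! ### Bases and independent sets -/

namespace DoubleCover

open HalfEdgeGraph

variable {V' H' V H : Type*} [Fintype V'] [Fintype H'] [Fintype V] [Fintype H]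
  {G' : HalfEdgeGraph V' H'} {G : HalfEdgeGraph V H} (p : DoubleCover G' G)

theorem relConnectedOver_iff_rigid {I : Set G.Edge} :
    p.RelConnectedOver (G.deleteEdges I) ↔ p.signing.Rigid (p.undilatedEdges \ I) := by
  rw [p.relConnectedOver_iff, p.constantOff_eq_bot_iff]
  refine forall_congr' fun f => imp_congr_left ⟨fun hf => ⟨hf.1, fun h hh => hf.2 h hh.2⟩,
    fun hf => ⟨hf.1, fun h hh => ?_⟩⟩
  -- Both ends of a dilated edge are grounded, so dilated edges impose no condition on a potential.
  by_cases hd : p.DilatedHalf h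
  · rw [Signing.defect, hf.1 _ (p.dilated_root h hd),
      hf.1 _ (p.dilated_root _ (p.dilated_inv h hd)), mul_zero, sub_zero]
  · exact hf.2 h ⟨⟨h, rfl, hd⟩, hh⟩

theorem signedCographicMatroid_indep_iff (hG : G.whole.Connected) (hp : p.Nontrivial)
    {I : Set G.Edge} : (p.signedCographicMatroid hG hp).Indep I ↔
      I ⊆ p.undilatedEdges ∧ p.signing.Rigid (p.undilatedEdges \ I) := by
  rw [← p.relConnectedOver_iff_rigid]
  rfl

theorem signedCographicMatroid_ground (hG : G.whole.Connected) (hp : p.Nontrivial) :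
    (p.signedCographicMatroid hG hp).E = p.undilatedEdges := rfl

/-- Bases of the dual are the complements of maximal sets whose complement is rigid, that is, the
minimal rigid sets. -/
theorem isBase_iff (hG : G.whole.Connected) (hp : p.Nontrivial) {B : Set G.Edge}
    (hB : B ⊆ p.undilatedEdges) : (p.signedGraphicMatroid hG hp).IsBase B ↔
      p.signing.Rigid B ∧ p.signing.FlowFree B := by
  rw [signedGraphicMatroid, Matroid.dual_isBase_iff (by exact hB),
    p.signedCographicMatroid_ground, Matroid.isBase_iff_maximal_indep,
    ← Signing.minimal_rigid_iff]
  have hcc : p.undilatedEdges \ (p.undilatedEdges \ B) = B := Set.sdiff_sdiff_cancel_left hB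
  constructor
  · intro h
    have h1 := ((p.signedCographicMatroid_indep_iff hG hp).mp h.prop).2
    rw [hcc] at h1
    refine ⟨h1, fun B' hB' hr => ?_⟩
    have hc' : p.undilatedEdges \ (p.undilatedEdges \ B') = B' :=
      Set.sdiff_sdiff_cancel_left (hB'.trans hB)
    have h2 := h.eq_of_ge (y := p.undilatedEdges \ B')
      ((p.signedCographicMatroid_indep_iff hG hp).mpr ⟨Set.sdiff_subset, by rwa [hc']⟩)
      (Set.sdiff_subset_sdiff_right hB')
    rw [← hcc, ← h2, hc']
  · rintro ⟨h1, h2⟩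
    refine ⟨(p.signedCographicMatroid_indep_iff hG hp).mpr ⟨Set.sdiff_subset, by rwa [hcc]⟩,
      fun I hI hle => ?_⟩
    obtain ⟨hIE, hr⟩ := (p.signedCographicMatroid_indep_iff hG hp).mp hI
    have h3 := h2 _ (by
      rw [← hcc]
      exact Set.sdiff_subset_sdiff_right hle) hr
    change I ⊆ _
    rw [← h3, Set.sdiff_sdiff_cancel_left hIE]

theorem rigid_undilatedEdges (hG : G.whole.Connected) (hp : p.Nontrivial) :
    p.signing.Rigid p.undilatedEdges := by
  have := ((p.signedCographicMatroid_indep_iff hG hp).mp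
    (p.signedCographicMatroid hG hp).empty_indep).2
  rwa [Set.sdiff_empty] at this

theorem indep_iff (hG : G.whole.Connected) (hp : p.Nontrivial) {F : Set G.Edge}
    (hF : F ⊆ p.undilatedEdges) : (p.signedGraphicMatroid hG hp).Indep F ↔
      p.signing.FlowFree F := by
  rw [Matroid.indep_iff]
  constructor
  · rintro ⟨B, hB, hFB⟩
    exact (((p.isBase_iff hG hp hB.subset_ground).mp hB).2).mono hFB
  · intro h
    obtain ⟨B, h1, h2, h3⟩ := h.exists_rigid hF (p.rigid_undilatedEdges hG hp)
    exact ⟨B, (p.isBase_iff hG hp h2).mpr h3, h1⟩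

/-- Without dilated edges the dilated part consists of isolated vertices. Its genus only counts
them, and it is connected when there is exactly one. -/
theorem genus_dilatedPart {S : G.Subgraph} (hS : ∀ h ∈ S.halves, ¬ p.DilatedHalf h) :
    (p.dilatedPart S).genus = 1 - ((S.verts ∩ p.signing.ground).ncard : ℤ) := by
  have h1 : (p.dilatedPart S).edges = ∅ := by
    rw [Set.eq_empty_iff_forall_notMem]
    rintro _ ⟨h, hh, rfl⟩
    exact hS h hh.1 hh.2
  have h2 : (p.dilatedPart S).verts = S.verts ∩ p.signing.ground := rfl
  rw [Subgraph.genus, h1, h2, Set.ncard_empty]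
  push_cast
  ring

theorem dilatedPart_connected_iff {S : G.Subgraph} (hS : ∀ h ∈ S.halves, ¬ p.DilatedHalf h) :
    (p.dilatedPart S).Connected ↔ (S.verts ∩ p.signing.ground).ncard = 1 := by
  have h2 : (p.dilatedPart S).verts = S.verts ∩ p.signing.ground := rfl
  rw [Set.ncard_eq_one, Subgraph.Connected, h2]
  constructor
  · rintro ⟨⟨v, hv⟩, h⟩
    refine ⟨v, Set.eq_singleton_iff_unique_mem.mpr ⟨hv, fun w hw => ?_⟩⟩
    rcases Relation.ReflTransGen.cases_head (h w hw v hv) with h | ⟨_, ⟨k, hk, -⟩, -⟩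
    · exact h
    · exact (hS k hk.1 hk.2).elim
  · rintro ⟨v, hv⟩
    rw [hv]
    refine ⟨⟨v, rfl⟩, ?_⟩
    rintro _ rfl _ rfl
    exact Relation.ReflTransGen.refl

theorem ncard_verts (S : G.Subgraph) : (S.verts \ p.signing.ground).ncard +
    (S.verts ∩ p.signing.ground).ncard = S.verts.ncard := by
  rw [add_comm]
  exact Set.ncard_inter_add_ncard_sdiff_eq_ncard S.verts p.signing.ground

/-- On a connected subgraph over which the cover is not trivial there is no potential. -/
theorem eq_zero_of_not_trivialFreeOver {S : G.Subgraph} (hS : S.Connected)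
    (hn : ¬ p.TrivialFreeOver S) {f : V → ℚ} (hf : p.signing.IsPotential S.edges f) {v : V}
    (hv : v ∈ S.verts) : f v = 0 :=
  by_contra fun h => hn (p.trivialFreeOver_of_potential hS hf.1 (fun k hk => hf.2 k ⟨k, hk, rfl⟩)
    hv h)

theorem root_mem_of_edge_mem_edges {S : G.Subgraph} (h : H) (hh : G.edge h ∈ S.edges)
    (hd : G.root h ∉ p.signing.ground) : G.root h ∈ S.verts \ p.signing.ground :=
  ⟨S.root_mem _ (Subgraph.edge_mem_edges_iff.mp hh), hd⟩

/-- The cover is elementary over a connected subgraph without dilated edges if and only if it is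
not trivial there and there are as many edges as undilated vertices. -/
theorem elementaryOver_iff {S : G.Subgraph} (hS : S.Connected)
    (hu : ∀ h ∈ S.halves, ¬ p.DilatedHalf h) : p.ElementaryOver S ↔
      ¬ p.TrivialFreeOver S ∧ S.edges.ncard = (S.verts \ p.signing.ground).ncard := by
  have hcard := p.ncard_verts S
  have hle := hS.ncard_verts_le
  have hfree : p.FreeOver S ↔ (S.verts ∩ p.signing.ground).ncard = 0 := by
    rw [Set.ncard_eq_zero]
    exact ⟨fun h => Set.eq_empty_iff_forall_notMem.mpr fun v hv => h v hv.1 hv.2,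
      fun h v hv hd => (h ▸ (⟨hv, hd⟩ : v ∈ S.verts ∩ p.signing.ground) : v ∈ (∅ : Set V))⟩
  have htriv : p.TrivialFreeOver S → p.FreeOver S := fun h v hv hd => by
    obtain ⟨f, h1, -, h3⟩ := p.exists_potential_of_trivialFreeOver h
    exact h3 v hv (h1 v hd)
  rw [ElementaryOver, p.dilatedPart_connected_iff hu, p.genus_dilatedPart hu, hfree]
  rw [hfree] at htriv
  simp only [Subgraph.genus]
  constructor
  · rintro (⟨h1, -, h2, h3⟩ | ⟨h1, -, h2, h3⟩)
    · exact ⟨fun h => h1 (htriv h), by omega⟩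
    · exact ⟨h3, by omega⟩
  · rintro ⟨h1, h2⟩
    -- If S has d dilated vertices, |E| = |V| - d and |V| ≤ |E| + 1 force d ≤ 1: for d = 0 the cover
    -- is free and the genus is one, for d = 1 it is dilated and both genera are zero.
    by_cases h3 : (S.verts ∩ p.signing.ground).ncard = 0
    · exact Or.inr ⟨h3, hS, by omega, h1⟩
    · exact Or.inl ⟨h3, hS, by omega, by omega⟩

theorem edges_component_subset {F : Set G.Edge} (v : V) :
    ((G.generatedBy F).component v).edges ⊆ F := by
  rintro _ ⟨h, hh, rfl⟩
  exact hh.1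

/-- A flow can be restricted to a connected component. -/
theorem isFlow_component {s : G.Signing} {F : Set G.Edge} {c : H → ℚ} (hc : s.IsFlow F c) (v : V) :
    s.IsFlow ((G.generatedBy F).component v).edges
      fun h => if G.root h ∈ ((G.generatedBy F).component v).verts then c h else 0 := by
  refine ⟨fun h => ?_, fun h hh => ?_, fun w hw => ?_⟩
  · by_cases hF : G.edge h ∈ F
    · simp only [Subgraph.root_inv_mem_component_iff (S := G.generatedBy F) hF, hc.1]
      split_ifs <;> simp
    · simp [hc.2.1 h hF, hc.2.1 (G.inv h) (by rwa [G.edge_inv])]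
  · by_cases hF : G.edge h ∈ F
    · exact if_neg fun hv => hh ⟨h, Subgraph.mem_halves_component hF hv, rfl⟩
    · simp [hc.2.1 h hF]
  · by_cases hv : w ∈ ((G.generatedBy F).component v).verts
    · rw [← hc.2.2 w hw]
      refine Finset.sum_congr rfl fun h hh => if_pos ?_
      rwa [(Finset.mem_filter.mp hh).2]
    · refine Finset.sum_eq_zero fun h hh => if_neg ?_
      rwa [(Finset.mem_filter.mp hh).2]

/-- Potentials and flows split over the components of G[F]. On a component, rigidity gives
nontriviality and at least as many edges as undilated vertices, and absence of flows gives at most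
as many. Conversely, nontriviality removes potentials, and equality of the numbers then removes
flows. -/
theorem rigid_flowFree_iff {F : Set G.Edge} (hF : F ⊆ p.undilatedEdges) :
    p.signing.Rigid F ∧ p.signing.FlowFree F ↔
      (∀ v, ¬ p.DilatedVert v → v ∈ (G.generatedBy F).verts) ∧
        ∀ C, (G.generatedBy F).IsComponent C → p.ElementaryOver C := by
  have hel : ∀ v, p.ElementaryOver ((G.generatedBy F).component v) ↔
      ¬ p.TrivialFreeOver ((G.generatedBy F).component v) ∧
        ((G.generatedBy F).component v).edges.ncard =
          (((G.generatedBy F).component v).verts \ p.signing.ground).ncard := fun v =>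
    p.elementaryOver_iff (Subgraph.component_connected _ v)
      fun h hh => p.not_dilatedHalf hF hh.1
  constructor
  · rintro ⟨hr, hf⟩
    refine ⟨fun v hv => ?_, ?_⟩
    · by_contra hvF
      -- A vertex missed by F is unconstrained, so that its indicator is a potential.
      have := hr (fun w => if w = v then 1 else 0) ⟨fun w hw => if_neg (by rintro rfl; exact hv hw),
        fun h hh => ?_⟩
      · have := congrFun this v
        simp at this
      · rw [Signing.defect, if_neg, if_neg]
        · simp
        · exact fun e => hvF ⟨G.inv h, by rwa [G.edge_inv], e⟩
        · exact fun e => hvF ⟨h, hh, e⟩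
    · rintro _ ⟨v, hv, rfl⟩
      rw [hel]
      -- A potential on the component extends by zero to all of F, since no edge of F leaves the
      -- component.
      have hext : ∀ f, (∀ v ∈ p.signing.ground, f v = 0) →
          (∀ h ∈ ((G.generatedBy F).component v).halves, p.signing.defect f h = 0) →
          (∀ w, w ∉ ((G.generatedBy F).component v).verts → f w = 0) → f = 0 := by
        intro f h1 h2 h3
        refine hr f ⟨h1, fun h hh => ?_⟩
        by_cases hC : G.root h ∈ ((G.generatedBy F).component v).verts
        · exact h2 h ⟨hh, hC⟩
        · rw [Signing.defect, h3 _ hC, h3, mul_zero, sub_zero]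
          rwa [Subgraph.root_inv_mem_component_iff (S := G.generatedBy F) hh]
      refine ⟨fun ht => ?_, le_antisymm ?_ ?_⟩
      · obtain ⟨f, h1, h2, h3⟩ := p.exists_potential_of_trivialFreeOver ht
        have hvC : v ∈ ((G.generatedBy F).component v).verts := Relation.ReflTransGen.refl
        have h0 := congrFun (hext
          (fun w => if w ∈ ((G.generatedBy F).component v).verts then f w else 0)
          (fun w hw => by rw [h1 w hw, ite_self]) (fun h hh => by
            have hc := ((G.generatedBy F).component v).root_mem _ hh
            have hc' := ((G.generatedBy F).component v).root_mem _
              (((G.generatedBy F).component v).inv_mem _ hh)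
            rw [Signing.defect, if_pos hc, if_pos hc']
            exact h2 h hh) fun w hw => if_neg hw) v
        rw [if_pos hvC] at h0
        exact h3 v hvC h0
      · exact (hf.mono (edges_component_subset v)).ncard_le disjoint_sdiff_self_left
          p.root_mem_of_edge_mem_edges
      · refine Signing.ncard_le_of_potential_eq_zero disjoint_sdiff_self_left fun f hf h0 =>
          hext f hf.1 (fun h hh => hf.2 h ⟨h, hh, rfl⟩) fun w hw => h0 w fun h => hw h.1
  · rintro ⟨hv, hC⟩
    refine ⟨fun f hf => ?_, fun c hc => ?_⟩
    · funext v
      by_cases hd : p.DilatedVert v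
      · exact hf.1 v hd
      · have h1 := (hel v).mp (hC _ ⟨v, hv v hd, rfl⟩)
        exact p.eq_zero_of_not_trivialFreeOver (Subgraph.component_connected _ v) h1.1
          ⟨hf.1, fun h hh => hf.2 h (edges_component_subset v hh)⟩ Relation.ReflTransGen.refl
    · funext h
      by_cases hF : G.edge h ∈ F
      swap
      · exact hc.2.1 h hF
      have h1 := (hel (G.root h)).mp (hC _ ⟨G.root h, ⟨h, hF, rfl⟩, rfl⟩)
      have h2 := (Signing.flowFree_iff_of_ncard_eq (s := p.signing) disjoint_sdiff_self_left
        p.root_mem_of_edge_mem_edges h1.2).mpr fun f hf h0 => by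
          funext w
          by_cases hw : w ∈ ((G.generatedBy F).component (G.root h)).verts
          · exact p.eq_zero_of_not_trivialFreeOver (Subgraph.component_connected _ _) h1.1 hf hw
          · exact h0 w fun h => hw h.1
      have h3 := congrFun (h2 _ (isFlow_component hc (G.root h))) h
      rwa [if_pos] at h3
      exact Relation.ReflTransGen.refl

end DoubleCover

namespace HalfEdgeGraph

variable {V H : Type*} {G : HalfEdgeGraph V H}

/-! ### Degrees -/

/-- The number of half-edges in `F` at a vertex. -/
noncomputable def degree (G : HalfEdgeGraph V H) (F : Set G.Edge) (v : V) : ℕ :=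
  {h | G.edge h ∈ F ∧ G.root h = v}.ncard

theorem edges_generatedBy (F : Set G.Edge) : (G.generatedBy F).edges = F := by
  ext e
  constructor
  · rintro ⟨h, hh, rfl⟩
    exact hh
  · intro he
    exact ⟨G.rep e, by change G.edge _ ∈ F; rwa [edge_rep], G.edge_rep e⟩

section Degree

variable [Finite H]

theorem degree_mono {P F : Set G.Edge} (h : P ⊆ F) (v : V) : G.degree P v ≤ G.degree F v :=
  Set.ncard_le_ncard (fun _ hx => ⟨h hx.1, hx.2⟩) (Set.toFinite _)

theorem degree_union {P Q : Set G.Edge} (h : Disjoint P Q) (v : V) :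
    G.degree (P ∪ Q) v = G.degree P v + G.degree Q v := by
  rw [degree, degree, degree, ← Set.ncard_union_eq (Set.disjoint_left.mpr fun x hx hy =>
    Set.disjoint_left.mp h hx.1 hy.1) (Set.toFinite _) (Set.toFinite _)]
  congr 1
  ext x
  simp only [Set.mem_union, Set.mem_ofPred_eq]
  tauto

theorem degree_sdiff_add {P F : Set G.Edge} (h : P ⊆ F) (v : V) :
    G.degree (F \ P) v + G.degree P v = G.degree F v := by
  rw [← degree_union disjoint_sdiff_self_left, Set.sdiff_union_of_subset h]

theorem degree_singleton (h : H) (v : V) : G.degree {G.edge h} v =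
    (if G.root h = v then 1 else 0) + if G.root (G.inv h) = v then 1 else 0 := by
  have hs : {k | G.edge k ∈ ({G.edge h} : Set G.Edge) ∧ G.root k = v} =
      {k | k = h ∧ G.root h = v} ∪ {k | k = G.inv h ∧ G.root (G.inv h) = v} := by
    ext k
    simp only [Set.mem_ofPred_eq, Set.mem_singleton_iff, edge_eq_iff', Set.mem_union]
    constructor
    · rintro ⟨rfl | rfl, hk⟩
      · exact Or.inl ⟨rfl, hk⟩
      · exact Or.inr ⟨rfl, hk⟩
    · rintro (⟨rfl, hk⟩ | ⟨rfl, hk⟩)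
      · exact ⟨Or.inl rfl, hk⟩
      · exact ⟨Or.inr rfl, hk⟩
  have hone : ∀ k : H, {x | x = k ∧ G.root k = v}.ncard = if G.root k = v then 1 else 0 := by
    intro k
    split_ifs with hk
    · simp [hk]
    · simp [hk]
  rw [degree, hs, Set.ncard_union_eq _ (Set.toFinite _) (Set.toFinite _), hone, hone]
  rw [Set.disjoint_left]
  rintro k ⟨rfl, -⟩ ⟨e, -⟩
  exact G.inv_ne k e.symm

theorem degree_pos_iff {F : Set G.Edge} {v : V} :
    0 < G.degree F v ↔ ∃ h, G.edge h ∈ F ∧ G.root h = v := by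
  rw [degree, Set.ncard_pos (Set.toFinite _)]
  rfl

theorem degree_pos_iff_mem {F : Set G.Edge} {v : V} :
    0 < G.degree F v ↔ v ∈ (G.generatedBy F).verts := degree_pos_iff

theorem sum_degree [Fintype V] (F : Set G.Edge) : ∑ v, G.degree F v = 2 * F.ncard := by
  refine Set.Finite.induction_on F (Set.toFinite _) ?_ ?_
  · simp [degree]
  · intro e s he hs ih
    rw [Set.ncard_insert_of_notMem he hs, Set.insert_eq, mul_add, ← ih]
    simp_rw [degree_union (Set.disjoint_singleton_left.mpr he)]
    rw [Finset.sum_add_distrib, add_comm, ← G.edge_rep e]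
    simp_rw [degree_singleton]
    rw [Finset.sum_add_distrib]
    simp

end Degree

/-! ### Chains -/

theorem IsChain.map_root {u w : V} {l : List H} (h : G.IsChain u l w) (hl : l ≠ []) :
    l.map G.root = u :: G.chainInterior l := by
  cases l with
  | nil => exact absurd rfl hl
  | cons k t => rw [← h.1]; rfl

theorem IsChain.map_root_inv {u w : V} {l : List H} (h : G.IsChain u l w) (hl : l ≠ []) :
    l.map (fun k => G.root (G.inv k)) = G.chainInterior l ++ [w] := by
  induction l generalizing u with
  | nil => exact absurd rfl hl
  | cons k t ih =>
    obtain ⟨-, h2⟩ := h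
    cases t with
    | nil =>
      have : G.root (G.inv k) = w := h2
      simp [chainInterior, this]
    | cons m t' =>
      rw [List.map_cons, ih h2 (by simp)]
      simp [chainInterior, h2.1]

theorem IsChain.append {u v w : V} {l l' : List H} (h : G.IsChain u l v) (h' : G.IsChain v l' w) :
    G.IsChain u (l ++ l') w := by
  induction l generalizing u with
  | nil =>
    have : u = v := h
    rw [this]
    exact h'
  | cons k t ih => exact ⟨h.1, ih h.2⟩

theorem chainInterior_concat {l : List H} (hl : l ≠ []) (k : H) :
    G.chainInterior (l ++ [k]) = G.chainInterior l ++ [G.root k] := by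
  cases l with
  | nil => exact absurd rfl hl
  | cons m t => simp [chainInterior]

theorem length_chainInterior {l : List H} (hl : l ≠ []) :
    (G.chainInterior l).length + 1 = (G.chainEdges l).length := by
  cases l with
  | nil => exact absurd rfl hl
  | cons m t => simp [chainInterior, chainEdges]

/-- The set of edges of a chain. -/
def chainSet (G : HalfEdgeGraph V H) (l : List H) : Set G.Edge := {e | e ∈ G.chainEdges l}

theorem mem_chainSet {l : List H} {k : H} : G.edge k ∈ G.chainSet l ↔ k ∈ l ∨ G.inv k ∈ l := by
  change G.edge k ∈ l.map G.edge ↔ _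
  rw [List.mem_map]
  constructor
  · rintro ⟨x, hx, e⟩
    rcases (G.edge_eq_iff x k).mp e with rfl | rfl
    · exact Or.inl hx
    · exact Or.inr (by rwa [G.inv_inv])
  · rintro (hk | hk)
    · exact ⟨k, hk, rfl⟩
    · exact ⟨_, hk, G.edge_inv k⟩

theorem mem_chainSet_of_mem {l : List H} {k : H} (hk : k ∈ l) : G.edge k ∈ G.chainSet l :=
  mem_chainSet.mpr (Or.inl hk)

theorem chainSet_nonempty {l : List H} (hl : l ≠ []) : (G.chainSet l).Nonempty := by
  obtain ⟨k, hk⟩ := List.exists_mem_of_ne_nil l hl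
  exact ⟨_, mem_chainSet_of_mem hk⟩

theorem ncard_chainSet {l : List H} (h : (G.chainEdges l).Nodup) :
    (G.chainSet l).ncard = (G.chainEdges l).length := by
  rw [← List.toFinset_card_of_nodup h, ← Set.ncard_coe_finset]
  congr 1
  ext e
  simp [chainSet]

theorem degree_chainSet [Finite H] {l : List H} (h : (G.chainEdges l).Nodup) (v : V) :
    G.degree (G.chainSet l) v =
      (l.map G.root).count v + (l.map fun k => G.root (G.inv k)).count v := by
  induction l with
  | nil => simp [degree, chainSet, chainEdges]
  | cons k t ih =>
    have hn : G.edge k ∉ G.chainEdges t ∧ (G.chainEdges t).Nodup := List.nodup_cons.mp h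
    have hs : G.chainSet (k :: t) = {G.edge k} ∪ G.chainSet t := by
      ext e
      simp [chainSet, chainEdges]
    rw [hs, degree_union (Set.disjoint_singleton_left.mpr hn.1), degree_singleton, ih hn.2]
    simp only [List.map_cons, List.count_cons, beq_iff_eq]
    ring

/-- The roots of the half-edges list the start and the interior, the roots of their partners list
the interior and the end; interior vertices are therefore counted twice. -/
theorem IsChain.degree_chainSet [Finite H] {u w : V} {l : List H} (h : G.IsChain u l w)
    (hl : l ≠ []) (hn : (G.chainEdges l).Nodup) (v : V) :
    G.degree (G.chainSet l) v = 2 * (G.chainInterior l).count v + (if u = v then 1 else 0) +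
      if w = v then 1 else 0 := by
  rw [HalfEdgeGraph.degree_chainSet hn, h.map_root hl, h.map_root_inv hl]
  simp only [List.count_cons, List.count_append, List.count_nil, beq_iff_eq]
  ring

theorem IsChain.mem_verts {u w : V} {l : List H} (h : G.IsChain u l w) (hl : l ≠ []) {v : V} :
    v ∈ (G.generatedBy (G.chainSet l)).verts ↔ v = u ∨ v = w ∨ v ∈ G.chainInterior l := by
  have h1 : v ∈ l.map G.root ↔ v = u ∨ v ∈ G.chainInterior l := by
    rw [h.map_root hl, List.mem_cons]
  have h2 : v ∈ l.map (fun k => G.root (G.inv k)) ↔ v ∈ G.chainInterior l ∨ v = w := by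
    rw [h.map_root_inv hl, List.mem_append, List.mem_singleton]
  have h3 : v ∈ (G.generatedBy (G.chainSet l)).verts ↔
      v ∈ l.map G.root ∨ v ∈ l.map (fun k => G.root (G.inv k)) := by
    rw [List.mem_map, List.mem_map]
    constructor
    · rintro ⟨k, hk, rfl⟩
      rcases mem_chainSet.mp hk with hk | hk
      · exact Or.inl ⟨k, hk, rfl⟩
      · exact Or.inr ⟨_, hk, by rw [G.inv_inv]⟩
    · rintro (⟨k, hk, rfl⟩ | ⟨k, hk, rfl⟩)
      · exact ⟨k, mem_chainSet_of_mem hk, rfl⟩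
      · exact ⟨G.inv k, by rw [G.edge_inv]; exact mem_chainSet_of_mem hk, rfl⟩
  rw [h3, h1, h2]
  tauto

theorem IsChain.reach {S : G.Subgraph} {u w : V} {l : List H} (h : G.IsChain u l w)
    (hS : ∀ k ∈ l, k ∈ S.halves) : ∀ k ∈ l, S.Reach u (G.root k) := by
  induction l generalizing u with
  | nil => simp
  | cons m t ih =>
    intro k hk
    obtain ⟨rfl, h2⟩ := h
    rcases List.mem_cons.mp hk with rfl | hk
    · exact Relation.ReflTransGen.refl
    · exact Relation.ReflTransGen.head ⟨m, hS m (by simp), rfl, rfl⟩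
        (ih h2 (fun x hx => hS x (by simp [hx])) k hk)

theorem IsChain.connected {u w : V} {l : List H} (h : G.IsChain u l w) (hl : l ≠ []) :
    (G.generatedBy (G.chainSet l)).Connected := by
  have key : ∀ v ∈ (G.generatedBy (G.chainSet l)).verts,
      (G.generatedBy (G.chainSet l)).Reach u v := by
    have hr := h.reach (S := G.generatedBy (G.chainSet l)) fun k hk => mem_chainSet_of_mem hk
    rintro v ⟨k, hk, rfl⟩
    rcases mem_chainSet.mp hk with hk | hk
    · exact hr k hk
    · exact (hr _ hk).tail ⟨G.inv k, mem_chainSet_of_mem hk, rfl, by rw [G.inv_inv]⟩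
  exact ⟨⟨u, (h.mem_verts hl).mpr (Or.inl rfl)⟩, fun a ha b hb =>
    ((G.generatedBy (G.chainSet l)).reach_symm (key a ha)).trans (key b hb)⟩

/-- A chain with distinct edges and distinct interior vertices, none of which is an end. -/
structure IsArc (G : HalfEdgeGraph V H) (u : V) (l : List H) (w : V) : Prop where
  ne_nil : l ≠ []
  chain : G.IsChain u l w
  edges_nodup : (G.chainEdges l).Nodup
  interior_nodup : (G.chainInterior l).Nodup
  left_notMem : u ∉ G.chainInterior l
  right_notMem : w ∉ G.chainInterior l

namespace IsArc

variable [Finite H] {u w : V} {l : List H}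

theorem degree_interior (hl : G.IsArc u l w) {v : V} (hv : v ∈ G.chainInterior l) :
    G.degree (G.chainSet l) v = 2 := by
  rw [hl.chain.degree_chainSet hl.ne_nil hl.edges_nodup, List.count_eq_one_of_mem
    hl.interior_nodup hv, if_neg, if_neg]
  · rintro rfl
    exact hl.right_notMem hv
  · rintro rfl
    exact hl.left_notMem hv

theorem degree_of_notMem (hl : G.IsArc u l w) {v : V} (hv : v ∉ G.chainInterior l) :
    G.degree (G.chainSet l) v = (if u = v then 1 else 0) + if w = v then 1 else 0 := by
  rw [hl.chain.degree_chainSet hl.ne_nil hl.edges_nodup, List.count_eq_zero_of_not_mem hv]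
  simp

end IsArc

/-- From every half-edge at a vertex in `X` there is an arc to a vertex in `X`, if there are no
branchings outside `X`. -/
theorem exists_isArc [Finite H] {F : Set G.Edge} {X : Set V}
    (hX : ∀ v, v ∉ X → G.degree F v = 0 ∨ G.degree F v = 2) {u : V} (hu : u ∈ X)
    (hd : 0 < G.degree F u) : ∃ l, ∃ w ∈ X, G.IsArc u l w ∧ G.chainSet l ⊆ F ∧
      ∀ v ∈ G.chainInterior l, v ∉ X := by
  -- A greedy walk from u, stopped at its first return to X; `n` bounds the number of edges of F not
  -- yet used.
  have key : ∀ (n : ℕ) (l : List H) (w : V), F.ncard ≤ (G.chainEdges l).length + n → l ≠ [] →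
      G.IsChain u l w → (G.chainEdges l).Nodup → (G.chainInterior l).Nodup →
      G.chainSet l ⊆ F → (∀ v ∈ G.chainInterior l, v ∉ X) → ∃ l, ∃ w ∈ X, G.IsArc u l w ∧
        G.chainSet l ⊆ F ∧ ∀ v ∈ G.chainInterior l, v ∉ X := by
    intro n
    induction n with
    | zero | succ n ih =>
      intro l w hn hne hc h1 h2 h3 h4
      by_cases hw : w ∈ X
      · exact ⟨l, w, hw, ⟨hne, hc, h1, h2, fun h => h4 u h hu, fun h => h4 w h hw⟩, h3, h4⟩
      have huw : u ≠ w := fun e => hw (e ▸ hu)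
      have hdeg := hc.degree_chainSet hne h1 w
      rw [if_neg huw, if_pos rfl] at hdeg
      have hadd := degree_sdiff_add h3 w
      -- The walk has arrived at w outside X, where F has degree two. It has used an odd number of
      -- the half-edges there, hence exactly one: one is left, and w was not visited before.
      have hpos : 0 < G.degree (F \ G.chainSet l) w := by
        rcases hX w hw with h | h <;> omega
      have hcount : (G.chainInterior l).count w = 0 := by
        rcases hX w hw with h | h <;> omega
      rw [List.count_eq_zero] at hcount
      obtain ⟨k, hk, rfl⟩ := degree_pos_iff.mp hpos
      -- For n = 0 the walk has exhausted F, contrary to the unused half-edge at w; otherwise that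
      -- half-edge prolongs the walk.
      first
      | (refine absurd ?_ hk.2
         rw [Set.eq_of_subset_of_ncard_le h3 (by rw [ncard_chainSet h1]; omega)]
         exact hk.1)
      | (refine ih (l ++ [k]) (G.root (G.inv k)) ?_ (by simp) (hc.append ⟨rfl, rfl⟩) ?_ ?_ ?_ ?_
         · simp only [chainEdges, List.map_append, List.length_append, List.map_cons, List.map_nil,
             List.length_cons, List.length_nil, List.length_map] at hn ⊢
           omega
         · simp only [chainEdges, List.map_append, List.map_cons, List.map_nil]
           rw [← List.concat_eq_append, List.nodup_concat]
           exact ⟨hk.2, h1⟩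
         · rw [chainInterior_concat hne, ← List.concat_eq_append, List.nodup_concat]
           exact ⟨hcount, h2⟩
         · intro e he
           simp only [chainSet, chainEdges, List.map_append, List.map_cons, List.map_nil,
             List.mem_append, List.mem_singleton, Set.mem_ofPred_eq] at he
           rcases he with he | rfl
           · exact h3 he
           · exact hk.1
         · intro v hv
           rw [chainInterior_concat hne, List.mem_append, List.mem_singleton] at hv
           rcases hv with hv | rfl
           · exact h4 v hv
           · exact hw)
  obtain ⟨h, hh, rfl⟩ := degree_pos_iff.mp hd
  refine key F.ncard [h] (G.root (G.inv h)) (by omega) (by simp) ⟨rfl, rfl⟩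
    (by simp [chainEdges]) (by simp [chainInterior]) ?_ (by simp [chainInterior])
  rintro e he
  rw [show e = G.edge h by simpa [chainSet, chainEdges] using he]
  exact hh

/-! ### Flows on chains -/

namespace Signing

variable [Fintype H] {s : G.Signing} {F : Set G.Edge} {c : H → ℚ}

/-- The bound on the cardinality makes t the set of all half-edges of F at v, and the flow vanishes
on the others. -/
theorem IsFlow.sum_degree (hc : s.IsFlow F c) {v : V} (hv : v ∉ s.ground) {t : Finset H}
    (ht : ∀ h ∈ t, G.edge h ∈ F ∧ G.root h = v) (hcard : G.degree F v ≤ t.card) :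
    ∑ h ∈ t, c h = 0 := by
  rw [← hc.2.2 v hv]
  have hs : (t : Set H) = {h | G.edge h ∈ F ∧ G.root h = v} :=
    Set.eq_of_subset_of_ncard_le (fun h hh => ht h hh) (by rwa [Set.ncard_coe_finset])
  refine Finset.sum_subset (fun h hh => by simpa using (ht h hh).2) fun h hh hn => ?_
  refine hc.2.1 h fun hF => hn ?_
  have : h ∈ (t : Set H) := by
    rw [hs]
    exact ⟨hF, by simpa using hh⟩
  exact this

theorem IsFlow.eq_zero_of_degree_eq_one (hc : s.IsFlow F c) {h : H} (hv : G.root h ∉ s.ground)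
    (hd : G.degree F (G.root h) = 1) (hh : G.edge h ∈ F) : c h = 0 := by
  simpa using hc.sum_degree hv (t := {h}) (by simp [hh]) (by simp [hd])

theorem IsFlow.eq_zero_iff_of_degree_eq_two (hc : s.IsFlow F c) {h k : H} (hne : h ≠ k)
    (hr : G.root h = G.root k) (hv : G.root k ∉ s.ground) (hd : G.degree F (G.root k) = 2)
    (hh : G.edge h ∈ F) (hk : G.edge k ∈ F) : c h = 0 ↔ c k = 0 := by
  have := hc.sum_degree hv (t := {h, k}) (by simp [hh, hk, hr])
    (by rw [Finset.card_pair hne, hd])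
  rw [Finset.sum_pair hne] at this
  constructor
  · intro h0
    rwa [h0, zero_add] at this
  · intro h0
    rwa [h0, add_zero] at this

theorem IsFlow.eq_zero_iff_inv (hc : s.IsFlow F c) (h : H) : c (G.inv h) = 0 ↔ c h = 0 :=
  ⟨hc.eq_zero_of_edge_eq (G.edge_inv h), hc.eq_zero_of_edge_eq (G.edge_inv h).symm⟩

theorem IsFlow.eq_zero_iff_head (hc : s.IsFlow F c) {u w : V} {m : H} {t : List H}
    (hl : G.IsChain u (m :: t) w) (hn : (G.chainEdges (m :: t)).Nodup)
    (hF : G.chainSet (m :: t) ⊆ F)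
    (hd : ∀ v ∈ G.chainInterior (m :: t), v ∉ s.ground ∧ G.degree F v = 2) :
    ∀ k ∈ m :: t, (c k = 0 ↔ c m = 0) := by
  induction t generalizing u m with
  | nil => simp
  | cons x t ih =>
    intro k hk
    have hx : G.root x ∈ G.chainInterior (m :: x :: t) := by simp [chainInterior]
    have hn' : G.edge m ∉ G.chainEdges (x :: t) ∧ (G.chainEdges (x :: t)).Nodup :=
      List.nodup_cons.mp hn
    -- The vertex between consecutive edges has only the half-edges `G.inv m` and `x` in F, so
    -- conservation there leaves a sum of two terms.
    have h1 : c x = 0 ↔ c m = 0 := by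
      rw [← hc.eq_zero_iff_inv m]
      refine (hc.eq_zero_iff_of_degree_eq_two ?_ hl.2.1.symm (hd _ hx).1 (hd _ hx).2 ?_ ?_).symm
      · intro e
        refine hn'.1 ?_
        rw [← G.edge_inv, e]
        simp [chainEdges]
      · rw [G.edge_inv]
        exact hF (mem_chainSet_of_mem (by simp))
      · exact hF (mem_chainSet_of_mem (by simp))
    rcases List.mem_cons.mp hk with rfl | hk
    · rfl
    · refine (ih hl.2 hn'.2 (fun e he => hF ?_) (fun v hv => hd v ?_) k hk).trans h1
      · exact List.mem_cons_of_mem _ he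
      · exact List.mem_cons_of_mem _ hv

/-- A flow that vanishes on one edge of a chain without branchings vanishes on the chain. -/
theorem IsFlow.eq_zero_on_chain (hc : s.IsFlow F c) {u w : V} {l : List H}
    (hl : G.IsChain u l w) (hn : (G.chainEdges l).Nodup) (hF : G.chainSet l ⊆ F)
    (hd : ∀ v ∈ G.chainInterior l, v ∉ s.ground ∧ G.degree F v = 2) {h : H}
    (hh : G.edge h ∈ G.chainSet l) (h0 : c h = 0) : ∀ k, G.edge k ∈ G.chainSet l → c k = 0 := by
  have hl0 : ∃ x ∈ l, c x = 0 := by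
    rcases mem_chainSet.mp hh with hh | hh
    · exact ⟨h, hh, h0⟩
    · exact ⟨_, hh, (hc.eq_zero_iff_inv h).mpr h0⟩
  obtain ⟨x, hx, hx0⟩ := hl0
  have hall : ∀ k ∈ l, c k = 0 := by
    cases l with
    | nil => simp
    | cons m t =>
      have := hc.eq_zero_iff_head hl hn hF hd
      exact fun k hk => (this k hk).mpr ((this x hx).mp hx0)
  intro k hk
  rcases mem_chainSet.mp hk with hk | hk
  · exact hall k hk
  · exact (hc.eq_zero_iff_inv k).mp (hall _ hk)

/-- The restriction of a flow to a set of edges that does not meet its complement. -/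
theorem IsFlow.indicator (hc : s.IsFlow F c) {P : Set G.Edge}
    (h : ∀ h k, G.edge h ∈ P → G.edge k ∈ F \ P → G.root h ≠ G.root k) :
    s.IsFlow P fun k => if G.edge k ∈ P then c k else 0 := by
  refine ⟨fun k => ?_, fun k hk => if_neg hk, fun v hv => ?_⟩
  · simp only [G.edge_inv, hc.1]
    split_ifs <;> simp
  · by_cases hex : ∃ h, G.edge h ∈ P ∧ G.root h = v
    · obtain ⟨m, hm, rfl⟩ := hex
      refine (Finset.sum_congr rfl fun k hk => ?_).trans (hc.2.2 _ hv)
      change (if G.edge k ∈ P then c k else 0) = c k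
      split_ifs with hkP
      · rfl
      · refine (hc.2.1 k fun hkF => ?_).symm
        exact h m k hm ⟨hkF, hkP⟩ (Finset.mem_filter.mp hk).2.symm
    · refine Finset.sum_eq_zero fun k hk => if_neg fun hkP => hex ⟨k, hkP, ?_⟩
      exact (Finset.mem_filter.mp hk).2

/-- The unit flow along a chain, from its start to its end. -/
theorem exists_chain_flow (s : G.Signing) {u w : V} {l : List H} (hl : G.IsChain u l w) :
    ∃ (c : H → ℚ) (σ : ℚ), (σ = 1 ∨ σ = -1) ∧ (∀ h, c (G.inv h) = -(s.sign h * c h)) ∧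
      (∀ h, G.edge h ∉ G.chainSet l → c h = 0) ∧
      ∀ v, ∑ h with G.root h = v, c h = (if u = v then 1 else 0) - σ * if w = v then 1 else 0 := by
  induction l generalizing u with
  | nil =>
    have : u = w := hl
    subst this
    exact ⟨0, 1, Or.inl rfl, by simp, by simp, by simp⟩
  | cons m t ih =>
    obtain ⟨rfl, h2⟩ := hl
    obtain ⟨c, σ, hσ, c1, c2, c3⟩ := ih h2
    -- The unit flow on the first edge arrives at its far end with boundary minus the sign of `m`;
    -- adding this sign times the unit flow along the rest cancels it. Thus σ is the product of the
    -- signs.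
    refine ⟨fun h => (if h = m then 1 else 0) - s.sign m * (if h = G.inv m then 1 else 0) +
      s.sign m * c h, s.sign m * σ, ?_, fun h => ?_, fun h hh => ?_, fun v => ?_⟩
    · rcases s.sign_eq m with h | h <;> rcases hσ with h' | h' <;> simp [h, h']
    · have e1 : (G.inv h = G.inv m) = (h = m) := by
        rw [eq_iff_iff]
        exact ⟨fun e => by rw [← G.inv_inv h, e, G.inv_inv], fun e => by rw [e]⟩
      have e2 : (G.inv h = m) = (h = G.inv m) := by
        rw [eq_iff_iff]
        exact ⟨fun e => by rw [← e, G.inv_inv], fun e => by rw [e, G.inv_inv]⟩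
      simp only [e1, e2, c1]
      by_cases hm : h = m
      · subst hm
        rw [if_pos rfl, if_neg (G.inv_ne h).symm]
        ring
      · rw [if_neg hm]
        by_cases hm' : h = G.inv m
        · subst hm'
          rw [if_pos rfl, s.sign_inv]
          linear_combination -s.sign_mul_self m
        · rw [if_neg hm']
          ring
    · have hm : h ≠ m := by
        rintro rfl
        exact hh (mem_chainSet_of_mem (by simp))
      have hm' : h ≠ G.inv m := by
        rintro rfl
        exact hh (mem_chainSet.mpr (Or.inr (by simp [G.inv_inv])))
      simp [hm, hm', c2 h fun h' => hh (List.mem_cons_of_mem _ h')]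
    · rw [Finset.sum_add_distrib, Finset.sum_sub_distrib, ← Finset.mul_sum, ← Finset.mul_sum, c3,
        Finset.sum_ite_eq', Finset.sum_ite_eq']
      simp only [Finset.mem_filter, Finset.mem_univ, true_and]
      ring

/-- Two of three edge-disjoint chains with the same distinct undilated ends carry a flow. -/
theorem not_flowFree_of_three_chains (s : G.Signing) {u w : V} (hne : u ≠ w)
    {l : Fin 3 → List H} (hl : ∀ i, G.IsChain u (l i) w)
    (hd : ∀ i j, i ≠ j → Disjoint (G.chainSet (l i)) (G.chainSet (l j))) :
    ∃ i j, i ≠ j ∧ ¬ s.FlowFree (G.chainSet (l i) ∪ G.chainSet (l j)) := by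
  choose c σ hσ c1 c2 c3 using fun i => s.exists_chain_flow (hl i)
  -- Pigeonhole: three chains, two possible sign products.
  have hij : ∃ i j, i ≠ j ∧ σ i = σ j := by
    rcases hσ 0 with h0 | h0 <;> rcases hσ 1 with h1 | h1 <;> rcases hσ 2 with h2 | h2
    · exact ⟨0, 1, by decide, h0.trans h1.symm⟩
    · exact ⟨0, 1, by decide, h0.trans h1.symm⟩
    · exact ⟨0, 2, by decide, h0.trans h2.symm⟩
    · exact ⟨1, 2, by decide, h1.trans h2.symm⟩
    · exact ⟨1, 2, by decide, h1.trans h2.symm⟩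
    · exact ⟨0, 2, by decide, h0.trans h2.symm⟩
    · exact ⟨0, 1, by decide, h0.trans h1.symm⟩
    · exact ⟨0, 1, by decide, h0.trans h1.symm⟩
  obtain ⟨i, j, hij, hs⟩ := hij
  refine ⟨i, j, hij, fun hfree => ?_⟩
  -- With equal sign products the two unit flows have the same boundary, so their difference is
  -- conserved everywhere. It is nonzero because the unit flow on the first chain has boundary 1 at
  -- u.
  have h0 := hfree (fun h => c i h - c j h) ⟨fun h => ?_, fun h hh => ?_, fun v _ => ?_⟩
  · have hi0 : ∀ h, c i h = 0 := by
      intro h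
      by_cases hi : G.edge h ∈ G.chainSet (l i)
      · have := congrFun h0 h
        simp only [Pi.zero_apply] at this
        rwa [c2 j h (Set.disjoint_left.mp (hd i j hij) hi), sub_zero] at this
      · exact c2 i h hi
    have := c3 i u
    rw [if_pos rfl, if_neg hne.symm, Finset.sum_eq_zero fun h _ => hi0 h] at this
    norm_num at this
  · simp only [c1]
    ring
  · rw [Set.mem_union, not_or] at hh
    simp [c2 i h hh.1, c2 j h hh.2]
  · rw [Finset.sum_sub_distrib, c3, c3, hs, sub_self]

end Signing

end HalfEdgeGraph

/-! ### Circuits of signed graphs -/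

namespace HalfEdgeGraph

variable {V H : Type*} {G : HalfEdgeGraph V H}

theorem degree_biUnion [Finite H] {ι : Type*} (J : Finset ι) (P : ι → Set G.Edge)
    (hP : ∀ i ∈ J, ∀ j ∈ J, i ≠ j → Disjoint (P i) (P j)) (v : V) :
    G.degree (⋃ i ∈ J, P i) v = ∑ i ∈ J, G.degree (P i) v := by
  induction J using Finset.induction_on with
  | empty => simp [degree]
  | insert i J hi ih =>
    rw [Finset.sum_insert hi, Finset.set_biUnion_insert, degree_union, ih]
    · exact fun a ha b hb => hP a (Finset.mem_insert_of_mem ha) b (Finset.mem_insert_of_mem hb)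
    · rw [Set.disjoint_iUnion₂_right]
      exact fun j hj => hP i (Finset.mem_insert_self _ _) j (Finset.mem_insert_of_mem hj)
        fun e => hi (e ▸ hj)

namespace Signing

variable [Fintype H] (s : G.Signing) {F : Set G.Edge} {c : H → ℚ}

/-- A minimal set of edges that supports a nonzero flow. -/
def IsCircuit (F : Set G.Edge) : Prop := ¬ s.FlowFree F ∧ ∀ F', F' ⊂ F → s.FlowFree F'

variable {s}

theorem IsCircuit.eq_of_subset (hF : s.IsCircuit F) {P : Set G.Edge} (hP : P ⊆ F)
    (h : ¬ s.FlowFree P) : P = F :=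
  by_contra fun hne => h (hF.2 P (hP.ssubset_of_ne hne))

/-- If every flow that vanishes somewhere on `F` is zero, then `F` is a circuit. -/
theorem isCircuit_of_flow (hF : ¬ s.FlowFree F)
    (h : ∀ c, s.IsFlow F c → ∀ k, G.edge k ∈ F → c k = 0 → ∀ m, G.edge m ∈ F → c m = 0) :
    s.IsCircuit F := by
  refine ⟨hF, fun F' hF' c hc => ?_⟩
  obtain ⟨e, he, he'⟩ := Set.exists_of_ssubset hF'
  funext m
  by_cases hm : G.edge m ∈ F
  · exact h c (hc.mono hF'.subset) (G.rep e) (by rwa [G.edge_rep])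
      (hc.2.1 _ (by rwa [G.edge_rep])) m hm
  · exact hc.2.1 m fun h => hm (hF'.subset h)

/-- A nonzero flow that vanished on an edge of F would live on a proper subset of the circuit. -/
theorem IsCircuit.exists_flow (hF : s.IsCircuit F) :
    ∃ c, s.IsFlow F c ∧ ∀ h, G.edge h ∈ F → c h ≠ 0 := by
  obtain ⟨c, hc, hne⟩ : ∃ c, s.IsFlow F c ∧ c ≠ 0 := by
    by_contra hcon
    push Not at hcon
    exact hF.1 hcon
  refine ⟨c, hc, fun h hh h0 => ?_⟩
  refine hne (hF.2 (F \ {G.edge h}) ?_ c (hc.restrict fun k hk => ⟨?_, fun e => ?_⟩))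
  · exact Set.sdiff_singleton_ssubset.mpr hh
  · exact by_contra fun hkF => hk (hc.2.1 k hkF)
  · exact hk (hc.eq_zero_of_edge_eq (Eq.symm e) h0)

/-- Conservation at an ungrounded leaf would make the nowhere-zero flow vanish on the edge there. -/
theorem IsCircuit.degree_ne_one (hF : s.IsCircuit F) {v : V} (hv : v ∉ s.ground) :
    G.degree F v ≠ 1 := by
  intro hd
  obtain ⟨c, hc, hne⟩ := hF.exists_flow
  obtain ⟨h, hh, rfl⟩ := degree_pos_iff.mp (by omega : 0 < G.degree F v)
  exact hne h hh (hc.eq_zero_of_degree_eq_one hv hd hh)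

theorem IsCircuit.nonempty (hF : s.IsCircuit F) : F.Nonempty := by
  rw [Set.nonempty_iff_ne_empty]
  rintro rfl
  exact hF.1 fun c hc => funext fun h => hc.2.1 h (by simp)

/-- The nowhere-zero flow restricts to a nonzero flow on one component, so by minimality this
component contains all of F. -/
theorem IsCircuit.connected [Fintype V] (hF : s.IsCircuit F) : (G.generatedBy F).Connected := by
  obtain ⟨e, he⟩ := hF.nonempty
  obtain ⟨c, hc, hne⟩ := hF.exists_flow
  have he' : G.edge (G.rep e) ∈ F := by rwa [G.edge_rep]
  have hnf : ¬ s.FlowFree ((G.generatedBy F).component (G.root (G.rep e))).edges := by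
    intro hfree
    have h0 := congrFun (hfree _ (DoubleCover.isFlow_component hc (G.root (G.rep e)))) (G.rep e)
    rw [if_pos (by exact Relation.ReflTransGen.refl)] at h0
    exact hne _ he' h0
  have heq := hF.eq_of_subset (DoubleCover.edges_component_subset _) hnf
  have hr : ∀ v ∈ (G.generatedBy F).verts, (G.generatedBy F).Reach (G.root (G.rep e)) v := by
    rintro v ⟨h, hh, rfl⟩
    rw [← heq, Subgraph.edge_mem_edges_iff] at hh
    exact hh.2
  exact ⟨⟨_, G.rep e, he', rfl⟩, fun u hu v hv =>
    ((G.generatedBy F).reach_symm (hr u hu)).trans (hr v hv)⟩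

/-- In a connected set of edges all of whose degrees are two, a flow that vanishes on one edge is
zero. -/
theorem IsFlow.eq_zero_of_degree_two (hc : s.IsFlow F c) (hconn : (G.generatedBy F).Connected)
    (hd : ∀ v ∈ (G.generatedBy F).verts, v ∉ s.ground ∧ G.degree F v = 2) {k : H}
    (hk : G.edge k ∈ F) (h0 : c k = 0) : ∀ m, G.edge m ∈ F → c m = 0 := by
  have hloc : ∀ x y, G.edge x ∈ F → G.edge y ∈ F → G.root x = G.root y → c x = 0 → c y = 0 := by
    intro x y hx hy hr h0
    by_cases hxy : x = y
    · rwa [← hxy]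
    · have := hd (G.root y) ⟨y, hy, rfl⟩
      exact (hc.eq_zero_iff_of_degree_eq_two hxy hr this.1 this.2 hx hy).mp h0
  have hall : ∀ v, (G.generatedBy F).Reach (G.root k) v →
      ∀ m, G.edge m ∈ F → G.root m = v → c m = 0 := by
    intro v hv
    induction hv with
    | refl => exact fun m hm hr => hloc k m hk hm hr.symm h0
    | tail _ h2 ih =>
      obtain ⟨x, hx, rfl, rfl⟩ := h2
      have hx' : G.edge x ∈ F := hx
      exact fun m hm hr => hloc (G.inv x) m (by rwa [G.edge_inv]) hm hr.symm
        ((hc.eq_zero_iff_inv x).mpr (ih x hx rfl))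
  exact fun m hm => hall _ (hconn.2 _ ⟨k, hk, rfl⟩ _ ⟨m, hm, rfl⟩) m hm rfl

end Signing

end HalfEdgeGraph

/-! ### Circuits over which the cover is trivial -/

namespace DoubleCover

open HalfEdgeGraph

variable {V' H' V H : Type*} [Fintype V'] [Fintype H'] [Fintype V] [Fintype H]
  {G' : HalfEdgeGraph V' H'} {G : HalfEdgeGraph V H} (p : DoubleCover G' G) {F : Set G.Edge}

theorem isCircuit_iff (hG : G.whole.Connected) (hp : p.Nontrivial)
    (hF : F ⊆ p.undilatedEdges) : (p.signedGraphicMatroid hG hp).IsCircuit F ↔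
      p.signing.IsCircuit F := by
  rw [Matroid.isCircuit_iff_forall_ssubset, Matroid.dep_iff, p.indep_iff hG hp hF]
  constructor
  · rintro ⟨⟨h1, -⟩, h2⟩
    exact ⟨h1, fun F' h => (p.indep_iff hG hp (h.subset.trans hF)).mp (h2 h)⟩
  · rintro ⟨h1, h2⟩
    exact ⟨⟨h1, hF⟩, fun F' h => (p.indep_iff hG hp (h.subset.trans hF)).mpr (h2 F' h)⟩

theorem notMem_ground_of_trivialFreeOver {S : G.Subgraph} (hS : p.TrivialFreeOver S) {v : V}
    (hv : v ∈ S.verts) : v ∉ p.signing.ground := fun hd => by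
  obtain ⟨f, h1, -, h3⟩ := p.exists_potential_of_trivialFreeOver hS
  exact h3 v hv (h1 v hd)

/-- A connected subgraph carries a potential if and only if the cover is trivial over it. -/
theorem potential_eq_zero_iff {S : G.Subgraph} (hS : S.Connected) :
    (∀ f, p.signing.IsPotential S.edges f →
      (∀ v, v ∉ S.verts \ p.signing.ground → f v = 0) → f = 0) ↔ ¬ p.TrivialFreeOver S := by
  constructor
  · intro h ht
    obtain ⟨f, h1, h2, h3⟩ := p.exists_potential_of_trivialFreeOver ht
    obtain ⟨v, hv⟩ := hS.1
    -- The nowhere-zero potential of the trivial cover, cut off outside S.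
    have h0 := congrFun (h (fun w => if w ∈ S.verts then f w else 0)
      ⟨fun w hw => by simp [h1 w hw], fun k hk => ?_⟩ fun w hw => ?_) v
    · rw [if_pos hv] at h0
      exact h3 v hv h0
    · rw [Subgraph.edge_mem_edges_iff] at hk
      rw [Signing.defect, if_pos (S.root_mem _ hk), if_pos (S.root_mem _ (S.inv_mem _ hk))]
      exact h2 k hk
    · exact if_neg fun hw' => hw ⟨hw', p.notMem_ground_of_trivialFreeOver ht hw'⟩
  · intro h f hf h0
    funext w
    by_cases hw : w ∈ S.verts
    · exact p.eq_zero_of_not_trivialFreeOver hS h hf hw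
    · exact h0 w fun h => hw h.1

theorem root_mem_generatedBy (h : H) (hh : G.edge h ∈ F) (hd : G.root h ∉ p.signing.ground) :
    G.root h ∈ (G.generatedBy F).verts \ p.signing.ground := ⟨⟨h, hh, rfl⟩, hd⟩

theorem flowFree_iff_not_trivialFreeOver (hS : (G.generatedBy F).Connected)
    (hcard : F.ncard = ((G.generatedBy F).verts \ p.signing.ground).ncard) :
    p.signing.FlowFree F ↔ ¬ p.TrivialFreeOver (G.generatedBy F) := by
  rw [← p.potential_eq_zero_iff hS, edges_generatedBy]
  exact Signing.flowFree_iff_of_ncard_eq disjoint_sdiff_self_left p.root_mem_generatedBy hcard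

/-- A closed arc through undilated vertices is independent if and only if the cover is not trivial
over it. -/
theorem flowFree_chainSet_iff {u : V} {l : List H} (hl : G.IsArc u l u)
    (hu : u ∉ p.signing.ground) (hint : ∀ v ∈ G.chainInterior l, v ∉ p.signing.ground) :
    p.signing.FlowFree (G.chainSet l) ↔ ¬ p.TrivialFreeOver (G.generatedBy (G.chainSet l)) := by
  refine p.flowFree_iff_not_trivialFreeOver (hl.chain.connected hl.ne_nil) ?_
  -- A closed arc has as many edges as vertices, namely one more than its interior vertices, so the
  -- coboundary is square.
  rw [ncard_chainSet hl.edges_nodup, ← length_chainInterior hl.ne_nil, ← List.length_cons (a := u),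
    ← List.toFinset_card_of_nodup (List.nodup_cons.mpr ⟨hl.left_notMem, hl.interior_nodup⟩),
    ← Set.ncard_coe_finset]
  congr 1
  ext v
  simp only [Set.mem_sdiff, hl.chain.mem_verts hl.ne_nil, List.coe_toFinset, List.mem_cons,
    Set.mem_ofPred_eq]
  constructor
  · rintro (rfl | h)
    · exact ⟨Or.inl rfl, hu⟩
    · exact ⟨Or.inr (Or.inr h), hint v h⟩
  · tauto

/-- Genus one means as many edges as vertices. The degrees are at least two and have average two, so
all are two and G[F] is a cycle; a flow vanishing on one of its edges is zero. The coboundary is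
square and not injective, hence a nonzero flow exists. -/
theorem isCircuit_of_trivialFreeOver (hconn : (G.generatedBy F).Connected)
    (hval : ∀ v ∈ (G.generatedBy F).verts, ¬ p.DilatedVert v → (G.generatedBy F).valency v ≠ 1)
    (hg : (G.generatedBy F).genus = 1) (ht : p.TrivialFreeOver (G.generatedBy F)) :
    p.signing.IsCircuit F := by
  have hun : ∀ v ∈ (G.generatedBy F).verts, v ∉ p.signing.ground :=
    fun v hv => p.notMem_ground_of_trivialFreeOver ht hv
  have hU : (G.generatedBy F).verts \ p.signing.ground = (G.generatedBy F).verts :=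
    sdiff_eq_left.mpr (Set.disjoint_left.mpr hun)
  rw [Subgraph.genus, edges_generatedBy] at hg
  have hcard : F.ncard = (G.generatedBy F).verts.ncard := by omega
  have hge : ∀ v ∈ (G.generatedBy F).verts, 2 ≤ G.degree F v := by
    intro v hv
    have h1 : G.degree F v ≠ 1 := hval v hv (hun v hv)
    have h2 := degree_pos_iff_mem.mpr hv
    omega
  have hsum : ∑ v ∈ (G.generatedBy F).verts.toFinset, G.degree F v =
      ∑ v ∈ (G.generatedBy F).verts.toFinset, 2 := by
    rw [Finset.sum_const, ← Set.ncard_eq_toFinset_card', ← hcard, smul_eq_mul, mul_comm,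
      ← sum_degree]
    refine Finset.sum_subset (Finset.subset_univ _) fun v _ hv => ?_
    rw [Set.mem_toFinset, ← degree_pos_iff_mem] at hv
    omega
  have htwo := (Finset.sum_eq_sum_iff_of_le fun v hv => hge v (Set.mem_toFinset.mp hv)).mp hsum.symm
  refine Signing.isCircuit_of_flow ?_ fun c hc k hk h0 => hc.eq_zero_of_degree_two hconn
    (fun v hv => ⟨hun v hv, (htwo v (Set.mem_toFinset.mpr hv)).symm⟩) hk h0
  rw [p.flowFree_iff_not_trivialFreeOver hconn (by rw [hU, hcard])]
  exact not_not.mpr ht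

/-! ### Realizations of diagrams -/

/-- The conditions of `HasType` for a given realization of a diagram. -/
structure Realizes (F : Set G.Edge) (D : CoverDiagram) (φ : Fin D.numVerts → V)
    (c : Fin D.numEdges → List H) : Prop where
  injective : Function.Injective φ
  dilated : ∀ x, p.DilatedVert (φ x) ↔ x ∈ D.dilated
  chain : ∀ i, c i ≠ [] ∧ G.IsChain (φ (D.src i)) (c i) (φ (D.tgt i))
  nodup : ∀ i, (G.chainEdges (c i)).Nodup ∧ (G.chainInterior (c i)).Nodup
  interior : ∀ i, ∀ v ∈ G.chainInterior (c i), ¬ p.DilatedVert v ∧ v ∉ Set.range φ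
  disjoint : ∀ i j, i ≠ j → List.Disjoint (G.chainEdges (c i)) (G.chainEdges (c j)) ∧
      List.Disjoint (G.chainInterior (c i)) (G.chainInterior (c j))
  eq : F = {e | ∃ i, e ∈ G.chainEdges (c i)}
  odd : ∀ i ∈ D.odd, ¬ p.TrivialFreeOver (G.generatedBy {e | e ∈ G.chainEdges (c i)})

theorem hasType_iff (D : CoverDiagram) : p.HasType F D ↔ ∃ φ c, p.Realizes F D φ c :=
  exists_congr fun _ => exists_congr fun _ =>
    ⟨fun ⟨h1, h2, h3, h4, h5, h6, h7, h8⟩ => ⟨h1, h2, h3, h4, h5, h6, h7, h8⟩,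
      fun ⟨h1, h2, h3, h4, h5, h6, h7, h8⟩ => ⟨h1, h2, h3, h4, h5, h6, h7, h8⟩⟩

namespace Realizes

variable {p} {D : CoverDiagram} {φ : Fin D.numVerts → V} {c : Fin D.numEdges → List H}

theorem isArc (R : p.Realizes F D φ c) (i : Fin D.numEdges) :
    G.IsArc (φ (D.src i)) (c i) (φ (D.tgt i)) where
  ne_nil := (R.chain i).1
  chain := (R.chain i).2
  edges_nodup := (R.nodup i).1
  interior_nodup := (R.nodup i).2
  left_notMem h := (R.interior i _ h).2 ⟨_, rfl⟩
  right_notMem h := (R.interior i _ h).2 ⟨_, rfl⟩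

theorem disjoint_chainSet (R : p.Realizes F D φ c) {i j : Fin D.numEdges} (h : i ≠ j) :
    Disjoint (G.chainSet (c i)) (G.chainSet (c j)) :=
  Set.disjoint_left.mpr fun _ h1 h2 => (R.disjoint i j h).1 h1 h2

theorem mem_iff (R : p.Realizes F D φ c) {e : G.Edge} : e ∈ F ↔ ∃ i, e ∈ G.chainSet (c i) := by
  rw [R.eq]
  rfl

theorem chainSet_subset (R : p.Realizes F D φ c) (i : Fin D.numEdges) : G.chainSet (c i) ⊆ F :=
  fun _ he => R.mem_iff.mpr ⟨i, he⟩

theorem eq_biUnion (R : p.Realizes F D φ c) :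
    F = ⋃ i ∈ (Finset.univ : Finset (Fin D.numEdges)), G.chainSet (c i) := by
  ext e
  simp [R.mem_iff]

theorem degree_biUnion (R : p.Realizes F D φ c) (J : Finset (Fin D.numEdges)) (v : V) :
    G.degree (⋃ i ∈ J, G.chainSet (c i)) v = ∑ i ∈ J, G.degree (G.chainSet (c i)) v :=
  HalfEdgeGraph.degree_biUnion J _ (fun _ _ _ _ h => R.disjoint_chainSet h) v

theorem degree_interior (R : p.Realizes F D φ c) {i : Fin D.numEdges} {v : V}
    (hv : v ∈ G.chainInterior (c i)) : v ∉ p.signing.ground ∧ G.degree F v = 2 := by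
  obtain ⟨h1, h2⟩ := R.interior i v hv
  refine ⟨h1, ?_⟩
  rw [R.eq_biUnion, R.degree_biUnion, Finset.sum_eq_single i, (R.isArc i).degree_interior hv]
  · intro j _ hj
    rw [(R.isArc j).degree_of_notMem fun h => (R.disjoint j i hj).2 h hv,
      if_neg fun e => h2 ⟨_, e⟩, if_neg fun e => h2 ⟨_, e⟩, add_zero]
  · simp

theorem degree_branch (R : p.Realizes F D φ c) (J : Finset (Fin D.numEdges))
    (x : Fin D.numVerts) : G.degree (⋃ i ∈ J, G.chainSet (c i)) (φ x) =
      ∑ i ∈ J, ((if D.src i = x then 1 else 0) + if D.tgt i = x then 1 else 0) := by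
  rw [R.degree_biUnion]
  refine Finset.sum_congr rfl fun i _ => ?_
  rw [(R.isArc i).degree_of_notMem fun h => (R.interior i _ h).2 ⟨x, rfl⟩]
  simp only [R.injective.eq_iff]

/-- A diagram with more edges than undilated vertices is dependent. -/
theorem not_flowFree (R : p.Realizes F D φ c) (hD : D.dilatedᶜ.ncard < D.numEdges) :
    ¬ p.signing.FlowFree F := by
  intro hfree
  have hle := hfree.ncard_le (U := (G.generatedBy F).verts \ p.signing.ground)
    disjoint_sdiff_self_left p.root_mem_generatedBy
  -- Subdividing an edge of the diagram adds one edge and one undilated vertex, so the comparison of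
  -- cardinalities can be made on the diagram itself.
  have hsub : (G.generatedBy F).verts \ p.signing.ground ⊆
      ((Finset.univ.biUnion fun i => (G.chainInterior (c i)).toFinset : Finset V) : Set V) ∪
        φ '' D.dilatedᶜ := by
    rintro _ ⟨⟨h, hh, rfl⟩, hd⟩
    obtain ⟨i, hi⟩ := R.mem_iff.mp hh
    have hv : G.root h ∈ (G.generatedBy (G.chainSet (c i))).verts := ⟨h, hi, rfl⟩
    have hbr : ∀ x, G.root h = φ x → G.root h ∈ φ '' D.dilatedᶜ := fun x hx =>
      ⟨x, fun hx' => hd (hx ▸ (R.dilated x).mpr hx'), hx.symm⟩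
    rcases ((R.isArc i).chain.mem_verts (R.isArc i).ne_nil).mp hv with hv | hv | hv
    · exact Or.inr (hbr _ hv)
    · exact Or.inr (hbr _ hv)
    · exact Or.inl (by simpa using ⟨i, hv⟩)
  have hF : F = ((Finset.univ.biUnion fun i => (G.chainEdges (c i)).toFinset :
      Finset G.Edge) : Set G.Edge) := by
    ext e
    simp [R.mem_iff, chainSet]
  have h1 : F.ncard = ∑ i, (G.chainEdges (c i)).length := by
    rw [hF, Set.ncard_coe_finset, Finset.card_biUnion]
    · exact Finset.sum_congr rfl fun i _ => List.toFinset_card_of_nodup (R.nodup i).1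
    · intro i _ j _ hij
      rw [Function.onFun, List.disjoint_toFinset_iff_disjoint]
      exact (R.disjoint i j hij).1
  have h2 := (hle.trans (Set.ncard_le_ncard hsub (Set.toFinite _))).trans (Set.ncard_union_le _ _)
  rw [Set.ncard_coe_finset] at h2
  have h3 : (Finset.univ.biUnion fun i => (G.chainInterior (c i)).toFinset).card ≤
      ∑ i, (G.chainInterior (c i)).length :=
    Finset.card_biUnion_le.trans (Finset.sum_le_sum fun i _ => List.toFinset_card_le _)
  have h4 := Set.ncard_image_le (f := φ) (Set.toFinite D.dilatedᶜ)
  have h5 : ∑ i, (G.chainEdges (c i)).length =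
      ∑ i, (G.chainInterior (c i)).length + D.numEdges := by
    rw [Finset.sum_congr rfl fun i _ => (length_chainInterior (R.isArc i).ne_nil).symm,
      Finset.sum_add_distrib]
    simp
  omega

variable {f : H → ℚ}

theorem eq_zero_on (R : p.Realizes F D φ c) (hf : p.signing.IsFlow F f) {i : Fin D.numEdges}
    {h : H} (hh : G.edge h ∈ G.chainSet (c i)) (h0 : f h = 0) :
    ∀ k, G.edge k ∈ G.chainSet (c i) → f k = 0 :=
  hf.eq_zero_on_chain (R.isArc i).chain (R.isArc i).edges_nodup (R.chainSet_subset i)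
    (fun _ hv => R.degree_interior hv) hh h0

theorem isFlow_biUnion (R : p.Realizes F D φ c) (hf : p.signing.IsFlow F f)
    (J : Finset (Fin D.numEdges))
    (hJ : ∀ j, j ∉ J → ∀ k, G.edge k ∈ G.chainSet (c j) → f k = 0) :
    p.signing.IsFlow (⋃ i ∈ J, G.chainSet (c i)) f := by
  refine hf.restrict fun k hk => ?_
  have hkF : G.edge k ∈ F := by_contra fun h => hk (hf.2.1 k h)
  obtain ⟨i, hi⟩ := R.mem_iff.mp hkF
  refine Set.mem_iUnion₂.mpr ⟨i, ?_, hi⟩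
  exact by_contra fun h => hk (hJ i h k hi)

/-- A flow vanishes on the edge of the diagram that is the only one at an undilated vertex, among
those on which the flow is not known to vanish. -/
theorem eq_zero_of_leaf (R : p.Realizes F D φ c) (hf : p.signing.IsFlow F f)
    (J : Finset (Fin D.numEdges))
    (hJ : ∀ j, j ∉ J → ∀ k, G.edge k ∈ G.chainSet (c j) → f k = 0) {x : Fin D.numVerts}
    (hx : x ∉ D.dilated)
    (hs : ∑ i ∈ J, ((if D.src i = x then 1 else 0) + if D.tgt i = x then 1 else 0) = 1)
    {i : Fin D.numEdges} (hi : i ∈ J) (hix : D.src i = x ∨ D.tgt i = x) :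
    ∀ k, G.edge k ∈ G.chainSet (c i) → f k = 0 := by
  have hd := R.degree_branch J x
  rw [hs] at hd
  have hv : φ x ∈ (G.generatedBy (G.chainSet (c i))).verts := by
    rw [(R.isArc i).chain.mem_verts (R.isArc i).ne_nil]
    rcases hix with rfl | rfl
    · exact Or.inl rfl
    · exact Or.inr (Or.inl rfl)
  obtain ⟨h, hh, hr⟩ := hv
  refine R.eq_zero_on hf hh ((R.isFlow_biUnion hf J hJ).eq_zero_of_degree_eq_one ?_ ?_ ?_)
  · rw [hr]
    exact fun h => hx ((R.dilated x).mp h)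
  · rw [hr, hd]
  · exact Set.mem_iUnion₂.mpr ⟨i, hi, hh⟩

/-- A flow vanishes on an odd loop at an undilated vertex if it vanishes on the other edges at that
vertex. -/
theorem eq_zero_of_odd (R : p.Realizes F D φ c) (hf : p.signing.IsFlow F f)
    {i : Fin D.numEdges} (hi : i ∈ D.odd) (hloop : D.tgt i = D.src i) (hd : D.src i ∉ D.dilated)
    (h : ∀ j, j ≠ i → (∀ k, G.edge k ∈ G.chainSet (c j) → f k = 0) ∨
      D.src j ≠ D.src i ∧ D.tgt j ≠ D.src i) :
    ∀ k, G.edge k ∈ G.chainSet (c i) → f k = 0 := by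
  have harc := R.isArc i
  rw [hloop] at harc
  have hfree := (p.flowFree_chainSet_iff harc (fun h => hd ((R.dilated _).mp h))
    fun v hv => (R.interior i v hv).1).mpr (R.odd i hi)
  -- Discarding the other chains that touch the loop's vertex, on all of which f vanishes, leaves
  -- the loop disjoint from the remaining chains.
  have hfl := R.isFlow_biUnion hf
    (Finset.univ.filter fun j => j = i ∨ D.src j ≠ D.src i ∧ D.tgt j ≠ D.src i) (by
      intro j hj
      simp only [Finset.mem_filter, Finset.mem_univ, true_and, not_or] at hj
      exact (h j hj.1).resolve_right hj.2)
  -- The restriction of f to the loop is then itself a flow, and the odd loop is independent.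
  have hind := hfl.indicator (P := G.chainSet (c i)) (by
      rintro a b ha ⟨hb, hbn⟩ hab
      obtain ⟨j, hj, hbj⟩ := Set.mem_iUnion₂.mp hb
      have hji : j ≠ i := by
        rintro rfl
        exact hbn hbj
      simp only [Finset.mem_filter, Finset.mem_univ, true_and, hji, false_or] at hj
      have hva : G.root a ∈ (G.generatedBy (G.chainSet (c i))).verts := ⟨a, ha, rfl⟩
      have hvb : G.root a ∈ (G.generatedBy (G.chainSet (c j))).verts := ⟨b, hbj, hab.symm⟩
      rw [harc.chain.mem_verts harc.ne_nil] at hva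
      rw [(R.isArc j).chain.mem_verts (R.isArc j).ne_nil] at hvb
      have hφ : ∀ x, G.root a = φ x → G.root a ∉ G.chainInterior (c i) ∧
          G.root a ∉ G.chainInterior (c j) := fun x hx =>
        ⟨fun h => (R.interior i _ h).2 ⟨x, hx.symm⟩, fun h => (R.interior j _ h).2 ⟨x, hx.symm⟩⟩
      have hva' : G.root a = φ (D.src i) ∨ G.root a ∈ G.chainInterior (c i) := by tauto
      rcases hva' with hva | hva
      · rcases hvb with hvb | hvb | hvb
        · exact hj.1 (R.injective (hvb.symm.trans hva))
        · exact hj.2 (R.injective (hvb.symm.trans hva))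
        · exact (hφ _ hva).2 hvb
      · rcases hvb with hvb | hvb | hvb
        · exact (hφ _ hvb).1 hva
        · exact (hφ _ hvb).1 hva
        · exact (R.disjoint j i hji).2 hvb hva)
  intro k hk
  have := congrFun (hfree _ hind) k
  rwa [if_pos hk] at this

/-- Criterion for a realized diagram to be a circuit. -/
theorem isCircuit (R : p.Realizes F D φ c) (hD : D.dilatedᶜ.ncard < D.numEdges)
    (h : ∀ f, p.signing.IsFlow F f → ∀ i, (∀ k, G.edge k ∈ G.chainSet (c i) → f k = 0) →
      ∀ j, ∀ k, G.edge k ∈ G.chainSet (c j) → f k = 0) : p.signing.IsCircuit F := by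
  refine Signing.isCircuit_of_flow (R.not_flowFree hD) fun f hf k hk h0 m hm => ?_
  obtain ⟨i, hi⟩ := R.mem_iff.mp hk
  obtain ⟨j, hj⟩ := R.mem_iff.mp hm
  exact h f hf i (R.eq_zero_on hf hi h0) j m hj

end Realizes

/-- Each of the five diagrams has exactly one edge more than undilated vertices, which gives the
dependence needed in `Realizes.isCircuit`. -/
theorem ncard_compl_dilated_typeII :
    CoverDiagram.typeII.dilatedᶜ.ncard < CoverDiagram.typeII.numEdges := by
  have h : (∅ : Set (Fin 2))ᶜ.ncard < 3 := by simp
  exact h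

theorem ncard_compl_dilated_typeIII :
    CoverDiagram.typeIII.dilatedᶜ.ncard < CoverDiagram.typeIII.numEdges := by
  have h : (∅ : Set (Fin 1))ᶜ.ncard < 2 := by
    rw [Set.compl_empty, Set.ncard_univ, Nat.card_eq_fintype_card]
    decide
  exact h

theorem ncard_compl_dilated_typeIV :
    CoverDiagram.typeIV.dilatedᶜ.ncard < CoverDiagram.typeIV.numEdges := by
  have h0 : ({0} : Set (Fin 2))ᶜ = {1} := by
    ext x
    revert x
    simp [Fin.forall_fin_two]
  have h : ({0} : Set (Fin 2))ᶜ.ncard < 2 := by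
    rw [h0]
    simp
  exact h

theorem ncard_compl_dilated_typeV :
    CoverDiagram.typeV.dilatedᶜ.ncard < CoverDiagram.typeV.numEdges := by
  have h0 : ({0} : Set (Fin 1))ᶜ = ∅ := by
    ext x
    simp [Subsingleton.elim x 0]
  have h : ({0} : Set (Fin 1))ᶜ.ncard < 1 := by
    rw [h0]
    simp
  exact h

theorem ncard_compl_dilated_typeVI :
    CoverDiagram.typeVI.dilatedᶜ.ncard < CoverDiagram.typeVI.numEdges := by
  have h0 : ({0, 1} : Set (Fin 2))ᶜ = ∅ := by
    ext x
    revert x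
    simp [Fin.forall_fin_two]
  have h : ({0, 1} : Set (Fin 2))ᶜ.ncard < 1 := by
    rw [h0]
    simp
  exact h

theorem forall_fin_three {P : Fin 3 → Prop} : (∀ i, P i) ↔ P 0 ∧ P 1 ∧ P 2 := by
  simp [Fin.forall_fin_succ]

theorem isCircuit_of_typeV (h : p.HasType F CoverDiagram.typeV) : p.signing.IsCircuit F := by
  obtain ⟨φ, c, R⟩ := (p.hasType_iff _).mp h
  refine R.isCircuit ncard_compl_dilated_typeV fun f _ i hi j => ?_
  have : j = i := Subsingleton.elim (α := Fin 1) j i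
  rwa [this]

theorem isCircuit_of_typeVI (h : p.HasType F CoverDiagram.typeVI) : p.signing.IsCircuit F := by
  obtain ⟨φ, c, R⟩ := (p.hasType_iff _).mp h
  refine R.isCircuit ncard_compl_dilated_typeVI fun f _ i hi j => ?_
  have : j = i := Subsingleton.elim (α := Fin 1) j i
  rwa [this]

/-- Once a flow vanishes on one loop, the other odd loop is alone at the common vertex and carries
no flow. -/
theorem isCircuit_of_typeIII (h : p.HasType F CoverDiagram.typeIII) : p.signing.IsCircuit F := by
  obtain ⟨φ, c, R⟩ := (p.hasType_iff _).mp h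
  refine R.isCircuit ncard_compl_dilated_typeIII fun f hf => ?_
  have h01 : (∀ k, G.edge k ∈ G.chainSet (c (0 : Fin 2)) → f k = 0) →
      ∀ k, G.edge k ∈ G.chainSet (c (1 : Fin 2)) → f k = 0 := fun h0 =>
    R.eq_zero_of_odd hf (i := (1 : Fin 2)) (show (1 : Fin 2) ∈ ({0, 1} : Set (Fin 2)) by simp) rfl
      (show (0 : Fin 1) ∉ (∅ : Set (Fin 1)) by simp)
      (Fin.forall_fin_two.mpr ⟨fun _ => Or.inl h0, fun h => absurd rfl h⟩)
  have h10 : (∀ k, G.edge k ∈ G.chainSet (c (1 : Fin 2)) → f k = 0) →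
      ∀ k, G.edge k ∈ G.chainSet (c (0 : Fin 2)) → f k = 0 := fun h0 =>
    R.eq_zero_of_odd hf (i := (0 : Fin 2)) (show (0 : Fin 2) ∈ ({0, 1} : Set (Fin 2)) by simp) rfl
      (show (0 : Fin 1) ∉ (∅ : Set (Fin 1)) by simp)
      (Fin.forall_fin_two.mpr ⟨fun h => absurd rfl h, fun _ => Or.inl h0⟩)
  exact Fin.forall_fin_two.mpr ⟨fun h => Fin.forall_fin_two.mpr ⟨h, h01 h⟩,
    fun h => Fin.forall_fin_two.mpr ⟨h10 h, h⟩⟩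

/-- If a flow vanishes on the loop, the joining edge becomes a leaf at its undilated end; if it
vanishes on the joining edge, the odd loop is isolated. -/
theorem isCircuit_of_typeIV (h : p.HasType F CoverDiagram.typeIV) : p.signing.IsCircuit F := by
  obtain ⟨φ, c, R⟩ := (p.hasType_iff _).mp h
  refine R.isCircuit ncard_compl_dilated_typeIV fun f hf => ?_
  have h01 : (∀ k, G.edge k ∈ G.chainSet (c (0 : Fin 2)) → f k = 0) →
      ∀ k, G.edge k ∈ G.chainSet (c (1 : Fin 2)) → f k = 0 := fun h0 =>
    R.eq_zero_of_odd hf (i := (1 : Fin 2)) (show (1 : Fin 2) ∈ ({1} : Set (Fin 2)) by simp) rfl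
      (show (1 : Fin 2) ∉ ({0} : Set (Fin 2)) by simp)
      (Fin.forall_fin_two.mpr ⟨fun _ => Or.inl h0, fun h => absurd rfl h⟩)
  have h10 : (∀ k, G.edge k ∈ G.chainSet (c (1 : Fin 2)) → f k = 0) →
      ∀ k, G.edge k ∈ G.chainSet (c (0 : Fin 2)) → f k = 0 := fun h0 =>
    R.eq_zero_of_leaf hf ({0} : Finset (Fin 2))
      (Fin.forall_fin_two.mpr
        ⟨fun h => absurd (show (0 : Fin 2) ∈ ({0} : Finset (Fin 2)) by decide) h, fun _ => h0⟩)
      (x := (1 : Fin 2)) (show (1 : Fin 2) ∉ ({0} : Set (Fin 2)) by simp) rfl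
      (show (0 : Fin 2) ∈ ({0} : Finset (Fin 2)) by decide) (Or.inr rfl)
  exact Fin.forall_fin_two.mpr ⟨fun h => Fin.forall_fin_two.mpr ⟨h, h01 h⟩,
    fun h => Fin.forall_fin_two.mpr ⟨h10 h, h⟩⟩

/-- Everything passes through the joining edge, which has index 1: vanishing on a loop makes it a
leaf at that loop's vertex, and vanishing on it isolates both odd loops. -/
theorem isCircuit_of_typeII (h : p.HasType F CoverDiagram.typeII) : p.signing.IsCircuit F := by
  obtain ⟨φ, c, R⟩ := (p.hasType_iff _).mp h
  refine R.isCircuit ncard_compl_dilated_typeII fun f hf => ?_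
  have hodd0 : (∀ k, G.edge k ∈ G.chainSet (c (1 : Fin 3)) → f k = 0) →
      ∀ k, G.edge k ∈ G.chainSet (c (0 : Fin 3)) → f k = 0 := fun h0 =>
    R.eq_zero_of_odd hf (i := (0 : Fin 3)) (show (0 : Fin 3) ∈ ({0, 2} : Set (Fin 3)) by simp) rfl
      (show (0 : Fin 2) ∉ (∅ : Set (Fin 2)) by simp)
      (forall_fin_three.mpr ⟨fun h => absurd rfl h, fun _ => Or.inl h0, fun _ => Or.inr
        (show (1 : Fin 2) ≠ 0 ∧ (1 : Fin 2) ≠ 0 by decide)⟩)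
  have hodd2 : (∀ k, G.edge k ∈ G.chainSet (c (1 : Fin 3)) → f k = 0) →
      ∀ k, G.edge k ∈ G.chainSet (c (2 : Fin 3)) → f k = 0 := fun h0 =>
    R.eq_zero_of_odd hf (i := (2 : Fin 3)) (show (2 : Fin 3) ∈ ({0, 2} : Set (Fin 3)) by simp) rfl
      (show (1 : Fin 2) ∉ (∅ : Set (Fin 2)) by simp)
      (forall_fin_three.mpr ⟨fun _ => Or.inr (show (0 : Fin 2) ≠ 1 ∧ (0 : Fin 2) ≠ 1 by decide),
        fun _ => Or.inl h0, fun h => absurd rfl h⟩)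
  have h01 : (∀ k, G.edge k ∈ G.chainSet (c (0 : Fin 3)) → f k = 0) →
      ∀ k, G.edge k ∈ G.chainSet (c (1 : Fin 3)) → f k = 0 := fun h0 =>
    R.eq_zero_of_leaf hf ({1, 2} : Finset (Fin 3))
      (forall_fin_three.mpr ⟨fun _ => h0,
        fun h => absurd (show (1 : Fin 3) ∈ ({1, 2} : Finset (Fin 3)) by decide) h,
        fun h => absurd (show (2 : Fin 3) ∈ ({1, 2} : Finset (Fin 3)) by decide) h⟩)
      (x := (0 : Fin 2)) (show (0 : Fin 2) ∉ (∅ : Set (Fin 2)) by simp) rfl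
      (show (1 : Fin 3) ∈ ({1, 2} : Finset (Fin 3)) by decide) (Or.inl rfl)
  have h21 : (∀ k, G.edge k ∈ G.chainSet (c (2 : Fin 3)) → f k = 0) →
      ∀ k, G.edge k ∈ G.chainSet (c (1 : Fin 3)) → f k = 0 := fun h0 =>
    R.eq_zero_of_leaf hf ({0, 1} : Finset (Fin 3))
      (forall_fin_three.mpr
        ⟨fun h => absurd (show (0 : Fin 3) ∈ ({0, 1} : Finset (Fin 3)) by decide) h,
          fun h => absurd (show (1 : Fin 3) ∈ ({0, 1} : Finset (Fin 3)) by decide) h, fun _ => h0⟩)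
      (x := (1 : Fin 2)) (show (1 : Fin 2) ∉ (∅ : Set (Fin 2)) by simp) rfl
      (show (1 : Fin 3) ∈ ({0, 1} : Finset (Fin 3)) by decide) (Or.inr rfl)
  have hall : (∀ k, G.edge k ∈ G.chainSet (c (1 : Fin 3)) → f k = 0) →
      ∀ j, ∀ k, G.edge k ∈ G.chainSet (c j) → f k = 0 := fun h =>
    forall_fin_three.mpr ⟨hodd0 h, h, hodd2 h⟩
  exact forall_fin_three.mpr ⟨fun h => hall (h01 h), hall, fun h => hall (h21 h)⟩

end DoubleCover

/-! ### Classification of the circuits over which the cover is not trivial -/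

namespace HalfEdgeGraph

variable {V H : Type*} {G : HalfEdgeGraph V H}

/-- Removing an arc between two vertices of `X` preserves the absence of branchings outside `X`. -/
theorem exists_isArc_sdiff [Finite H] {F : Set G.Edge} {X : Set V}
    (hX : ∀ v, v ∉ X → G.degree F v = 0 ∨ G.degree F v = 2) {u : V} (hu : u ∈ X)
    (hd : 0 < G.degree F u) : ∃ l, ∃ w ∈ X, G.IsArc u l w ∧ G.chainSet l ⊆ F ∧
      (∀ v ∈ G.chainInterior l, v ∉ X) ∧
      (∀ x ∈ X, G.degree (F \ G.chainSet l) x +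
        ((if u = x then 1 else 0) + if w = x then 1 else 0) = G.degree F x) ∧
      ∀ v, v ∉ X → G.degree (F \ G.chainSet l) v = 0 ∨ G.degree (F \ G.chainSet l) v = 2 := by
  obtain ⟨l, w, hw, hl, hF, hint⟩ := exists_isArc hX hu hd
  refine ⟨l, w, hw, hl, hF, hint, fun x hx => ?_, fun v hv => ?_⟩
  · rw [← degree_sdiff_add hF x, hl.degree_of_notMem fun h => hint x h hx]
  · have h1 := degree_sdiff_add hF v
    have h2 := hX v hv
    by_cases hvl : v ∈ G.chainInterior l
    · rw [hl.degree_interior hvl] at h1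
      omega
    · rw [hl.degree_of_notMem hvl, if_neg (show ¬ u = v from fun e => hv (e ▸ hu)),
        if_neg (show ¬ w = v from fun e => hv (e ▸ hw))] at h1
      omega

end HalfEdgeGraph

theorem Finset.sum_eq_two_cases {ι : Type*} [Fintype ι] {g : ι → ℕ} (h : ∑ i, g i = 2) :
    (∃ i, g i = 2 ∧ ∀ k, k ≠ i → g k = 0) ∨
      ∃ i j, i ≠ j ∧ g i = 1 ∧ g j = 1 ∧ ∀ k, k ≠ i → k ≠ j → g k = 0 := by
  obtain ⟨i, -, hi⟩ := Finset.exists_ne_zero_of_sum_ne_zero (by omega : ∑ i, g i ≠ 0)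
  have h1 := Finset.add_sum_erase Finset.univ g (Finset.mem_univ i)
  by_cases hi2 : g i = 2
  · refine Or.inl ⟨i, hi2, fun k hk => ?_⟩
    have h0 : ∑ k ∈ Finset.univ.erase i, g k = 0 := by omega
    exact (Finset.sum_eq_zero_iff.mp h0) k (by simp [hk])
  · have hs : ∑ k ∈ Finset.univ.erase i, g k = 1 := by omega
    obtain ⟨j, hj, hj0⟩ := Finset.exists_ne_zero_of_sum_ne_zero (by omega :
      ∑ k ∈ Finset.univ.erase i, g k ≠ 0)
    have h2 := Finset.add_sum_erase _ g hj
    have h0 : ∑ k ∈ (Finset.univ.erase i).erase j, g k = 0 := by omega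
    refine Or.inr ⟨i, j, (Finset.ne_of_mem_erase hj).symm, by omega, by omega, fun k hk hk' => ?_⟩
    exact (Finset.sum_eq_zero_iff.mp h0) k (by simp [hk, hk'])

namespace DoubleCover

open HalfEdgeGraph

variable {V' H' V H : Type*} [Fintype V'] [Fintype H'] [Fintype V] [Fintype H]
  {G' : HalfEdgeGraph V' H'} {G : HalfEdgeGraph V H} (p : DoubleCover G' G) {F : Set G.Edge}

/-- A circuit over which the cover is trivial has genus one. -/
theorem genus_of_isCircuit (hC : p.signing.IsCircuit F)
    (ht : p.TrivialFreeOver (G.generatedBy F)) : (G.generatedBy F).genus = 1 := by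
  have hun : ∀ v ∈ (G.generatedBy F).verts, v ∉ p.signing.ground :=
    fun v hv => p.notMem_ground_of_trivialFreeOver ht hv
  have hU : (G.generatedBy F).verts \ p.signing.ground = (G.generatedBy F).verts :=
    sdiff_eq_left.mpr (Set.disjoint_left.mpr hun)
  have hge : 2 * (G.generatedBy F).verts.ncard ≤ 2 * F.ncard := by
    rw [← sum_degree, Set.ncard_eq_toFinset_card', mul_comm, ← smul_eq_mul, ← Finset.sum_const]
    refine (Finset.sum_le_sum fun v hv => ?_).trans
      (Finset.sum_le_sum_of_subset (Finset.subset_univ _))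
    rw [Set.mem_toFinset] at hv
    have h1 := hC.degree_ne_one (hun v hv)
    have h2 := degree_pos_iff_mem.mpr hv
    omega
  obtain ⟨e, he⟩ := hC.nonempty
  have hfree := hC.2 (F \ {e}) (Set.sdiff_singleton_ssubset.mpr he)
  have hUF : ∀ h, G.edge h ∈ F \ {e} → G.root h ∉ p.signing.ground →
      G.root h ∈ (G.generatedBy F).verts \ p.signing.ground :=
    fun h hh hd => p.root_mem_generatedBy h hh.1 hd
  have hle := hfree.ncard_le (U := (G.generatedBy F).verts \ p.signing.ground)
    disjoint_sdiff_self_left hUF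
  have hcard := Set.ncard_sdiff_singleton_add_one he
  -- Equality would make the coboundary on F \ {e} square and surjective, hence injective, whereas
  -- the trivial cover has a nonzero potential. So there are no more edges than vertices; the
  -- degrees give the reverse inequality.
  have hne : (F \ {e}).ncard ≠ ((G.generatedBy F).verts \ p.signing.ground).ncard := by
    intro heq
    refine (p.potential_eq_zero_iff hC.connected).mp ?_ ht
    rw [edges_generatedBy]
    have := (Signing.flowFree_iff_of_ncard_eq disjoint_sdiff_self_left hUF heq).mp hfree
    exact fun f hf => this f ⟨hf.1, fun h hh => hf.2 h hh.1⟩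
  rw [hU] at hle hne
  rw [Subgraph.genus, edges_generatedBy]
  omega

/-- A circuit over which the cover is not trivial has one more edge than undilated vertices. -/
theorem ncard_of_isCircuit (hC : p.signing.IsCircuit F)
    (hn : ¬ p.TrivialFreeOver (G.generatedBy F)) :
    F.ncard = ((G.generatedBy F).verts \ p.signing.ground).ncard + 1 := by
  obtain ⟨e, he⟩ := hC.nonempty
  have hfree := hC.2 (F \ {e}) (Set.sdiff_singleton_ssubset.mpr he)
  have hle := hfree.ncard_le (U := (G.generatedBy F).verts \ p.signing.ground)
    disjoint_sdiff_self_left fun h hh hd => p.root_mem_generatedBy h hh.1 hd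
  have hcard := Set.ncard_sdiff_singleton_add_one he
  have hpot := (p.potential_eq_zero_iff hC.connected).mpr hn
  rw [edges_generatedBy] at hpot
  have hge := Signing.ncard_le_of_potential_eq_zero disjoint_sdiff_self_left hpot
  -- Removing one edge gives |F| - 1 ≤ |U|, and nontriviality gives |U| ≤ |F|. Equality would make F
  -- flow-free, so |F| = |U| + 1.
  have hne : F.ncard ≠ ((G.generatedBy F).verts \ p.signing.ground).ncard := fun heq =>
    hC.1 ((p.flowFree_iff_not_trivialFreeOver hC.connected heq).mpr hn)
  omega

/-- The branching of `F` at `v` exceeds that of a vertex inside a chain by `n`. -/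
def Excess (F : Set G.Edge) (v : V) (n : ℕ) : Prop :=
  (v ∈ p.signing.ground ∧ G.degree F v = n) ∨ (v ∉ p.signing.ground ∧ G.degree F v = n + 2)

/-- The set `F` does not branch at `v`. -/
def Unbranched (F : Set G.Edge) (v : V) : Prop :=
  G.degree F v = 0 ∨ G.degree F v = 2 ∧ v ∉ p.signing.ground

/-- The degrees sum to 2|U| + 2, where U is the set of undilated vertices of G[F]. Each vertex of U
has degree at least two, so subtracting 2 at each of them leaves nonnegative excesses with sum 2. -/
theorem excess_of_isCircuit (hC : p.signing.IsCircuit F)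
    (hn : ¬ p.TrivialFreeOver (G.generatedBy F)) :
    (∃ v, p.Excess F v 2 ∧ ∀ w, w ≠ v → p.Unbranched F w) ∨
      ∃ u v, u ≠ v ∧ p.Excess F u 1 ∧ p.Excess F v 1 ∧
        ∀ w, w ≠ u → w ≠ v → p.Unbranched F w := by
  set U := (G.generatedBy F).verts \ p.signing.ground with hU
  have hdeg : ∀ v ∈ U, 2 ≤ G.degree F v := by
    intro v hv
    have h1 := hC.degree_ne_one hv.2
    have h2 := degree_pos_iff_mem.mpr hv.1
    omega
  have hsplit : ∀ v, G.degree F v = (G.degree F v - if v ∈ U then 2 else 0) +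
      if v ∈ U then 2 else 0 := by
    intro v
    by_cases hv : v ∈ U
    · have := hdeg v hv
      rw [if_pos hv]
      omega
    · rw [if_neg hv]
      omega
  have hsum : ∑ v, (G.degree F v - if v ∈ U then 2 else 0) = 2 := by
    have h1 := sum_degree (G := G) F
    rw [Finset.sum_congr rfl fun v _ => hsplit v, Finset.sum_add_distrib,
      p.ncard_of_isCircuit hC hn, ← hU] at h1
    have h2 : ∑ v, (if v ∈ U then 2 else 0) = 2 * U.ncard := by
      rw [← Finset.sum_filter, Finset.sum_const, smul_eq_mul, mul_comm,
        Set.ncard_eq_toFinset_card']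
      congr 2
      ext v
      simp
    omega
  have hpos : ∀ v n, 0 < n → (G.degree F v - if v ∈ U then 2 else 0) = n → p.Excess F v n := by
    intro v n hn hv
    by_cases hg : v ∈ p.signing.ground
    · rw [if_neg fun h => h.2 hg] at hv
      exact Or.inl ⟨hg, hv⟩
    · have hvU : v ∈ U := ⟨degree_pos_iff_mem.mp (by omega), hg⟩
      have := hdeg v hvU
      rw [if_pos hvU] at hv
      exact Or.inr ⟨hg, by omega⟩
  have hzero : ∀ v, (G.degree F v - if v ∈ U then 2 else 0) = 0 → p.Unbranched F v := by
    intro v hv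
    by_cases hvU : v ∈ U
    · have := hdeg v hvU
      rw [if_pos hvU] at hv
      exact Or.inr ⟨by omega, hvU.2⟩
    · rw [if_neg hvU] at hv
      exact Or.inl hv
  rcases Finset.sum_eq_two_cases hsum with ⟨v, h1, h2⟩ | ⟨u, v, huv, h1, h2, h3⟩
  · exact Or.inl ⟨v, hpos v 2 (by omega) h1, fun w hw => hzero w (h2 w hw)⟩
  · exact Or.inr ⟨u, v, huv, hpos u 1 (by omega) h1, hpos v 1 (by omega) h2,
      fun w hw hw' => hzero w (h3 w hw hw')⟩

/-- A circuit that contains a system of arcs with the shape of a dependent diagram has the type of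
this diagram. -/
theorem hasType_of_arcs (hC : p.signing.IsCircuit F) (D : CoverDiagram)
    (φ : Fin D.numVerts → V) (c : Fin D.numEdges → List H) (hφ : Function.Injective φ)
    (hdil : ∀ x, φ x ∈ p.signing.ground ↔ x ∈ D.dilated)
    (harc : ∀ i, G.IsArc (φ (D.src i)) (c i) (φ (D.tgt i))) (hsub : ∀ i, G.chainSet (c i) ⊆ F)
    (hint : ∀ i, ∀ v ∈ G.chainInterior (c i), v ∉ Set.range φ)
    (hdisj : ∀ i j, i ≠ j → Disjoint (G.chainSet (c i)) (G.chainSet (c j)))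
    (hunb : ∀ v, v ∉ Set.range φ → p.Unbranched F v)
    (hD : D.dilatedᶜ.ncard < D.numEdges)
    (hodd : ∀ i ∈ D.odd, D.tgt i = D.src i ∧ D.src i ∉ D.dilated ∧ ∃ j, j ≠ i) :
    p.HasType F D := by
  have hint' : ∀ i, ∀ v ∈ G.chainInterior (c i), G.degree F v = 2 ∧ v ∉ p.signing.ground := by
    intro i v hv
    have h1 := degree_mono (hsub i) v
    rw [(harc i).degree_interior hv] at h1
    exact (hunb v (hint i v hv)).resolve_left (by omega)
  have R : p.Realizes {e | ∃ i, e ∈ G.chainEdges (c i)} D φ c := by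
    refine ⟨hφ, hdil, fun i => ⟨(harc i).ne_nil, (harc i).chain⟩,
      fun i => ⟨(harc i).edges_nodup, (harc i).interior_nodup⟩,
      fun i v hv => ⟨(hint' i v hv).2, hint i v hv⟩,
      fun i j hij => ⟨fun e h1 h2 => Set.disjoint_left.mp (hdisj i j hij) h1 h2,
        fun v h1 h2 => ?_⟩, rfl, fun i hi => ?_⟩
    -- A common interior vertex of two arcs would have degree at least four in F.
    · have h3 := degree_mono (Set.union_subset (hsub i) (hsub j)) v
      rw [degree_union (hdisj i j hij), (harc i).degree_interior h1, (harc j).degree_interior h2,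
        (hint' i v h1).1] at h3
      omega
    -- An odd loop misses the edges of another arc, so it is a proper part of the circuit and
    -- independent; for a closed arc this means that the cover over it is not trivial.
    · obtain ⟨h1, h2, j, hj⟩ := hodd i hi
      have ha := harc i
      rw [h1] at ha
      refine (p.flowFree_chainSet_iff ha (fun h => h2 ((hdil _).mp h))
        fun v hv => (hint' i v hv).2).mp (hC.2 _ ((hsub i).ssubset_of_ne fun e => ?_))
      obtain ⟨x, hx⟩ := chainSet_nonempty (G := G) (harc j).ne_nil
      exact Set.disjoint_left.mp (hdisj j i hj) hx (e ▸ hsub j hx)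
  -- The arcs already form a dependent set, so by minimality they exhaust F.
  have hF := hC.eq_of_subset (by rintro e ⟨i, hi⟩; exact hsub i hi) (R.not_flowFree hD)
  rw [hF] at R
  exact (p.hasType_iff D).mpr ⟨φ, c, R⟩

theorem Unbranched.degree {v : V} (h : p.Unbranched F v) : G.degree F v = 0 ∨ G.degree F v = 2 :=
  h.imp_right And.left

/-- The arc that leaves the only branch vertex must return to it. -/
theorem typeV_of_excess (hC : p.signing.IsCircuit F) {v : V} (hv : v ∈ p.signing.ground)
    (hd : G.degree F v = 2) (hunb : ∀ w, w ≠ v → p.Unbranched F w) :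
    p.HasType F CoverDiagram.typeV := by
  obtain ⟨l, w, rfl, hl, hF, hint, -⟩ := exists_isArc_sdiff (X := {v})
    (fun w hw => (hunb w hw).degree) rfl (by omega)
  have hr : Set.range (fun _ : Fin 1 => w) = {w} := Set.range_const
  exact p.hasType_of_arcs hC CoverDiagram.typeV (fun _ : Fin 1 => w) (fun _ : Fin 1 => l)
    (fun a b _ => Subsingleton.elim (α := Fin 1) a b)
    (fun x => ⟨fun _ => Subsingleton.elim (α := Fin 1) x 0, fun _ => hv⟩)
    (fun _ => hl) (fun _ => hF) (fun _ x hx => hr ▸ hint x hx)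
    (fun i j hij => absurd (Subsingleton.elim (α := Fin 1) i j) hij)
    (fun x hx => hunb x fun e => hx (e ▸ ⟨(0 : Fin 1), rfl⟩)) ncard_compl_dilated_typeV
    fun i hi => hi.elim

/-- The first closed arc uses two of the four half-edges at v, and a second one can start from the
remaining two. -/
theorem typeIII_of_excess (hC : p.signing.IsCircuit F) {v : V} (hv : v ∉ p.signing.ground)
    (hd : G.degree F v = 4) (hunb : ∀ w, w ≠ v → p.Unbranched F w) :
    p.HasType F CoverDiagram.typeIII := by
  obtain ⟨l₀, w, hw, hl₀, hF₀, hint₀, hd₀, hX₁⟩ := exists_isArc_sdiff (X := {v})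
    (fun w hw => (hunb w hw).degree) rfl (by omega)
  rw [Set.mem_singleton_iff] at hw
  subst hw
  have hd₁ := hd₀ w rfl
  rw [if_pos rfl] at hd₁
  obtain ⟨l₁, w', hw', hl₁, hF₁, hint₁, -⟩ := exists_isArc_sdiff (X := {w})
    hX₁ rfl (by omega)
  rw [Set.mem_singleton_iff] at hw'
  subst hw'
  have hr : Set.range (fun _ : Fin 1 => w') = {w'} := Set.range_const
  have h01 : Disjoint (G.chainSet l₀) (G.chainSet l₁) :=
    Set.disjoint_left.mpr fun e h h' => (hF₁ h').2 h
  exact p.hasType_of_arcs hC CoverDiagram.typeIII (fun _ : Fin 1 => w') (![l₀, l₁] : Fin 2 → _)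
    (fun a b _ => Subsingleton.elim (α := Fin 1) a b)
    (fun x => ⟨fun h => absurd h hv, fun h => h.elim⟩)
    (Fin.forall_fin_two.mpr ⟨hl₀, hl₁⟩)
    (Fin.forall_fin_two.mpr ⟨hF₀, hF₁.trans Set.sdiff_subset⟩)
    (Fin.forall_fin_two.mpr ⟨fun x hx => hr ▸ hint₀ x hx, fun x hx => hr ▸ hint₁ x hx⟩)
    (Fin.forall_fin_two.mpr ⟨Fin.forall_fin_two.mpr ⟨fun h => absurd rfl h, fun _ => h01⟩,
      Fin.forall_fin_two.mpr ⟨fun _ => h01.symm, fun h => absurd rfl h⟩⟩)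
    (fun x hx => hunb x fun e => hx (e ▸ ⟨(0 : Fin 1), rfl⟩)) ncard_compl_dilated_typeIII
    (Fin.forall_fin_two.mpr ⟨fun _ => ⟨rfl, id, (1 : Fin 2), (by decide : (1 : Fin 2) ≠ 0)⟩,
      fun _ => ⟨rfl, id, (0 : Fin 2), (by decide : (0 : Fin 2) ≠ 1)⟩⟩)

section TwoBranchings

variable {p} {u v : V}

theorem range_pair : Set.range (![u, v] : Fin 2 → V) = {u, v} := by
  rw [Matrix.range_cons, Matrix.range_cons, Matrix.range_empty, Set.union_empty]
  rfl

theorem injective_pair (huv : u ≠ v) : Function.Injective (![u, v] : Fin 2 → V) := by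
  intro a b
  revert a b
  simp [Fin.forall_fin_two, huv, huv.symm]

theorem unbranched_range (hunb : ∀ w, w ≠ u → w ≠ v → p.Unbranched F w) (x : V)
    (hx : x ∉ Set.range (![u, v] : Fin 2 → V)) : p.Unbranched F x := by
  rw [range_pair] at hx
  simp only [Set.mem_insert_iff, Set.mem_singleton_iff, not_or] at hx
  exact hunb x hx.1 hx.2

theorem degree_of_unbranched (hunb : ∀ w, w ≠ u → w ≠ v → p.Unbranched F w) (x : V)
    (hx : x ∉ ({u, v} : Set V)) : G.degree F x = 0 ∨ G.degree F x = 2 :=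
  Unbranched.degree p (unbranched_range hunb x (by rwa [range_pair]))

theorem typeVI_of_excess (hC : p.signing.IsCircuit F) (huv : u ≠ v) (hu : u ∈ p.signing.ground)
    (hv : v ∈ p.signing.ground) (hdu : G.degree F u = 1)
    (hunb : ∀ w, w ≠ u → w ≠ v → p.Unbranched F w) : p.HasType F CoverDiagram.typeVI := by
  obtain ⟨l, w, hw, hl, hF, hint, hd, -⟩ := exists_isArc_sdiff (X := {u, v})
    (degree_of_unbranched hunb) (Or.inl rfl) (by omega)
  have h1 := hd u (Or.inl rfl)
  rw [if_pos rfl, hdu] at h1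
  -- An arc returning to u would need two half-edges there.
  have hwv : w = v := by
    rcases hw with rfl | hw
    · rw [if_pos rfl] at h1
      omega
    · exact hw
  subst hwv
  exact p.hasType_of_arcs hC CoverDiagram.typeVI (![u, w] : Fin 2 → V) (fun _ : Fin 1 => l)
    (injective_pair huv)
    (Fin.forall_fin_two.mpr ⟨⟨fun _ => Or.inl rfl, fun _ => hu⟩,
      ⟨fun _ => Or.inr rfl, fun _ => hv⟩⟩)
    (Fin.forall_fin_one.mpr hl) (fun _ => hF)
    (fun _ x hx => range_pair (u := u) (v := w) ▸ hint x hx)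
    (fun i j hij => absurd (Subsingleton.elim (α := Fin 1) i j) hij)
    (unbranched_range hunb) ncard_compl_dilated_typeVI fun i hi => hi.elim

theorem typeIV_of_excess (hC : p.signing.IsCircuit F) (huv : u ≠ v) (hu : u ∈ p.signing.ground)
    (hv : v ∉ p.signing.ground) (hdu : G.degree F u = 1) (hdv : G.degree F v = 3)
    (hunb : ∀ w, w ≠ u → w ≠ v → p.Unbranched F w) : p.HasType F CoverDiagram.typeIV := by
  obtain ⟨l₀, w, hw, hl₀, hF₀, hint₀, hd₀, hX₁⟩ := exists_isArc_sdiff (X := {u, v})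
    (degree_of_unbranched hunb) (Or.inl rfl) (by omega)
  have h1 := hd₀ u (Or.inl rfl)
  have h2 := hd₀ v (Or.inr rfl)
  have hwv : w = v := by
    rcases hw with rfl | hw
    · rw [if_pos rfl, hdu] at h1
      omega
    · exact hw
  subst hwv
  rw [if_pos rfl, if_neg huv.symm, hdu] at h1
  rw [if_pos rfl, if_neg huv, hdv] at h2
  obtain ⟨l₁, x, hx, hl₁, hF₁, hint₁, hd₁, -⟩ := exists_isArc_sdiff (X := {u, w}) hX₁
    (Or.inr rfl) (by omega)
  have h3 := hd₁ u (Or.inl rfl)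
  -- The first arc has used the only half-edge at u, so the second one returns to its start.
  have hxw : x = w := by
    rcases hx with rfl | hx
    · rw [if_pos rfl] at h3
      omega
    · exact hx
  subst hxw
  have h01 : Disjoint (G.chainSet l₀) (G.chainSet l₁) :=
    Set.disjoint_left.mpr fun e h h' => (hF₁ h').2 h
  exact p.hasType_of_arcs hC CoverDiagram.typeIV (![u, x] : Fin 2 → V) (![l₀, l₁] : Fin 2 → _)
    (injective_pair huv)
    (Fin.forall_fin_two.mpr ⟨⟨fun _ => rfl, fun _ => hu⟩,
      ⟨fun h => absurd h hv, fun h => absurd h (by decide : ¬ (1 : Fin 2) = 0)⟩⟩)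
    (Fin.forall_fin_two.mpr ⟨hl₀, hl₁⟩)
    (Fin.forall_fin_two.mpr ⟨hF₀, hF₁.trans Set.sdiff_subset⟩)
    (Fin.forall_fin_two.mpr ⟨fun y hy => range_pair (u := u) (v := x) ▸ hint₀ y hy,
      fun y hy => range_pair (u := u) (v := x) ▸ hint₁ y hy⟩)
    (Fin.forall_fin_two.mpr ⟨Fin.forall_fin_two.mpr ⟨fun h => absurd rfl h, fun _ => h01⟩,
      Fin.forall_fin_two.mpr ⟨fun _ => h01.symm, fun h => absurd rfl h⟩⟩)
    (unbranched_range hunb) ncard_compl_dilated_typeIV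
    (Fin.forall_fin_two.mpr ⟨fun h => absurd h (by decide : ¬ (0 : Fin 2) = 1),
      fun _ => ⟨rfl, (by decide : ¬ (1 : Fin 2) = 0), (0 : Fin 2), (by decide : (0 : Fin 2) ≠ 1)⟩⟩)

/-- The arcs enter by their roles, because the loop at u and the joining arc may be found in either
order. -/
theorem typeII_of_arcs (hC : p.signing.IsCircuit F) (huv : u ≠ v) (hu : u ∉ p.signing.ground)
    (hv : v ∉ p.signing.ground) (hunb : ∀ w, w ≠ u → w ≠ v → p.Unbranched F w)
    {l₀ l₁ l₂ : List H} (hl₀ : G.IsArc u l₀ u) (hl₁ : G.IsArc u l₁ v) (hl₂ : G.IsArc v l₂ v)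
    (hF₀ : G.chainSet l₀ ⊆ F) (hF₁ : G.chainSet l₁ ⊆ F) (hF₂ : G.chainSet l₂ ⊆ F)
    (hint₀ : ∀ x ∈ G.chainInterior l₀, x ∉ ({u, v} : Set V))
    (hint₁ : ∀ x ∈ G.chainInterior l₁, x ∉ ({u, v} : Set V))
    (hint₂ : ∀ x ∈ G.chainInterior l₂, x ∉ ({u, v} : Set V))
    (h01 : Disjoint (G.chainSet l₀) (G.chainSet l₁))
    (h02 : Disjoint (G.chainSet l₀) (G.chainSet l₂))
    (h12 : Disjoint (G.chainSet l₁) (G.chainSet l₂)) : p.HasType F CoverDiagram.typeII :=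
  p.hasType_of_arcs hC CoverDiagram.typeII (![u, v] : Fin 2 → V) (![l₀, l₁, l₂] : Fin 3 → _)
    (injective_pair huv)
    (Fin.forall_fin_two.mpr ⟨⟨fun h => absurd h hu, fun h => h.elim⟩,
      ⟨fun h => absurd h hv, fun h => h.elim⟩⟩)
    (forall_fin_three.mpr ⟨hl₀, hl₁, hl₂⟩) (forall_fin_three.mpr ⟨hF₀, hF₁, hF₂⟩)
    (forall_fin_three.mpr ⟨fun y hy => range_pair (u := u) (v := v) ▸ hint₀ y hy,
      fun y hy => range_pair (u := u) (v := v) ▸ hint₁ y hy,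
      fun y hy => range_pair (u := u) (v := v) ▸ hint₂ y hy⟩)
    (forall_fin_three.mpr ⟨forall_fin_three.mpr ⟨fun h => absurd rfl h, fun _ => h01, fun _ => h02⟩,
      forall_fin_three.mpr ⟨fun _ => h01.symm, fun h => absurd rfl h, fun _ => h12⟩,
      forall_fin_three.mpr ⟨fun _ => h02.symm, fun _ => h12.symm, fun h => absurd rfl h⟩⟩)
    (unbranched_range hunb) ncard_compl_dilated_typeII
    fun i hi => by
      rcases hi with rfl | rfl
      · exact ⟨rfl, id, (1 : Fin 3), (by decide : (1 : Fin 3) ≠ 0)⟩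
      · exact ⟨rfl, id, (1 : Fin 3), (by decide : (1 : Fin 3) ≠ 2)⟩

/-- A circuit contains no three edge-disjoint chains with the same distinct ends. -/
theorem false_of_three_chains (hC : p.signing.IsCircuit F) (huv : u ≠ v)
    {l : Fin 3 → List H} (hl : ∀ i, G.IsChain u (l i) v) (hne : ∀ i, l i ≠ [])
    (hF : ∀ i, G.chainSet (l i) ⊆ F)
    (hd : ∀ i j, i ≠ j → Disjoint (G.chainSet (l i)) (G.chainSet (l j))) : False := by
  obtain ⟨i, j, -, hnf⟩ := Signing.not_flowFree_of_three_chains p.signing huv hl hd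
  have heq := hC.eq_of_subset (Set.union_subset (hF i) (hF j)) hnf
  obtain ⟨k, hki, hkj⟩ := (by decide : ∀ i j : Fin 3, ∃ k, k ≠ i ∧ k ≠ j) i j
  obtain ⟨e, he⟩ := chainSet_nonempty (G := G) (hne k)
  rcases heq.symm.subset (hF k he) with h | h
  · exact Set.disjoint_left.mp (hd k i hki) he h
  · exact Set.disjoint_left.mp (hd k j hkj) he h

/-- Two vertices of degree three are joined either as a dumbbell, which is type II, or as a theta
graph, which `false_of_three_chains` excludes. -/
theorem typeII_of_excess (hC : p.signing.IsCircuit F) (huv : u ≠ v) (hu : u ∉ p.signing.ground)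
    (hv : v ∉ p.signing.ground) (hdu : G.degree F u = 3) (hdv : G.degree F v = 3)
    (hunb : ∀ w, w ≠ u → w ≠ v → p.Unbranched F w) : p.HasType F CoverDiagram.typeII := by
  have huX : u ∈ ({u, v} : Set V) := Or.inl rfl
  have hvX : v ∈ ({u, v} : Set V) := Or.inr rfl
  obtain ⟨l₀, w₀, hw₀, hl₀, hF₀, hint₀, hd₀, hX₁⟩ := exists_isArc_sdiff
    (degree_of_unbranched hunb) huX (by omega)
  have h0u := hd₀ u huX
  have h0v := hd₀ v hvX
  rw [if_pos rfl, hdu] at h0u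
  rw [if_neg huv, hdv] at h0v
  have hu1 : 0 < G.degree (F \ G.chainSet l₀) u := by
    split_ifs at h0u <;> omega
  obtain ⟨l₁, w₁, hw₁, hl₁, hF₁, hint₁, hd₁, hX₂⟩ := exists_isArc_sdiff hX₁ huX hu1
  have h1u := hd₁ u huX
  have h1v := hd₁ v hvX
  rw [if_pos rfl] at h1u
  rw [if_neg huv] at h1v
  have d01 : Disjoint (G.chainSet l₀) (G.chainSet l₁) :=
    Set.disjoint_left.mpr fun e h h' => (hF₁ h').2 h
  have hF₁' := hF₁.trans Set.sdiff_subset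
  have hcase : ∀ {x : V}, x ∈ ({u, v} : Set V) → x = u ∨ x = v := fun h => h
  rcases hcase hw₀ with e₀ | e₀ <;> rcases hcase hw₁ with e₁ | e₁ <;>
    rw [e₀] at hl₀ h0u h0v <;> rw [e₁] at hl₁ h1u h1v
  -- Two loops at u would use four half-edges.
  · rw [if_pos rfl] at h0u h1u
    omega
  -- The first arc is a loop at u and the second joins u to v; the two half-edges left at v bound
  -- the second loop.
  · rw [if_pos rfl] at h0u h1v
    rw [if_neg huv.symm] at h1u
    rw [if_neg huv] at h0v
    obtain ⟨l₂, w₂, hw₂, hl₂, hF₂, hint₂, hd₂, -⟩ := exists_isArc_sdiff hX₂ hvX (by omega)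
    have d02 : Disjoint (G.chainSet l₀) (G.chainSet l₂) :=
      Set.disjoint_left.mpr fun e h h' => (hF₂ h').1.2 h
    have d12 : Disjoint (G.chainSet l₁) (G.chainSet l₂) :=
      Set.disjoint_left.mpr fun e h h' => (hF₂ h').2 h
    have hF₂' := (hF₂.trans Set.sdiff_subset).trans Set.sdiff_subset
    rcases hcase hw₂ with e₂ | e₂
    · have h2u := hd₂ u huX
      rw [e₂, if_pos rfl] at h2u
      omega
    · rw [e₂] at hl₂
      exact typeII_of_arcs hC huv hu hv hunb hl₀ hl₁ hl₂ hF₀ hF₁' hF₂' hint₀ hint₁ hint₂ d01 d02 d12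
  -- The same dumbbell with the joining arc found before the loop at u.
  · rw [if_pos rfl] at h0v h1u
    rw [if_neg huv.symm] at h0u
    rw [if_neg huv] at h1v
    obtain ⟨l₂, w₂, hw₂, hl₂, hF₂, hint₂, hd₂, -⟩ := exists_isArc_sdiff hX₂ hvX (by omega)
    have d02 : Disjoint (G.chainSet l₀) (G.chainSet l₂) :=
      Set.disjoint_left.mpr fun e h h' => (hF₂ h').1.2 h
    have d12 : Disjoint (G.chainSet l₁) (G.chainSet l₂) :=
      Set.disjoint_left.mpr fun e h h' => (hF₂ h').2 h
    have hF₂' := (hF₂.trans Set.sdiff_subset).trans Set.sdiff_subset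
    rcases hcase hw₂ with e₂ | e₂
    · have h2u := hd₂ u huX
      rw [e₂, if_pos rfl] at h2u
      omega
    · rw [e₂] at hl₂
      exact typeII_of_arcs hC huv hu hv hunb hl₁ hl₀ hl₂ hF₁' hF₀ hF₂' hint₁ hint₀ hint₂ d01.symm
        d12 d02
  -- Both arcs end at v, and the one half-edge left at u starts a third arc to v: the theta graph.
  · rw [if_neg huv.symm] at h0u h1u
    obtain ⟨l₂, w₂, hw₂, hl₂, hF₂, hint₂, hd₂, -⟩ := exists_isArc_sdiff hX₂ huX (by omega)
    have d02 : Disjoint (G.chainSet l₀) (G.chainSet l₂) :=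
      Set.disjoint_left.mpr fun e h h' => (hF₂ h').1.2 h
    have d12 : Disjoint (G.chainSet l₁) (G.chainSet l₂) :=
      Set.disjoint_left.mpr fun e h h' => (hF₂ h').2 h
    have hF₂' := (hF₂.trans Set.sdiff_subset).trans Set.sdiff_subset
    have h2u := hd₂ u huX
    rw [if_pos rfl] at h2u
    rcases hcase hw₂ with e₂ | e₂
    · rw [if_pos e₂] at h2u
      omega
    · rw [e₂] at hl₂
      refine (false_of_three_chains hC huv (l := ![l₀, l₁, l₂])
        (forall_fin_three.mpr ⟨hl₀.chain, hl₁.chain, hl₂.chain⟩)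
        (forall_fin_three.mpr ⟨hl₀.ne_nil, hl₁.ne_nil, hl₂.ne_nil⟩)
        (forall_fin_three.mpr ⟨hF₀, hF₁', hF₂'⟩)
        (forall_fin_three.mpr
          ⟨forall_fin_three.mpr ⟨fun h => absurd rfl h, fun _ => d01, fun _ => d02⟩,
          forall_fin_three.mpr ⟨fun _ => d01.symm, fun h => absurd rfl h, fun _ => d12⟩,
          forall_fin_three.mpr ⟨fun _ => d02.symm, fun _ => d12.symm, fun h => absurd rfl h⟩⟩)).elim

end TwoBranchings

theorem hasType_of_isCircuit (hC : p.signing.IsCircuit F)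
    (hn : ¬ p.TrivialFreeOver (G.generatedBy F)) :
    p.HasType F CoverDiagram.typeII ∨ p.HasType F CoverDiagram.typeIII ∨
      p.HasType F CoverDiagram.typeIV ∨ p.HasType F CoverDiagram.typeV ∨
      p.HasType F CoverDiagram.typeVI := by
  rcases p.excess_of_isCircuit hC hn with ⟨v, ⟨h1, h2⟩ | ⟨h1, h2⟩, hunb⟩ |
    ⟨u, v, huv, ⟨h1, h2⟩ | ⟨h1, h2⟩, ⟨h3, h4⟩ | ⟨h3, h4⟩, hunb⟩
  · exact Or.inr (Or.inr (Or.inr (Or.inl (p.typeV_of_excess hC h1 h2 hunb))))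
  · exact Or.inr (Or.inl (p.typeIII_of_excess hC h1 h2 hunb))
  · exact Or.inr (Or.inr (Or.inr (Or.inr (typeVI_of_excess hC huv h1 h3 h2 hunb))))
  · exact Or.inr (Or.inr (Or.inl (typeIV_of_excess hC huv h1 h3 h2 h4 hunb)))
  · exact Or.inr (Or.inr (Or.inl (typeIV_of_excess hC huv.symm h3 h1 h4 h2
      fun w hw hw' => hunb w hw' hw)))
  · exact Or.inl (typeII_of_excess hC huv h1 h3 h2 h4 hunb)

end DoubleCover

/-- Bases, independent sets and circuits of the signed graphic matroid of a double cover. -/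
theorem proposition3p8 {V' H' V H : Type*} [Fintype V'] [Fintype H'] [Fintype V] [Fintype H]
    {G' : HalfEdgeGraph V' H'} {G : HalfEdgeGraph V H} (p : DoubleCover G' G)
    (hG : G.whole.Connected) (hp : p.Nontrivial)
    (F : Set G.Edge) (hF : F ⊆ p.undilatedEdges) :
    ((p.signedGraphicMatroid hG hp).IsBase F ↔
      (∀ v, ¬ p.DilatedVert v → v ∈ (G.generatedBy F).verts) ∧
        ∀ C, (G.generatedBy F).IsComponent C → p.ElementaryOver C) ∧
    ((p.signedGraphicMatroid hG hp).Indep F ↔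
      Function.Injective (p.homologyMap (G.generatedBy F))) ∧
    ((p.signedGraphicMatroid hG hp).IsCircuit F ↔
      (G.generatedBy F).Connected ∧
        (∀ v ∈ (G.generatedBy F).verts, ¬ p.DilatedVert v → (G.generatedBy F).valency v ≠ 1) ∧
        (((G.generatedBy F).genus = 1 ∧ p.TrivialFreeOver (G.generatedBy F)) ∨
          p.HasType F CoverDiagram.typeII ∨ p.HasType F CoverDiagram.typeIII ∨
          p.HasType F CoverDiagram.typeIV ∨ p.HasType F CoverDiagram.typeV ∨
          p.HasType F CoverDiagram.typeVI)) := by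
  refine ⟨?_, ?_, ?_⟩
  · rw [p.isBase_iff hG hp hF]
    exact p.rigid_flowFree_iff hF
  · rw [p.indep_iff hG hp hF]
    exact (p.homologyMap_injective_iff hF).symm
  · rw [p.isCircuit_iff hG hp hF]
    constructor
    · intro hC
      -- The valency in G[F] is by definition the degree of F.
      refine ⟨hC.connected, fun v _ hv => hC.degree_ne_one hv, ?_⟩
      by_cases ht : p.TrivialFreeOver (G.generatedBy F)
      · exact Or.inl ⟨p.genus_of_isCircuit hC ht, ht⟩
      · exact Or.inr (p.hasType_of_isCircuit hC ht)
    · rintro ⟨hconn, hval, ⟨hg, ht⟩ | h | h | h | h | h⟩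
      · exact p.isCircuit_of_trivialFreeOver hconn hval hg ht
      · exact p.isCircuit_of_typeII h
      · exact p.isCircuit_of_typeIII h
      · exact p.isCircuit_of_typeIV h
      · exact p.isCircuit_of_typeV h
      · exact p.isCircuit_of_typeVI h
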